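/- **Setting.** Two plates with midsurfaces $S$ and $\tilde S$ (quantities of the second plate carry a tilde) are coupled along a segment $\Gamma$ of length $2\ell>0$, a common edge, at an angle $0<\theta<\pi$. Each midsurface is a bounded, connected, open polygonal domain (not necessarily convex or simply connected; no cracks, and at every vertex exactly two edges meet; consecutive edges may be collinear), described in its own planar coordinates, whose origin is the midpoint of $\Gamma$ and whose axes are the outer unit normal $n$ and the unit tangent $t$ of $\Gamma$, where $(n,t)$ is positively oriented; thus $\Gamma=\{0\}\times[-\ell,\ell]$ in both coordinate systems, and $(0,y)\in\Gamma$ in the coordinates of $S$ is $(0,-y)$ in those of $\tilde S$. (In space, with $l=n\times t$, one has $\tilde n=n\cos\theta-l\sin\theta$, $\tilde t=-t$, $\tilde l=-n\sin\theta-l\cos\theta$.) On every edge, $n$ is the outer unit normal and $t$ the unit tangent with $(n,t)$ positively oriented. The clamped part $\partial S_0$ is a union of edges of $S$ other than $\Gamma$, and neither of the two edges of $S$ adjacent to $\Gamma$ is clamped. $\partial S_1$ is the union of the remaining edges of $S$ other than $\Gamma$, and $\partial\tilde S_1$ the union of all edges of $\tilde S$ other than $\Gamma$. **Spaces.** Let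 $\mathbb S$ be the symmetric real $2\times2$ matrices, $\nabla^s v=\frac12(\nabla v+\nabla v^T)$, and $\operatorname{Div}$ the row-wise divergence. Let $V=L^2(S;\mathbb R^2)\times L^2(S)\times L^2(\tilde S;\mathbb R^2)\times L^2(\tilde S)$ and $V_{\mathrm s}=L^2(S;\mathbb S)^2\times L^2(\tilde S;\mathbb S)^2$, with the $L^2$ inner products. Let $W$ be the set of all $\psi=(v,v_3;\tilde v,\tilde v_3)$ with $v\in H^1(S;\mathbb R^2)$, $v_3\in H^2(S)$, $\tilde v\in H^1(\tilde S;\mathbb R^2)$, $\tilde v_3\in H^2(\tilde S)$ that satisfy, in the sense of traces, $v=0$, $v_3=0$, $\partial_nv_3=0$ on $\partial S_0$ and $$\partial_nv_3=-\partial_{\tilde n}\tilde v_3,\quad v_1=\tilde v_1\cos\theta-\tilde v_3\sin\theta,\quad v_2=-\tilde v_2,\quad v_3=-\tilde v_1\sin\theta-\tilde v_3\cos\theta\quad\text{on }\Gamma .$$ Let $B\psi=(-\nabla^sv,\nabla^2v_3;-\tilde\nabla^s\tilde v,\tilde\nabla^2\tilde v_3)$ for $\psi\in W$, and let $\Sigma=D(B^*)$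 be the domain of its adjoint: $\Phi\in\Sigma$ if and only if $\Phi\in V_{\mathrm s}$ and there is $G\in V$ with $(B\psi,\Phi)_{V_{\mathrm s}}=(G,\psi)_V$ for all $\psi\in W$. Let $H_{\mathrm s}$ be the set of all $(N,M;\tilde N,\tilde M)\in V_{\mathrm s}$ for which the distributions $\operatorname{Div}N$, $\operatorname{div}\operatorname{Div}M$, $\operatorname{Div}\tilde N$, $\operatorname{div}\operatorname{Div}\tilde M$ are square integrable. On an edge put $A_{nn}=(An)\cdot n$, $A_{nt}=(An)\cdot t$ and $T=(\operatorname{Div}M)\cdot n+\partial_t\big((Mn)\cdot t\big)$. At a vertex $x$, $\llbracket M_{nt}\rrbracket_x$ is the value at $x$ of $M_{nt}$ taken from the edge that arrives at $x$ (in the direction of $t$) minus the value taken from the edge that leaves $x$. The same notation, with tildes, is used for $\tilde S$. **Theorem.** Let $\Phi=(N,M;\tilde N,\tilde M)\in V_{\mathrm s}$ with $N\in C^0(\bar S;\mathbb S)$, $M\in C^1(\bar S;\mathbb S)$, $\tilde N\in C^0(\bar{\tilde S};\mathbb S)$, $\tilde M\in C^1(\bar{\tilde S};\mathbb S)$. Then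 $\Phi\in\Sigma$ if and only if $\Phi\in H_{\mathrm s}$ and $\Phi$ satisfies all of the following. 1. Free boundary conditions: $Nn=0$, $T=0$, $M_{nn}=0$ on (the relative interior of each edge of) $\partial S_1$, and $\llbracket M_{nt}\rrbracket_x=0$ at every vertex $x$ at which two edges of $\partial S_1$ meet at an angle different from $\pi$; and $\tilde N\tilde n=0$, $\tilde T=0$, $\tilde M_{\tilde n\tilde n}=0$ on $\partial\tilde S_1$, and $\llbracket\tilde M_{\tilde n\tilde t}\rrbracket_x=0$ at every vertex $x$ at which two edges of $\partial\tilde S_1$ meet at an angle different from $\pi$. 2. Junction conditions on (the relative interior of) $\Gamma$: $\tilde M_{\tilde n\tilde n}=M_{nn}$, $\ \tilde N_{\tilde n\tilde n}=-N_{nn}\cos\theta+T\sin\theta$, $\ \tilde N_{\tilde n\tilde t}=N_{nt}$, $\ \tilde T=N_{nn}\sin\theta+T\cos\theta$. 3. Corner conditions at both end points $x$ of $\Gamma$: $\llbracket M_{nt}\rrbracket_x\sin\theta=0$ and $\llbracket\tilde M_{\tilde n\tilde t}\rrbracket_x-\llbracket M_{nt}\rrbracket_x\cos\theta=0$. -/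

import Mathlib

open MeasureTheory Filter Topology
open scoped ContDiff

noncomputable section

namespace Plates

/-- The Euclidean plane; each plate is described in its own planar coordinates. -/
abbrev Plane := EuclideanSpace ℝ (Fin 2)

/-- Square matrices of size two (stress and moment tensors are symmetric-matrix valued). -/
abbrev Mat := Matrix (Fin 2) (Fin 2) ℝ

/-- The coordinate unit vector `e j`. -/
def e (j : Fin 2) : Plane := EuclideanSpace.single j 1

/-! ### Polygonal domains -/

/-- Unit tangent of the oriented edge from `a` to `b`. -/
def edgeTangent (a b : Plane) : Plane := ‖b - a‖⁻¹ • (b - a)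

/-- Unit normal of the oriented edge from `a` to `b`: the tangent turned clockwise by a right
angle, so that `(normal, tangent)` is positively oriented. -/
def edgeNormal (a b : Plane) : Plane := !₂[edgeTangent a b 1, -(edgeTangent a b 0)]

/-- A bounded polygonal domain, not necessarily convex, possibly with holes. The edges are the
segments from `vert i` to `vert (next i)`; each of them has the domain on its left, so that
`edgeNormal` is the outer unit normal. The boundary is a disjoint union of simple closed polygons.
Two consecutive edges are allowed to be collinear, so that any finite subdivision of the
boundary into segments can be used. -/
structure PolygonalDomain where
  carrier : Set Plane
  isOpen : IsOpen carrier
  isConnected : IsConnected carrier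
  isBounded : Bornology.IsBounded carrier
  numEdges : ℕ
  vert : Fin numEdges → Plane
  next : Equiv.Perm (Fin numEdges)
  vert_injective : Function.Injective vert
  vert_next_ne : ∀ i, vert (next i) ≠ vert i
  frontier_eq : frontier carrier = ⋃ i, segment ℝ (vert i) (vert (next i))
  /-- Two different edges meet at most at common end points. -/
  edges_disjoint : ∀ i j, i ≠ j →
    Disjoint (openSegment ℝ (vert i) (vert (next i))) (segment ℝ (vert j) (vert (next j)))
  /-- Near a relatively interior point of an edge, the domain is the half plane to the left. -/
  locally_left : ∀ i, ∀ x ∈ openSegment ℝ (vert i) (vert (next i)), ∀ᶠ y in 𝓝 x,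
    (y ∈ carrier ↔ inner ℝ (y - vert i) (edgeNormal (vert i) (vert (next i))) < 0)

namespace PolygonalDomain

variable (S : PolygonalDomain)

/-- Unit tangent of the edge `i`. -/
def tangent (i : Fin S.numEdges) : Plane := edgeTangent (S.vert i) (S.vert (S.next i))

/-- Outer unit normal of the edge `i`. -/
def normal (i : Fin S.numEdges) : Plane := edgeNormal (S.vert i) (S.vert (S.next i))

/-- The edge that ends where the edge `i` starts. -/
def prev (i : Fin S.numEdges) : Fin S.numEdges := S.next.symm i

/-- Parametrization of the edge `i` by `[0, 1]`. -/
def edgePt (i : Fin S.numEdges) (s : ℝ) : Plane :=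
  AffineMap.lineMap (S.vert i) (S.vert (S.next i)) s

/-- Lebesgue measure restricted to the domain. -/
def μ : Measure Plane := volume.restrict S.carrier

/-- Square integrability of a scalar function on the domain. -/
def IsL2 (f : Plane → ℝ) : Prop := MemLp f 2 S.μ

/-- Smooth functions with compact support in the domain. -/
def IsTest (φ : Plane → ℝ) : Prop :=
  ContDiff ℝ ∞ φ ∧ HasCompactSupport φ ∧ tsupport φ ⊆ S.carrier

end PolygonalDomain

/-- The classical partial derivative in the direction of the `j`-th coordinate. -/
def pd (j : Fin 2) (f : Plane → ℝ) (x : Plane) : ℝ := fderiv ℝ f x (e j)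

/-! ### Sobolev functions and traces -/

/-- `g` is the weak `j`-th partial derivative of `f` in the domain. -/
def IsWeakDeriv (S : PolygonalDomain) (j : Fin 2) (f g : Plane → ℝ) : Prop :=
  ∀ φ, S.IsTest φ → ∫ x, f x * pd j φ x ∂S.μ = -∫ x, g x * φ x ∂S.μ

/-- A function in `H¹(S)`, together with (a representative of) its weak gradient. -/
structure H1Fun (S : PolygonalDomain) where
  val : Plane → ℝ
  grad : Fin 2 → Plane → ℝ
  val_mem : S.IsL2 val
  grad_mem : ∀ j, S.IsL2 (grad j)
  weak : ∀ j, IsWeakDeriv S j val (grad j)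

/-- A function in `H²(S)`, together with (representatives of) its weak gradient and
its weak Hessian; `hess i j` is the `j`-th weak derivative of `grad i`. -/
structure H2Fun (S : PolygonalDomain) extends H1Fun S where
  hess : Fin 2 → Fin 2 → Plane → ℝ
  hess_mem : ∀ i j, S.IsL2 (hess i j)
  weak_hess : ∀ i j, IsWeakDeriv S j (grad i) (hess i j)

/-- The weak partial derivative of an `H²` function, as an `H¹` function. -/
def H2Fun.partialH1 {S : PolygonalDomain} (w : H2Fun S) (i : Fin 2) : H1Fun S where
  val := w.grad i
  grad := w.hess i
  val_mem := w.grad_mem i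
  grad_mem := w.hess_mem i
  weak := w.weak_hess i

/-- `g ∈ L²(0, 1)` is the trace of `u ∈ H¹(S)` on the edge `i`, the edge being parametrized by
`[0, 1]`: some functions that are smooth up to the boundary converge to `u` in `H¹(S)` and their
restrictions to the edge converge to `g` in `L²`. -/
def HasTrace {S : PolygonalDomain} (u : H1Fun S) (i : Fin S.numEdges) (g : ℝ → ℝ) : Prop :=
  MemLp g 2 (volume.restrict (Set.Icc 0 1)) ∧
  ∃ φ : ℕ → Plane → ℝ, (∀ k, ContDiff ℝ ∞ (φ k)) ∧
    Tendsto (fun k => eLpNorm (fun x => φ k x - u.val x) 2 S.μ) atTop (𝓝 0) ∧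
    (∀ j, Tendsto (fun k => eLpNorm (fun x => pd j (φ k) x - u.grad j x) 2 S.μ) atTop (𝓝 0)) ∧
    Tendsto (fun k => eLpNorm (fun s => φ k (S.edgePt i s) - g s) 2
      (volume.restrict (Set.Icc 0 1))) atTop (𝓝 0)

/-- `g` is the trace of the normal derivative `∂ₙ w = ∑ j, nⱼ ∂ⱼ w` on the edge `i`. -/
def HasNormalTrace {S : PolygonalDomain} (w : H2Fun S) (i : Fin S.numEdges) (g : ℝ → ℝ) : Prop :=
  ∃ d : Fin 2 → ℝ → ℝ, (∀ j, HasTrace (w.partialH1 j) i (d j)) ∧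
    g = fun s => ∑ j, S.normal i j * d j s

/-! ### Fields on a single plate -/

/-- A displacement field of one plate in `H¹(S; ℝ²) × H²(S)`: in-plane part `v` and
deflection `w` (the third component). -/
structure PlateDisp (S : PolygonalDomain) where
  v : Fin 2 → H1Fun S
  w : H2Fun S

/-- A field in `L²(S; ℝ²) × L²(S)`. -/
structure PlateL2 (S : PolygonalDomain) where
  f : Fin 2 → Plane → ℝ
  f₃ : Plane → ℝ
  f_mem : ∀ i, S.IsL2 (f i)
  f₃_mem : S.IsL2 f₃

/-- A pair (stress tensor `N`, moment tensor `M`) of matrix fields on one plate. -/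
structure PlateStress where
  N : Plane → Mat
  M : Plane → Mat

/-- The symmetric gradient `(∇v + (∇v)ᵀ) / 2`. -/
def symGrad {S : PolygonalDomain} (v : Fin 2 → H1Fun S) (x : Plane) (i j : Fin 2) : ℝ :=
  ((v i).grad j x + (v j).grad i x) / 2

namespace PolygonalDomain

variable (S : PolygonalDomain)

/-- A matrix field in `L²(S; 𝕊)`. -/
def MemL2Sym (A : Plane → Mat) : Prop :=
  (∀ i j, S.IsL2 fun x => A x i j) ∧ ∀ᵐ x ∂S.μ, (A x).IsSymm

/-- The row-wise distributional divergence `Div A` is square integrable. -/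
def DivMemL2 (A : Plane → Mat) : Prop :=
  ∃ g : Fin 2 → Plane → ℝ, (∀ i, S.IsL2 (g i)) ∧ ∀ i, ∀ φ, S.IsTest φ →
    ∫ x, ∑ j, A x i j * pd j φ x ∂S.μ = -∫ x, g i x * φ x ∂S.μ

/-- The distribution `div Div A` is square integrable. -/
def DivDivMemL2 (A : Plane → Mat) : Prop :=
  ∃ g : Plane → ℝ, S.IsL2 g ∧ ∀ φ, S.IsTest φ →
    ∫ x, ∑ i, ∑ j, A x i j * pd i (pd j φ) x ∂S.μ = ∫ x, g x * φ x ∂S.μ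

/-- `(N, M) ∈ L²(S; 𝕊) × L²(S; 𝕊)`. -/
def StressL2 (Φ : PlateStress) : Prop := S.MemL2Sym Φ.N ∧ S.MemL2Sym Φ.M

/-- `(N, M) ∈ H(Div, S; 𝕊) × H(divDiv, S; 𝕊)`. -/
def StressHs (Φ : PlateStress) : Prop :=
  S.StressL2 Φ ∧ S.DivMemL2 Φ.N ∧ S.DivDivMemL2 Φ.M

/-- `(N, M)` belongs to `C⁰(S̄; 𝕊) × C¹(S̄; 𝕊)`. -/
def StressCs (Φ : PlateStress) : Prop :=
  (∀ i j, ContinuousOn (fun x => Φ.N x i j) (closure S.carrier)) ∧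
  (∀ i j, ContDiffOn ℝ 1 (fun x => Φ.M x i j) (closure S.carrier)) ∧
  ∀ x ∈ closure S.carrier, (Φ.N x).IsSymm ∧ (Φ.M x).IsSymm

/-- `- ∫ N : ∇ˢ v + ∫ M : ∇² w`, the contribution of one plate to the pairing with `B`. -/
def pairB (ψ : PlateDisp S) (Φ : PlateStress) : ℝ :=
  -(∫ x, ∑ i, ∑ j, symGrad ψ.v x i j * Φ.N x i j ∂S.μ) +
    ∫ x, ∑ i, ∑ j, ψ.w.hess i j x * Φ.M x i j ∂S.μ

/-- `∫ f · v + ∫ f₃ w`, the contribution of one plate to the inner product of `V`. -/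
def pairV (G : PlateL2 S) (ψ : PlateDisp S) : ℝ :=
  (∫ x, ∑ i, G.f i x * (ψ.v i).val x ∂S.μ) + ∫ x, G.f₃ x * ψ.w.val x ∂S.μ

/-- Clamping on the edge `i`: `v = 0`, `w = 0` and `∂ₙ w = 0` in the sense of traces. -/
def ClampedOn (ψ : PlateDisp S) (i : Fin S.numEdges) : Prop :=
  (∀ k, HasTrace (ψ.v k) i 0) ∧ HasTrace ψ.w.toH1Fun i 0 ∧
  ∃ g, HasNormalTrace ψ.w i g ∧ ∀ᵐ s ∂volume.restrict (Set.Icc (0 : ℝ) 1), g s = 0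

/-- The vector `A n` on the edge `i`. -/
def conormal (A : Plane → Mat) (i : Fin S.numEdges) (x : Plane) : Fin 2 → ℝ :=
  Matrix.mulVec (A x) fun k => S.normal i k

/-- The component `(A n) · n` on the edge `i`. -/
def nn (A : Plane → Mat) (i : Fin S.numEdges) (x : Plane) : ℝ :=
  ∑ k, S.conormal A i x k * S.normal i k

/-- The component `(A n) · t` on the edge `i`. -/
def nt (A : Plane → Mat) (i : Fin S.numEdges) (x : Plane) : ℝ :=
  ∑ k, S.conormal A i x k * S.tangent i k

/-- The Kirchhoff shear force `T = (Div M) · n + ∂ₜ((M n) · t)` on the edge `i`. Derivatives at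
points of the closed domain are taken within the closed domain, that is, they are the continuous
extensions of the derivatives inside. -/
def shear (M : Plane → Mat) (i : Fin S.numEdges) (x : Plane) : ℝ :=
  (∑ k, (∑ j, fderivWithin ℝ (fun y => M y k j) (closure S.carrier) x (e j)) * S.normal i k) +
    fderivWithin ℝ (S.nt M i) (closure S.carrier) x (S.tangent i)

/-- The jump of `(M n) · t` at the vertex `vert i`: the value from the edge that arrives there
minus the value from the edge that leaves. -/
def jumpNt (M : Plane → Mat) (i : Fin S.numEdges) : ℝ :=
  S.nt M (S.prev i) (S.vert i) - S.nt M i (S.vert i)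

/-- The conditions of a free boundary on the set `F` of edges: `N n = 0`, `T = 0`, `Mₙₙ = 0` on
each edge of `F`, and `⟦Mₙₜ⟧ = 0` at each vertex at which two edges of `F` meet at an angle
different from `π`. -/
def FreeBoundary (F : Set (Fin S.numEdges)) (Φ : PlateStress) : Prop :=
  (∀ i ∈ F, ∀ s ∈ Set.Ioo (0 : ℝ) 1,
    S.conormal Φ.N i (S.edgePt i s) = 0 ∧ S.shear Φ.M i (S.edgePt i s) = 0 ∧
      S.nn Φ.M i (S.edgePt i s) = 0) ∧
  ∀ i, i ∈ F → S.prev i ∈ F → S.tangent (S.prev i) ≠ S.tangent i → S.jumpNt Φ.M i = 0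

end PolygonalDomain

/-! ### Two coupled plates -/

/-- Two plates that are coupled along a rectilinear junction `Γ` of length `2 ℓ` at the angle `θ`.
Each midsurface is described in the local coordinates of the junction: the origin is the midpoint
of `Γ`, the first axis is the outer normal `n` and the second one the tangent `t` of `Γ`. In space,
the frames `(n, t, l)` of `S` and `(n', t', l')` of `S'`, with `l = n × t` and `l' = n' × t'`, are
related by `n' = cos θ n - sin θ l`, `t' = -t`, `l' = - sin θ n - cos θ l`. The point `(0, y)` of
`Γ` in the coordinates of `S` is therefore the point `(0, -y)` in the coordinates of `S'`. -/
structure CoupledPlates where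
  S : PolygonalDomain
  S' : PolygonalDomain
  θ : ℝ
  θ_pos : 0 < θ
  θ_lt_pi : θ < Real.pi
  ℓ : ℝ
  ℓ_pos : 0 < ℓ
  /-- The edge of `S` that is the junction. -/
  Γ : Fin S.numEdges
  /-- The edge of `S'` that is the junction. -/
  Γ' : Fin S'.numEdges
  Γ_start : S.vert Γ = !₂[0, -ℓ]
  Γ_end : S.vert (S.next Γ) = !₂[0, ℓ]
  Γ'_start : S'.vert Γ' = !₂[0, -ℓ]
  Γ'_end : S'.vert (S'.next Γ') = !₂[0, ℓ]
  /-- The edges of `S` that form the clamped part of the boundary. -/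
  clamped : Set (Fin S.numEdges)
  Γ_not_clamped : Γ ∉ clamped
  /-- The two edges next to the junction are not clamped: the end points of `Γ` are at a positive
  distance from the clamped part. -/
  next_not_clamped : S.next Γ ∉ clamped
  prev_not_clamped : S.prev Γ ∉ clamped

namespace CoupledPlates

variable (P : CoupledPlates)

/-- The free edges of `S`: neither clamped nor the junction. -/
def free : Set (Fin P.S.numEdges) := {i | i ∉ P.clamped ∧ i ≠ P.Γ}

/-- The free edges of `S'`: all edges but the junction. -/
def free' : Set (Fin P.S'.numEdges) := {i | i ≠ P.Γ'}

/-- The space `W` of admissible displacements: `ψ` vanishes together with the normal derivative of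
the deflection on the clamped part of `∂S` and satisfies on `Γ` the kinematic conditions
`∂ₙ w = -∂ₙ' w'`, `v₁ = v₁' cos θ - w' sin θ`, `v₂ = -v₂'`, `w = -v₁' sin θ - w' cos θ`.
The parameter `s` on the edge `Γ` of `S` is the parameter `1 - s` on the edge `Γ'` of `S'`. -/
def MemW (ψ : PlateDisp P.S × PlateDisp P.S') : Prop :=
  (∀ i ∈ P.clamped, P.S.ClampedOn ψ.1 i) ∧
  ∃ (v : Fin 2 → ℝ → ℝ) (w d : ℝ → ℝ) (v' : Fin 2 → ℝ → ℝ) (w' d' : ℝ → ℝ),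
    (∀ k, HasTrace (ψ.1.v k) P.Γ (v k)) ∧ HasTrace ψ.1.w.toH1Fun P.Γ w ∧
    HasNormalTrace ψ.1.w P.Γ d ∧
    (∀ k, HasTrace (ψ.2.v k) P.Γ' (v' k)) ∧ HasTrace ψ.2.w.toH1Fun P.Γ' w' ∧
    HasNormalTrace ψ.2.w P.Γ' d' ∧
    ∀ᵐ s ∂volume.restrict (Set.Icc (0 : ℝ) 1),
      d s = -d' (1 - s) ∧
      v 0 s = v' 0 (1 - s) * Real.cos P.θ - w' (1 - s) * Real.sin P.θ ∧
      v 1 s = -v' 1 (1 - s) ∧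
      w s = -(v' 0 (1 - s)) * Real.sin P.θ - w' (1 - s) * Real.cos P.θ

/-- The space of square integrable symmetric `(N, M; N', M')`. -/
def MemVs (Φ : PlateStress × PlateStress) : Prop := P.S.StressL2 Φ.1 ∧ P.S'.StressL2 Φ.2

/-- The space `Hₛ`. -/
def MemHs (Φ : PlateStress × PlateStress) : Prop := P.S.StressHs Φ.1 ∧ P.S'.StressHs Φ.2

/-- The space `Cₛ`. -/
def MemCs (Φ : PlateStress × PlateStress) : Prop := P.S.StressCs Φ.1 ∧ P.S'.StressCs Φ.2

/-- The space `Σ = D(B*)`, the domain of the adjoint of `B = (-∇ˢ, ∇²; -∇ˢ, ∇²)`, which is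
regarded as an operator in the `L²` spaces with domain `W`: those square integrable `Φ` for
which there is a square integrable `G` with `(B ψ, Φ) = (G, ψ)` for all `ψ ∈ W`. -/
def MemSigma (Φ : PlateStress × PlateStress) : Prop :=
  P.MemVs Φ ∧ ∃ G : PlateL2 P.S × PlateL2 P.S', ∀ ψ : PlateDisp P.S × PlateDisp P.S', P.MemW ψ →
    P.S.pairB ψ.1 Φ.1 + P.S'.pairB ψ.2 Φ.2 = P.S.pairV G.1 ψ.1 + P.S'.pairV G.2 ψ.2

/-- The free boundary conditions on both plates. -/
def FreeBoundaryConditions (Φ : PlateStress × PlateStress) : Prop :=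
  P.S.FreeBoundary P.free Φ.1 ∧ P.S'.FreeBoundary P.free' Φ.2

/-- The junction conditions at all points of `Γ`:
`M'ₙₙ = Mₙₙ`, `N'ₙₙ = -Nₙₙ cos θ + T sin θ`, `N'ₙₜ = Nₙₜ`, `T' = Nₙₙ sin θ + T cos θ`. -/
def JunctionConditions (Φ : PlateStress × PlateStress) : Prop :=
  ∀ s ∈ Set.Ioo (0 : ℝ) 1,
    let x := P.S.edgePt P.Γ s
    let x' := P.S'.edgePt P.Γ' (1 - s)
    P.S'.nn Φ.2.M P.Γ' x' = P.S.nn Φ.1.M P.Γ x ∧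
    P.S'.nn Φ.2.N P.Γ' x' =
      -(P.S.nn Φ.1.N P.Γ x) * Real.cos P.θ + P.S.shear Φ.1.M P.Γ x * Real.sin P.θ ∧
    P.S'.nt Φ.2.N P.Γ' x' = P.S.nt Φ.1.N P.Γ x ∧
    P.S'.shear Φ.2.M P.Γ' x' =
      P.S.nn Φ.1.N P.Γ x * Real.sin P.θ + P.S.shear Φ.1.M P.Γ x * Real.cos P.θ

/-- The corner conditions `⟦Mₙₜ⟧ sin θ = 0` and `⟦M'ₙₜ⟧ - ⟦Mₙₜ⟧ cos θ = 0` at the two end points of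
`Γ`; the start of the edge `Γ` of `S` is the end of the edge `Γ'` of `S'` and conversely. -/
def CornerConditions (Φ : PlateStress × PlateStress) : Prop :=
  (P.S.jumpNt Φ.1.M P.Γ * Real.sin P.θ = 0 ∧
    P.S'.jumpNt Φ.2.M (P.S'.next P.Γ') - P.S.jumpNt Φ.1.M P.Γ * Real.cos P.θ = 0) ∧
  (P.S.jumpNt Φ.1.M (P.S.next P.Γ) * Real.sin P.θ = 0 ∧
    P.S'.jumpNt Φ.2.M P.Γ' - P.S.jumpNt Φ.1.M (P.S.next P.Γ) * Real.cos P.θ = 0)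

end CoupledPlates

end Plates

end

/-!
The theorem is integration by parts on both plates: for an admissible displacement `ψ`, the
difference `(B ψ, Φ) - (Div Φ, ψ)` is the work of the boundary forces of `Φ` on the boundary values
of `ψ`, and `Φ` belongs to `D(B*)` if and only if this work vanishes for all `ψ ∈ W`. On an edge the
work has the density `∂ₙw Mₙₙ - w T - v · N n` (`edgeDensity`); the tangential part of `∇w · M n` is
integrated by parts along the edge, which produces the forces `w ⟦Mₙₜ⟧` at the vertices
(`green_moment`, `green_force`).

Green's formula (`green`) has to be shown for fields that are continuous up to the boundary and have
a merely integrable weak divergence, namely the rows of `N` and of `M`, and `Div M`. Away from the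
vertices it follows from the definition of the weak divergence with cutoffs in thin layers along an
edge; the vertices do not contribute because the gradient of a cutoff of radius `r` has the `L¹` norm
`O(r)`.

*Sufficiency.* A displacement in `W` is merely Sobolev. It is approximated by functions that are
smooth on the whole plane (`exists_smoothing`), which are obtained by mollification with kernels
shifted into the domain, as the cone property `exists_cone` of a polygonal domain permits. By the
trace inequality `exists_trace_bound`, the boundary values of *every* such approximation converge to
the traces (`HasTrace.tendsto`), so that Green's formulas pass to the limit. The approximations need
not be clamped, but on the clamped edges the work tends to zero, and so do the vertex forces at
the end points of clamped edges, since along a clamped edge the deflection tends to zero in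
`H¹(0, 1)` (`tendsto_vert_of_hasTrace_zero`). On the junction, the work of the two plates cancels
pointwise (`junction_iff`).

*Necessity.* Displacements with compact support in the domains identify `G` with the distributional
divergences of `Φ` (`isDivergence_of_pair`), so `Φ ∈ Hₛ`, and Green's formulas show that the total
boundary work of smooth admissible displacements vanishes (`MemSigma.boundary`). The displacements
`v = a η`, `w = (b - d dist) η`, with a radial bump `η` around a point of an edge and the distance
`dist` to that edge, have the boundary values `v = a η`, `w = b η`, `∂ₙw = d η` on this edge for
arbitrary constants `a`, `b`, `d`: at the points of a line through its centre, a radial function is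
stationary in the direction normal to that line. They are compatible on the junction as soon as the constants are, and
they single out the density at interior points of edges. Once the densities vanish, only vertex
forces are left (`MemSigma.vertex`), and bumps around the vertices give the remaining conditions.
-/

noncomputable section

namespace Plates

/-! ### Partial derivatives -/

theorem fderiv_apply_eq_sum (f : Plane → ℝ) (x v : Plane) :
    fderiv ℝ f x v = ∑ j, v j * pd j f x := by
  have hv : v = ∑ j, v j • e j := by
    ext i
    fin_cases i <;> simp [e, Fin.sum_univ_two]
  conv_lhs => rw [hv]
  simp [pd]

theorem pd_mul {f g : Plane → ℝ} {x : Plane} (j : Fin 2) (hf : DifferentiableAt ℝ f x)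
    (hg : DifferentiableAt ℝ g x) :
    pd j (fun y => f y * g y) x = pd j f x * g x + f x * pd j g x := by
  unfold pd
  rw [fderiv_fun_mul hf hg]
  simp
  ring

theorem pd_add {f g : Plane → ℝ} {x : Plane} (j : Fin 2) (hf : DifferentiableAt ℝ f x)
    (hg : DifferentiableAt ℝ g x) :
    pd j (fun y => f y + g y) x = pd j f x + pd j g x := by
  unfold pd
  rw [fderiv_fun_add hf hg]
  simp

theorem pd_sum {ι : Type*} (s : Finset ι) {f : ι → Plane → ℝ} {x : Plane} (j : Fin 2)
    (hf : ∀ i ∈ s, DifferentiableAt ℝ (f i) x) :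
    pd j (fun y => ∑ i ∈ s, f i y) x = ∑ i ∈ s, pd j (f i) x := by
  unfold pd
  rw [fderiv_fun_sum hf]
  simp

theorem pd_congr {f g : Plane → ℝ} {x : Plane} (j : Fin 2) (h : f =ᶠ[𝓝 x] g) :
    pd j f x = pd j g x := by
  unfold pd
  rw [h.fderiv_eq]

theorem contDiff_pd {f : Plane → ℝ} (hf : ContDiff ℝ ∞ f) (j : Fin 2) :
    ContDiff ℝ ∞ (pd j f) :=
  (hf.fderiv_right (m := ∞) (by simp)).clm_apply contDiff_const

theorem ContDiff.diffAt {f : Plane → ℝ} (hf : ContDiff ℝ ∞ f) (x : Plane) :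
    DifferentiableAt ℝ f x :=
  (hf.differentiable (by simp)).differentiableAt

theorem pd_comm {f : Plane → ℝ} (hf : ContDiff ℝ ∞ f) (i j : Fin 2) (x : Plane) :
    pd i (pd j f) x = pd j (pd i f) x := by
  have h : IsSymmSndFDerivAt ℝ f x := hf.contDiffAt.isSymmSndFDerivAt (by
    rw [minSmoothness_of_isRCLikeNormedField]
    exact WithTop.coe_le_coe.2 (le_top (a := (2 : ℕ∞))))
  have h2 : DifferentiableAt ℝ (fderiv ℝ f) x :=
    ((hf.fderiv_right (m := ∞) (by simp)).differentiable (by simp)).differentiableAt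
  have key : ∀ a b : Fin 2, pd a (pd b f) x = fderiv ℝ (fderiv ℝ f) x (e a) (e b) := by
    intro a b
    unfold pd
    rw [fderiv_clm_apply h2 (differentiableAt_const _)]
    simp
  rw [key, key]
  exact h.eq _ _

theorem tsupport_pd_subset (f : Plane → ℝ) (j : Fin 2) : tsupport (pd j f) ⊆ tsupport f :=
  tsupport_fderiv_apply_subset ℝ (e j)

theorem pd_eq_zero_of_notMem_tsupport {f : Plane → ℝ} {x : Plane} (j : Fin 2)
    (hx : x ∉ tsupport f) : pd j f x = 0 :=
  image_eq_zero_of_notMem_tsupport fun h => hx (tsupport_pd_subset f j h)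

/-! ### Smooth cutoff functions -/

/-- A finite smooth partition of unity on a compact set, subordinate to a given choice of an open
neighbourhood for each of its points. -/
theorem exists_partition {K : Set Plane} (hK : IsCompact K) (U : Plane → Set Plane)
    (hU : ∀ x ∈ K, IsOpen (U x)) (hxU : ∀ x ∈ K, x ∈ U x) :
    ∃ (t : Finset Plane) (η : Plane → Plane → ℝ), (∀ x ∈ t, x ∈ K) ∧
      (∀ x, ContDiff ℝ ∞ (η x)) ∧ (∀ x y, 0 ≤ η x y) ∧
      (∀ x ∈ t, tsupport (η x) ⊆ U x) ∧ ∀ y ∈ K, ∑ x ∈ t, η x y = 1 := by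
  classical
  obtain ⟨t, htK, hcov⟩ := hK.elim_nhds_subcover U fun x hx => (hU x hx).mem_nhds (hxU x hx)
  obtain ⟨f, hf⟩ := SmoothPartitionOfUnity.exists_isSubordinate (modelWithCornersSelf ℝ Plane)
    hK.isClosed (fun x : t => U x) (fun x => hU x (htK x x.2)) (by
      intro y hy
      obtain ⟨x, hx, hxy⟩ := Set.mem_iUnion₂.1 (hcov hy)
      exact Set.mem_iUnion.2 ⟨⟨x, hx⟩, hxy⟩)
  refine ⟨t, fun x => if h : x ∈ t then f ⟨x, h⟩ else 0, htK, ?_, ?_, ?_, ?_⟩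
  · intro x
    by_cases h : x ∈ t
    · simp only [h, dite_true]
      exact (f ⟨x, h⟩).contMDiff.contDiff
    · simp only [h, dite_false]
      exact contDiff_const
  · intro x y
    by_cases h : x ∈ t
    · simp only [h, dite_true]
      exact f.nonneg _ _
    · simp [h]
  · intro x hx
    simp only [hx, dite_true]
    exact hf ⟨x, hx⟩
  · intro y hy
    have := f.sum_eq_one hy
    rw [finsum_eq_sum_of_fintype] at this
    rw [← this, ← Finset.sum_coe_sort t]
    refine Finset.sum_congr rfl fun x _ => ?_
    simp

/-- A smooth function that depends only on the distance to `c`, is positive exactly on the open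
ball of radius `r > 0`, and equals one near `c`. -/
def radialBump (c : Plane) (r : ℝ) (x : Plane) : ℝ :=
  Real.smoothTransition (2 - 2 * (‖x - c‖ ^ 2 / r ^ 2))

theorem contDiff_radialBump (c : Plane) (r : ℝ) : ContDiff ℝ ∞ (radialBump c r) := by
  unfold radialBump
  exact Real.smoothTransition.contDiff.comp
    (contDiff_const.sub (contDiff_const.mul
      (((contDiff_id.sub contDiff_const).norm_sq ℝ).div_const _)))

theorem radialBump_nonneg (c : Plane) (r : ℝ) (x : Plane) : 0 ≤ radialBump c r x :=
  Real.smoothTransition.nonneg _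

theorem radialBump_le_one (c : Plane) (r : ℝ) (x : Plane) : radialBump c r x ≤ 1 :=
  Real.smoothTransition.le_one _

theorem radialBump_center (c : Plane) (r : ℝ) : radialBump c r c = 1 := by
  apply Real.smoothTransition.one_of_one_le
  simp

theorem radialBump_eventually_eq_one (c : Plane) (r : ℝ) :
    ∀ᶠ x in 𝓝 c, radialBump c r x = 1 := by
  have h : ContinuousAt (fun x : Plane => 2 - 2 * (‖x - c‖ ^ 2 / r ^ 2)) c := by fun_prop
  have h1 : ∀ᶠ x in 𝓝 c, 1 < 2 - 2 * (‖x - c‖ ^ 2 / r ^ 2) :=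
    continuousAt_const.eventually_lt h (by simp)
  filter_upwards [h1] with x hx
  exact Real.smoothTransition.one_of_one_le hx.le

theorem radialBump_eq_zero {c : Plane} {r : ℝ} (hr : 0 < r) {x : Plane} (hx : r ≤ ‖x - c‖) :
    radialBump c r x = 0 := by
  apply Real.smoothTransition.zero_of_nonpos
  have : 1 ≤ ‖x - c‖ ^ 2 / r ^ 2 := by
    rw [one_le_div (by positivity)]
    gcongr
  linarith

theorem tsupport_radialBump_subset (c : Plane) {r : ℝ} (hr : 0 < r) :
    tsupport (radialBump c r) ⊆ Metric.closedBall c r := by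
  refine closure_minimal (fun x hx => ?_) Metric.isClosed_closedBall
  rw [Metric.mem_closedBall, dist_eq_norm]
  by_contra h
  exact hx (radialBump_eq_zero hr (not_le.1 h).le)

theorem hasCompactSupport_radialBump (c : Plane) {r : ℝ} (hr : 0 < r) :
    HasCompactSupport (radialBump c r) :=
  (isCompact_closedBall c r).of_isClosed_subset (isClosed_tsupport _)
    (tsupport_radialBump_subset c hr)

theorem radialBump_scale (c : Plane) (r : ℝ) (x : Plane) :
    radialBump c r x = radialBump 0 1 (r⁻¹ • (x - c)) := by
  unfold radialBump
  rw [sub_zero, norm_smul, mul_pow, norm_inv, inv_pow, Real.norm_eq_abs, sq_abs]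
  congr 3
  ring

/-- The derivatives of a bump of radius `r` are of size `1 / r`. -/
theorem exists_abs_pd_radialBump_le :
    ∃ C, 0 ≤ C ∧ ∀ (c : Plane) (r : ℝ), 0 < r → ∀ j x, |pd j (radialBump c r) x| ≤ C / r := by
  have hb : ∀ j, ∃ C, ∀ x, ‖pd j (radialBump 0 1) x‖ ≤ C := fun j =>
    (contDiff_pd (contDiff_radialBump 0 1) j).continuous.bounded_above_of_compact_support
      ((hasCompactSupport_radialBump 0 one_pos).of_isClosed_subset
        (isClosed_tsupport _) (tsupport_pd_subset _ j))
  choose C hC using hb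
  refine ⟨max (C 0) (C 1), (norm_nonneg _).trans ((hC 0 0).trans (le_max_left _ _)), ?_⟩
  intro c r hr j x
  have h1 : radialBump c r = fun y => radialBump 0 1 (r⁻¹ • (y - c)) :=
    funext (radialBump_scale c r)
  have h2 : HasFDerivAt (fun y : Plane => r⁻¹ • (y - c)) (r⁻¹ • ContinuousLinearMap.id ℝ Plane) x :=
    ((hasFDerivAt_id x).sub_const c).const_smul r⁻¹
  have h3 : pd j (radialBump c r) x = r⁻¹ * pd j (radialBump 0 1) (r⁻¹ • (x - c)) := by
    rw [h1]
    unfold pd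
    have h4 := (((contDiff_radialBump 0 1).differentiable (by simp)).differentiableAt
      (x := r⁻¹ • (x - c))).hasFDerivAt.comp x h2
    have h5 := h4.fderiv
    simp only [Function.comp_def] at h5
    rw [h5]
    simp
  rw [h3, abs_mul, abs_of_pos (inv_pos.2 hr), div_eq_inv_mul]
  refine mul_le_mul_of_nonneg_left ((hC j _).trans ?_) (inv_pos.2 hr).le
  fin_cases j
  · exact le_max_left _ _
  · exact le_max_right _ _

namespace PolygonalDomain

variable (S : PolygonalDomain)

/-! ### Geometry of polygonal domains -/

/-- The length of the edge `i`. -/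
def len (i : Fin S.numEdges) : ℝ := ‖S.vert (S.next i) - S.vert i‖

theorem len_pos (i : Fin S.numEdges) : 0 < S.len i :=
  norm_pos_iff.2 (sub_ne_zero.2 (S.vert_next_ne i))

theorem len_smul_tangent (i : Fin S.numEdges) :
    S.len i • S.tangent i = S.vert (S.next i) - S.vert i := by
  unfold tangent edgeTangent
  have h : ‖S.vert (S.next i) - S.vert i‖ ≠ 0 := (S.len_pos i).ne'
  rw [smul_smul, len, mul_inv_cancel₀ h, one_smul]

theorem norm_tangent (i : Fin S.numEdges) : ‖S.tangent i‖ = 1 := by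
  unfold tangent edgeTangent
  rw [norm_smul, norm_inv, norm_norm]
  exact inv_mul_cancel₀ (S.len_pos i).ne'

theorem normal_zero (i : Fin S.numEdges) : S.normal i 0 = S.tangent i 1 := by
  simp [normal, edgeNormal, tangent]

theorem normal_one (i : Fin S.numEdges) : S.normal i 1 = -S.tangent i 0 := by
  simp [normal, edgeNormal, tangent]

theorem inner_eq (a b : Plane) : inner ℝ a b = a 0 * b 0 + a 1 * b 1 := by
  simp [PiLp.inner_apply, Fin.sum_univ_two]
  ring

theorem norm_sq_eq (a : Plane) : ‖a‖ ^ 2 = a 0 ^ 2 + a 1 ^ 2 := by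
  rw [← real_inner_self_eq_norm_sq, inner_eq]
  ring

theorem tangent_sq (i : Fin S.numEdges) : S.tangent i 0 ^ 2 + S.tangent i 1 ^ 2 = 1 := by
  rw [← norm_sq_eq, norm_tangent, one_pow]

theorem inner_normal_self (i : Fin S.numEdges) : inner ℝ (S.normal i) (S.normal i) = 1 := by
  rw [inner_eq, normal_zero, normal_one]
  linarith [S.tangent_sq i]

theorem norm_normal (i : Fin S.numEdges) : ‖S.normal i‖ = 1 := by
  have h := S.inner_normal_self i
  rw [real_inner_self_eq_norm_sq] at h
  exact (pow_eq_one_iff_of_nonneg (norm_nonneg _) two_ne_zero).1 h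

theorem inner_tangent_normal (i : Fin S.numEdges) : inner ℝ (S.tangent i) (S.normal i) = 0 := by
  rw [inner_eq, normal_zero, normal_one]
  ring

theorem edgePt_eq (i : Fin S.numEdges) (s : ℝ) :
    S.edgePt i s = S.vert i + (s * S.len i) • S.tangent i := by
  rw [edgePt, AffineMap.lineMap_apply, mul_smul, len_smul_tangent, vsub_eq_sub, vadd_eq_add,
    add_comm]

@[simp] theorem edgePt_zero (i : Fin S.numEdges) : S.edgePt i 0 = S.vert i := by
  simp [edgePt]

@[simp] theorem edgePt_one (i : Fin S.numEdges) : S.edgePt i 1 = S.vert (S.next i) := by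
  simp [edgePt]

theorem continuous_edgePt (i : Fin S.numEdges) : Continuous (S.edgePt i) := by
  unfold edgePt
  exact AffineMap.lineMap_continuous

theorem edgePt_injective (i : Fin S.numEdges) : Function.Injective (S.edgePt i) :=
  AffineMap.lineMap_injective ℝ (S.vert_next_ne i).symm

theorem hasDerivAt_edgePt (i : Fin S.numEdges) (s : ℝ) :
    HasDerivAt (S.edgePt i) (S.len i • S.tangent i) s := by
  rw [len_smul_tangent]
  exact AffineMap.hasDerivAt_lineMap

theorem segment_eq (i : Fin S.numEdges) :
    segment ℝ (S.vert i) (S.vert (S.next i)) = S.edgePt i '' Set.Icc 0 1 :=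
  segment_eq_image_lineMap ℝ _ _

theorem openSegment_eq (i : Fin S.numEdges) :
    openSegment ℝ (S.vert i) (S.vert (S.next i)) = S.edgePt i '' Set.Ioo 0 1 :=
  openSegment_eq_image_lineMap ℝ _ _

theorem edgePt_mem_segment (i : Fin S.numEdges) {s : ℝ} (hs : s ∈ Set.Icc (0 : ℝ) 1) :
    S.edgePt i s ∈ segment ℝ (S.vert i) (S.vert (S.next i)) := by
  rw [segment_eq]
  exact ⟨s, hs, rfl⟩

theorem edgePt_mem_openSegment (i : Fin S.numEdges) {s : ℝ} (hs : s ∈ Set.Ioo (0 : ℝ) 1) :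
    S.edgePt i s ∈ openSegment ℝ (S.vert i) (S.vert (S.next i)) := by
  rw [openSegment_eq]
  exact ⟨s, hs, rfl⟩

theorem isCompact_segment (i : Fin S.numEdges) :
    IsCompact (segment ℝ (S.vert i) (S.vert (S.next i))) := by
  rw [segment_eq]
  exact isCompact_Icc.image (S.continuous_edgePt i)

theorem segment_subset_frontier (i : Fin S.numEdges) :
    segment ℝ (S.vert i) (S.vert (S.next i)) ⊆ frontier S.carrier := by
  rw [S.frontier_eq]
  exact Set.subset_iUnion (fun i => segment ℝ (S.vert i) (S.vert (S.next i))) i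

theorem notMem_of_mem_segment {i : Fin S.numEdges} {x : Plane}
    (hx : x ∈ segment ℝ (S.vert i) (S.vert (S.next i))) : x ∉ S.carrier := by
  have h := S.segment_subset_frontier i hx
  rw [S.isOpen.frontier_eq] at h
  exact h.2

theorem edgePt_mem_closure (i : Fin S.numEdges) {s : ℝ} (hs : s ∈ Set.Icc (0 : ℝ) 1) :
    S.edgePt i s ∈ closure S.carrier :=
  frontier_subset_closure (S.segment_subset_frontier i (S.edgePt_mem_segment i hs))

theorem isCompact_closure : IsCompact (closure S.carrier) :=
  S.isBounded.isCompact_closure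

theorem next_ne (i : Fin S.numEdges) : S.next i ≠ i := fun h => S.vert_next_ne i (by rw [h])

theorem next_prev (i : Fin S.numEdges) : S.next (S.prev i) = i := S.next.apply_symm_apply i

theorem prev_next (i : Fin S.numEdges) : S.prev (S.next i) = i := S.next.symm_apply_apply i

theorem prev_ne (i : Fin S.numEdges) : S.prev i ≠ i := fun h => by
  have := S.next_prev i
  rw [h] at this
  exact S.next_ne i this

theorem inner_edgePt_normal (i : Fin S.numEdges) (s : ℝ) :
    inner ℝ (S.edgePt i s - S.vert i) (S.normal i) = 0 := by
  rw [edgePt_eq, add_sub_cancel_left, inner_smul_left, inner_tangent_normal, mul_zero]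

theorem mem_openSegment_of_ne {i : Fin S.numEdges} {x : Plane}
    (hx : x ∈ segment ℝ (S.vert i) (S.vert (S.next i))) (hv : ∀ j, x ≠ S.vert j) :
    x ∈ openSegment ℝ (S.vert i) (S.vert (S.next i)) :=
  mem_openSegment_of_ne_left_right (hv i).symm (hv (S.next i)).symm hx

theorem vert_notMem_openSegment (i j : Fin S.numEdges) :
    S.vert j ∉ openSegment ℝ (S.vert i) (S.vert (S.next i)) := by
  intro h
  by_cases hij : i = j
  · subst hij
    rw [openSegment_eq] at h
    obtain ⟨s, hs, he⟩ := h
    rw [← S.edgePt_zero] at he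
    exact hs.1.ne' (S.edgePt_injective _ he)
  · exact Set.disjoint_left.1 (S.edges_disjoint i j hij) h (left_mem_segment _ _ _)

/-- Only the two edges that meet at a vertex contain it. -/
theorem eq_or_eq_prev_of_vert_mem {i j : Fin S.numEdges}
    (h : S.vert i ∈ segment ℝ (S.vert j) (S.vert (S.next j))) : j = i ∨ j = S.prev i := by
  by_contra hne
  push Not at hne
  refine S.vert_notMem_openSegment j i (mem_openSegment_of_ne_left_right ?_ ?_ h)
  · exact fun he => hne.1 (S.vert_injective he)
  · intro he
    have := S.vert_injective he
    exact hne.2 (by rw [← this, S.prev_next])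

/-- A point of an edge is left through the outer side when moving against a direction that points
inwards. -/
theorem eventually_sub_notMem {i : Fin S.numEdges} {z h : Plane}
    (hz : z ∈ openSegment ℝ (S.vert i) (S.vert (S.next i))) (hh : inner ℝ h (S.normal i) < 0) :
    ∀ᶠ σ in 𝓝[>] (0 : ℝ), z - σ • h ∉ S.carrier := by
  have hloc := S.locally_left i z hz
  have hc : Tendsto (fun σ : ℝ => z - σ • h) (𝓝[>] 0) (𝓝 z) := by
    have : Tendsto (fun σ : ℝ => z - σ • h) (𝓝 0) (𝓝 (z - (0 : ℝ) • h)) :=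
      (continuous_const.sub (continuous_id.smul continuous_const)).tendsto 0
    rw [zero_smul, sub_zero] at this
    exact this.mono_left nhdsWithin_le_nhds
  filter_upwards [hc.eventually hloc, self_mem_nhdsWithin] with σ hσ hpos hmem
  have h1 := hσ.1 hmem
  rw [openSegment_eq] at hz
  obtain ⟨s, -, rfl⟩ := hz
  have h2 := S.inner_edgePt_normal i s
  have h3 : S.edgePt i s - σ • h - S.vert i = (S.edgePt i s - S.vert i) - σ • h := by abel
  change inner ℝ _ (S.normal i) < 0 at h1
  rw [h3, inner_sub_left, h2, inner_smul_left] at h1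
  simp only [conj_trivial] at h1
  have hpos' : 0 < σ := hpos
  nlinarith

/-- A straight path that starts in the domain, avoids the vertices and points strictly inwards at
all edges that it might meet stays in the domain. -/
theorem path_mem_of_avoid {x h y : Plane} {r T : ℝ}
    (hr : ∀ i, ∀ z ∈ segment ℝ (S.vert i) (S.vert (S.next i)), dist z x < r →
      x ∈ segment ℝ (S.vert i) (S.vert (S.next i)))
    (hh : ∀ i, x ∈ segment ℝ (S.vert i) (S.vert (S.next i)) → inner ℝ h (S.normal i) < 0)
    (hy : y ∈ S.carrier) (hT : ∀ τ ∈ Set.Icc 0 T, dist (y + τ • h) x < r)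
    (hv : ∀ τ ∈ Set.Icc 0 T, ∀ j, y + τ • h ≠ S.vert j) :
    ∀ τ ∈ Set.Icc 0 T, y + τ • h ∈ S.carrier := by
  by_contra hcon
  push Not at hcon
  have hcont : Continuous fun τ : ℝ => y + τ • h :=
    continuous_const.add (continuous_id.smul continuous_const)
  -- the first time at which the path leaves the domain
  set A : Set ℝ := Set.Icc 0 T ∩ (fun τ : ℝ => y + τ • h) ⁻¹' S.carrierᶜ with hA
  have hAc : IsClosed A := isClosed_Icc.inter (S.isOpen.isClosed_compl.preimage hcont)
  have hAne : A.Nonempty := by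
    obtain ⟨τ, h1, h2⟩ := hcon
    exact ⟨τ, h1, h2⟩
  have hAb : BddBelow A := ⟨0, fun τ hτ => hτ.1.1⟩
  have hmem := hAc.csInf_mem hAne hAb
  set τ₀ := sInf A
  have hlt : ∀ τ, 0 ≤ τ → τ < τ₀ → y + τ • h ∈ S.carrier := by
    intro τ h0 h1
    by_contra h2
    have : τ ∈ A := ⟨⟨h0, h1.le.trans hmem.1.2⟩, h2⟩
    exact absurd (csInf_le hAb this) (not_le.2 h1)
  have hpos : 0 < τ₀ := by
    rcases hmem.1.1.lt_or_eq with h1 | h1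
    · exact h1
    · exfalso
      have := hmem.2
      rw [← h1] at this
      simp at this
      exact this hy
  have hfr : y + τ₀ • h ∈ frontier S.carrier := by
    rw [S.isOpen.frontier_eq]
    refine ⟨?_, hmem.2⟩
    have h1 : Tendsto (fun τ : ℝ => y + τ • h) (𝓝[<] τ₀) (𝓝 (y + τ₀ • h)) :=
      (hcont.tendsto τ₀).mono_left nhdsWithin_le_nhds
    refine mem_closure_of_tendsto h1 ?_
    filter_upwards [Ioo_mem_nhdsLT hpos] with τ hτ
    exact hlt τ hτ.1.le hτ.2
  rw [S.frontier_eq] at hfr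
  obtain ⟨i, hi⟩ := Set.mem_iUnion.1 hfr
  have hxi := hr i _ hi (hT τ₀ hmem.1)
  have hop := S.mem_openSegment_of_ne hi (hv τ₀ hmem.1)
  have h1 := S.eventually_sub_notMem hop (hh i hxi)
  have h2 : ∀ᶠ σ in 𝓝[>] (0 : ℝ), σ ∈ Set.Ioo 0 τ₀ := Ioo_mem_nhdsGT hpos
  obtain ⟨σ, hσ1, hσ2⟩ := (h1.and h2).exists
  apply hσ1
  have := hlt (τ₀ - σ) (by linarith [hσ2.2]) (by linarith [hσ2.1])
  rwa [sub_smul, ← add_sub_assoc] at this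

/-- The same without the requirement to avoid a vertex `x`: a path through `x` can be
shifted along an edge at `x`, and the shifted path would lead from the domain to a point of that
edge. -/
theorem path_mem {x h y : Plane} {r T : ℝ}
    (hr : ∀ i, ∀ z ∈ segment ℝ (S.vert i) (S.vert (S.next i)), dist z x < r →
      x ∈ segment ℝ (S.vert i) (S.vert (S.next i)))
    (hrv : ∀ i, dist (S.vert i) x < r → S.vert i = x)
    (hh : ∀ i, x ∈ segment ℝ (S.vert i) (S.vert (S.next i)) → inner ℝ h (S.normal i) < 0)
    (hy : y ∈ S.carrier) (hT : ∀ τ ∈ Set.Icc 0 T, dist (y + τ • h) x < r / 2) :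
    ∀ τ ∈ Set.Icc 0 T, y + τ • h ∈ S.carrier := by
  by_cases hex : ∃ τ ∈ Set.Icc 0 T, ∃ j, y + τ • h = S.vert j
  · exfalso
    obtain ⟨τ₀, hτ₀, j, hj⟩ := hex
    have hr0 : 0 < r := by linarith [dist_nonneg.trans_lt (hT τ₀ hτ₀)]
    have hjx : S.vert j = x := hrv j (by rw [← hj]; linarith [hT τ₀ hτ₀])
    have hxj : x ∈ segment ℝ (S.vert j) (S.vert (S.next j)) := by
      rw [← hjx]; exact left_mem_segment _ _ _
    have hc : Tendsto (fun σ : ℝ => y + σ • S.tangent j) (𝓝[>] 0) (𝓝 y) := by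
      have : Tendsto (fun σ : ℝ => y + σ • S.tangent j) (𝓝 0) (𝓝 (y + (0 : ℝ) • S.tangent j)) :=
        (continuous_const.add (continuous_id.smul continuous_const)).tendsto 0
      rw [zero_smul, add_zero] at this
      exact this.mono_left nhdsWithin_le_nhds
    have e1 := hc.eventually (S.isOpen.mem_nhds hy)
    have e2 : ∀ᶠ σ in 𝓝[>] (0 : ℝ), σ ∈ Set.Ioo 0 (r / 2) := Ioo_mem_nhdsGT (by positivity)
    have e3 : ∀ᶠ σ in 𝓝[>] (0 : ℝ), σ ∈ Set.Ioo 0 (S.len j) := Ioo_mem_nhdsGT (S.len_pos j)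
    obtain ⟨σ, hσ1, hσ2, hσ3⟩ := (e1.and (e2.and e3)).exists
    have hd : ∀ τ ∈ Set.Icc 0 τ₀, dist ((y + σ • S.tangent j) + τ • h) x < r := by
      intro τ hτ
      have h1 := hT τ ⟨hτ.1, hτ.2.trans hτ₀.2⟩
      rw [dist_eq_norm] at h1 ⊢
      have h2 : y + σ • S.tangent j + τ • h - x = (y + τ • h - x) + σ • S.tangent j := by abel
      rw [h2]
      refine (norm_add_le _ _).trans_lt ?_
      rw [norm_smul, S.norm_tangent, mul_one, Real.norm_of_nonneg hσ2.1.le]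
      linarith [hσ2.2]
    have hq := S.path_mem_of_avoid hr hh hσ1 hd (by
      intro τ hτ k hk
      have hkx : S.vert k = x := hrv k (by rw [← hk]; exact hd τ hτ)
      rw [hkx, ← hjx, ← hj] at hk
      have h1 : σ • S.tangent j = (τ₀ - τ) • h := by
        rw [sub_smul]
        have : y + σ • S.tangent j + τ • h = y + (σ • S.tangent j + τ • h) := by abel
        rw [this] at hk
        rw [← add_left_cancel hk]
        abel
      have h2 := congrArg (fun v => inner ℝ v (S.normal j)) h1
      simp only [inner_smul_left, S.inner_tangent_normal, mul_zero, conj_trivial] at h2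
      have h3 := hh j hxj
      have h4 : τ₀ - τ = 0 := by
        rcases mul_eq_zero.1 h2.symm with h | h
        · exact h
        · exact absurd h h3.ne
      rw [h4, zero_smul] at h1
      have h5 := congrArg norm h1
      rw [norm_smul, S.norm_tangent, norm_zero, mul_one, Real.norm_of_nonneg hσ2.1.le] at h5
      exact hσ2.1.ne' h5) τ₀ ⟨hτ₀.1, le_rfl⟩
    refine S.notMem_of_mem_segment (i := j) ?_ hq
    have h6 : y + σ • S.tangent j + τ₀ • h = S.edgePt j (σ / S.len j) := by
      rw [edgePt_eq, div_mul_cancel₀ _ (S.len_pos j).ne', ← hj]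
      abel
    rw [h6]
    refine S.edgePt_mem_segment j ⟨div_nonneg hσ3.1.le (S.len_pos j).le, ?_⟩
    rw [div_le_one (S.len_pos j)]
    exact hσ3.2.le
  · push Not at hex
    refine S.path_mem_of_avoid hr hh hy (fun τ hτ => (hT τ hτ).trans_le ?_) hex
    have := dist_nonneg.trans_lt (hT τ hτ)
    linarith

/-- There are no cracks: two edges that fold back onto each other would overlap. -/
theorem normal_ne_neg_normal_prev (i : Fin S.numEdges) : S.normal i ≠ -S.normal (S.prev i) := by
  intro h
  have h0 := congrArg (fun v : Plane => v 0) h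
  have h1 := congrArg (fun v : Plane => v 1) h
  simp only [PiLp.neg_apply, normal_zero, normal_one, neg_neg] at h0 h1
  have ht : S.tangent i = -S.tangent (S.prev i) := by
    ext k
    fin_cases k
    · simp; linarith
    · simp; linarith
  set σ := min (S.len i) (S.len (S.prev i)) / 2 with hσ
  have hm : 0 < min (S.len i) (S.len (S.prev i)) := lt_min (S.len_pos _) (S.len_pos _)
  have hl1 : σ < S.len i := by have := min_le_left (S.len i) (S.len (S.prev i)); linarith
  have hl2 : σ < S.len (S.prev i) := by
    have := min_le_right (S.len i) (S.len (S.prev i)); linarith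
  have hσ0 : 0 < σ := by positivity
  refine Set.disjoint_left.1 (S.edges_disjoint i (S.prev i) (S.prev_ne i).symm)
    (S.edgePt_mem_openSegment i (s := σ / S.len i)
      ⟨div_pos hσ0 (S.len_pos i), (div_lt_one (S.len_pos i)).2 hl1⟩) ?_
  have : S.edgePt i (σ / S.len i) = S.edgePt (S.prev i) (1 - σ / S.len (S.prev i)) := by
    have h3 : S.vert i = S.edgePt (S.prev i) 1 := by rw [edgePt_one, next_prev]
    rw [edgePt_eq, h3, edgePt_eq, edgePt_eq, ht, sub_mul, div_mul_cancel₀ _ (S.len_pos _).ne',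
      div_mul_cancel₀ _ (S.len_pos _).ne', sub_smul]
    simp only [smul_neg]
    abel
  rw [this]
  refine S.edgePt_mem_segment _ ⟨?_, ?_⟩
  · have := (div_lt_one (S.len_pos (S.prev i))).2 hl2
    linarith
  · have := div_pos hσ0 (S.len_pos (S.prev i))
    linarith

/-- At each point there is a direction that points strictly inwards at all edges through it. -/
theorem exists_inward (x : Plane) :
    ∃ h : Plane, ∀ i, x ∈ segment ℝ (S.vert i) (S.vert (S.next i)) →
      inner ℝ h (S.normal i) < 0 := by
  by_cases hv : ∃ j, x = S.vert j
  · obtain ⟨j, rfl⟩ := hv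
    have hlt : -1 < inner ℝ (S.normal j) (S.normal (S.prev j)) := by
      have h1 := abs_real_inner_le_norm (S.normal j) (S.normal (S.prev j))
      rw [norm_normal, norm_normal, one_mul] at h1
      rcases (abs_le.1 h1).1.lt_or_eq with h | h
      · exact h
      · exfalso
        apply S.normal_ne_neg_normal_prev j
        rw [← sub_eq_zero, sub_neg_eq_add, ← norm_eq_zero, ← sq_eq_zero_iff,
          @norm_add_sq_real, ← h, norm_normal, norm_normal]
        norm_num
    -- the bisector of the two inner normals
    refine ⟨-(S.normal j + S.normal (S.prev j)), fun i hi => ?_⟩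
    rcases S.eq_or_eq_prev_of_vert_mem hi with rfl | rfl
    · rw [inner_neg_left, inner_add_left, inner_normal_self, real_inner_comm]
      linarith
    · rw [inner_neg_left, inner_add_left, inner_normal_self]
      linarith
  · push Not at hv
    by_cases he : ∃ i, x ∈ segment ℝ (S.vert i) (S.vert (S.next i))
    · obtain ⟨i, hi⟩ := he
      refine ⟨-S.normal i, fun j hj => ?_⟩
      have hij : j = i := by
        by_contra hne
        exact Set.disjoint_left.1 (S.edges_disjoint i j (Ne.symm hne))
          (S.mem_openSegment_of_ne hi hv) hj
      rw [hij, inner_neg_left, inner_normal_self]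
      norm_num
    · push Not at he
      exact ⟨0, fun i hi => absurd hi (he i)⟩

/-- Around each point there is a ball that meets only edges through that point and contains no
other vertex. -/
theorem exists_isolating_radius (x : Plane) :
    ∃ r > 0, (∀ i, ∀ z ∈ segment ℝ (S.vert i) (S.vert (S.next i)), dist z x < r →
      x ∈ segment ℝ (S.vert i) (S.vert (S.next i))) ∧
      ∀ i, dist (S.vert i) x < r → S.vert i = x := by
  have h1 : ∀ᶠ z in 𝓝 x, ∀ i, z ∈ segment ℝ (S.vert i) (S.vert (S.next i)) →
      x ∈ segment ℝ (S.vert i) (S.vert (S.next i)) := by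
    rw [eventually_all]
    intro i
    by_cases hx : x ∈ segment ℝ (S.vert i) (S.vert (S.next i))
    · exact Eventually.of_forall fun _ _ => hx
    · filter_upwards [(S.isCompact_segment i).isClosed.isOpen_compl.mem_nhds hx] with z hz hz'
      exact absurd hz' hz
  have h2 : ∀ᶠ z in 𝓝 x, ∀ i, S.vert i = z → S.vert i = x := by
    rw [eventually_all]
    intro i
    by_cases hx : S.vert i = x
    · exact Eventually.of_forall fun _ _ => hx
    · filter_upwards [isOpen_ne.mem_nhds (Ne.symm hx)] with z hz hz'
      exact absurd hz'.symm hz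
  obtain ⟨r, hr, hball⟩ := Metric.eventually_nhds_iff.1 (h1.and h2)
  exact ⟨r, hr, fun i z hz hd => (hball hd).1 i hz, fun i hd => (hball hd).2 i rfl⟩

/-- The uniform cone property: near each point, all translations by small multiples of the vectors
near `h` map the domain into itself, and `h` points strictly inwards at the edges close by. -/
theorem exists_cone (x : Plane) :
    ∃ (h : Plane) (c δ : ℝ), 0 < c ∧ 0 < δ ∧
      (∀ y ∈ S.carrier, dist y x < δ → ∀ h', dist h' h < c → ∀ τ ∈ Set.Ioo 0 δ,
        y + τ • h' ∈ S.carrier) ∧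
      ∀ i, ∀ z ∈ segment ℝ (S.vert i) (S.vert (S.next i)), dist z x < δ →
        inner ℝ h (S.normal i) < 0 := by
  obtain ⟨h, hh⟩ := S.exists_inward x
  obtain ⟨r, hr, hr1, hr2⟩ := S.exists_isolating_radius x
  have hop : ∀ᶠ h' in 𝓝 h, ∀ i, x ∈ segment ℝ (S.vert i) (S.vert (S.next i)) →
      inner ℝ h' (S.normal i) < 0 := by
    rw [eventually_all]
    intro i
    by_cases hx : x ∈ segment ℝ (S.vert i) (S.vert (S.next i))
    · have : Continuous fun h' : Plane => (inner ℝ h' (S.normal i) : ℝ) :=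
        continuous_id.inner continuous_const
      filter_upwards [this.continuousAt.eventually_lt continuousAt_const (hh i hx)] with h' h1 _
      exact h1
    · exact Eventually.of_forall fun _ h1 => absurd h1 hx
  obtain ⟨c, hc, hball⟩ := Metric.eventually_nhds_iff.1 hop
  have hden : 0 < 1 + ‖h‖ + c := by positivity
  refine ⟨h, c, r / (2 * (1 + ‖h‖ + c)), hc, by positivity, ?_, ?_⟩
  · intro y hy hyx h' hh' τ hτ
    refine S.path_mem (x := x) (h := h') (r := r) (T := τ) hr1 hr2 (hball hh') hy ?_ τ
      ⟨hτ.1.le, le_rfl⟩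
    intro σ hσ
    have hn : ‖h'‖ ≤ ‖h‖ + c := by
      have := norm_le_norm_add_norm_sub' h' h
      rw [dist_eq_norm] at hh'
      linarith
    calc dist (y + σ • h') x ≤ dist (y + σ • h') y + dist y x := dist_triangle _ _ _
      _ = σ * ‖h'‖ + dist y x := by
        rw [dist_eq_norm, add_sub_cancel_left, norm_smul, Real.norm_of_nonneg hσ.1]
      _ < r / (2 * (1 + ‖h‖ + c)) * (‖h‖ + c) + r / (2 * (1 + ‖h‖ + c)) := by
        refine add_lt_add_of_le_of_lt ?_ hyx
        exact mul_le_mul (hσ.2.trans hτ.2.le) hn (norm_nonneg _) (by positivity)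
      _ = r / 2 := by field_simp; ring
  · intro i z hz hd
    refine hh i (hr1 i z hz (hd.trans_le ?_))
    rw [div_le_iff₀ (by positivity)]
    nlinarith [norm_nonneg h]

/-- Inward translations map boundary points into the domain: a boundary point is replaced by a nearby
point of the domain at the cost of a slight change of the direction. -/
theorem exists_cone_closure {x : Plane} (hx : x ∈ closure S.carrier) :
    ∃ (h : Plane) (c δ : ℝ), 0 < c ∧ 0 < δ ∧ ∀ h', dist h' h < c → ∀ τ ∈ Set.Ioo 0 δ,
        x + τ • h' ∈ S.carrier := by
  obtain ⟨h, c, δ, hc, hδ, hcone, -⟩ := S.exists_cone x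
  refine ⟨h, c / 2, δ, by positivity, hδ, fun h' hh' τ hτ => ?_⟩
  obtain ⟨y, hy, hyx⟩ := Metric.mem_closure_iff.1 hx (min δ (τ * (c / 2)))
    (lt_min hδ (mul_pos hτ.1 (by positivity)))
  have hyx1 := hyx.trans_le (min_le_left _ _)
  have hyx2 := hyx.trans_le (min_le_right _ _)
  have := hcone y hy (by rwa [dist_comm]) (h' + τ⁻¹ • (x - y)) (by
    rw [dist_eq_norm] at hh' ⊢
    have : h' + τ⁻¹ • (x - y) - h = (h' - h) + τ⁻¹ • (x - y) := by abel
    rw [this]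
    refine (norm_add_le _ _).trans_lt ?_
    rw [norm_smul, norm_inv, Real.norm_of_nonneg hτ.1.le, ← dist_eq_norm x y]
    have : τ⁻¹ * dist x y < c / 2 := by
      rw [inv_mul_lt_iff₀ hτ.1]
      exact hyx2
    linarith) τ hτ
  rw [smul_add, smul_smul, mul_inv_cancel₀ hτ.1.ne', one_smul] at this
  convert this using 1
  abel

/-- By the cone property, each point of the closure is the apex of a convex set with nonempty
interior inside the closure. -/
theorem uniqueDiffOn_closure : UniqueDiffOn ℝ (closure S.carrier) := by
  intro x hx
  obtain ⟨h, c, δ, hc, hδ, hcone⟩ := S.exists_cone_closure hx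
  set B := Metric.ball (x + (δ / 2) • h) (δ / 2 * c) with hB
  have hBne : B.Nonempty := ⟨_, Metric.mem_ball_self (by positivity)⟩
  have hsub : convexHull ℝ (insert x B) ⊆ closure S.carrier := by
    rw [convexHull_insert hBne, (convex_ball _ _).convexHull_eq]
    intro y hy
    rw [convexJoin_singleton_left] at hy
    obtain ⟨z, hz, hy⟩ := Set.mem_iUnion₂.1 hy
    rw [segment_eq_image'] at hy
    obtain ⟨l, hl, rfl⟩ := hy
    rcases hl.1.eq_or_lt with h0 | h0
    · simpa [← h0] using hx
    apply subset_closure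
    have := hcone ((δ / 2)⁻¹ • (z - x)) (by
      have h1 : (δ / 2)⁻¹ • (z - x) - h = (δ / 2)⁻¹ • (z - (x + (δ / 2) • h)) := by
        rw [← sub_sub, smul_sub _ (z - x), smul_smul, inv_mul_cancel₀ (by positivity), one_smul]
      rw [Metric.mem_ball, dist_eq_norm] at hz
      rw [dist_eq_norm, h1, norm_smul, norm_inv, Real.norm_of_nonneg (by positivity),
        inv_mul_lt_iff₀ (by positivity)]
      exact hz) (l * (δ / 2)) ⟨by positivity, by nlinarith [hl.2]⟩
    rwa [smul_smul, mul_assoc, mul_inv_cancel₀ (by positivity), mul_one] at this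
  refine (uniqueDiffWithinAt_convex (convex_convexHull ℝ _) ?_ ?_).mono hsub
  · refine Set.Nonempty.mono (interior_mono ((Set.subset_insert _ _).trans
      (subset_convexHull ℝ _))) ?_
    rw [Metric.isOpen_ball.interior_eq]
    exact hBne
  · exact subset_closure (subset_convexHull ℝ _ (Set.mem_insert _ _))

end PolygonalDomain

namespace PolygonalDomain

variable (S : PolygonalDomain)

/-! ### Integration over a polygonal domain -/

instance isFiniteMeasure_μ : IsFiniteMeasure S.μ := by
  refine ⟨?_⟩
  rw [μ, Measure.restrict_apply_univ]
  exact S.isBounded.measure_lt_top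

theorem ae_mem : ∀ᵐ x ∂S.μ, x ∈ S.carrier := ae_restrict_mem S.isOpen.measurableSet

variable {S}

theorem integrable_of_continuousOn {f : Plane → ℝ} (hf : ContinuousOn f (closure S.carrier)) :
    Integrable f S.μ :=
  (hf.integrableOn_compact S.isCompact_closure).mono_set subset_closure

theorem exists_bound {f : Plane → ℝ} (hf : ContinuousOn f (closure S.carrier)) :
    ∃ C, 0 ≤ C ∧ ∀ x ∈ closure S.carrier, |f x| ≤ C := by
  obtain ⟨C, hC⟩ := S.isCompact_closure.exists_bound_of_continuousOn hf
  exact ⟨max C 0, le_max_right _ _, fun x hx => (hC x hx).trans (le_max_left _ _)⟩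

theorem memLp_of_continuousOn {f : Plane → ℝ} (hf : ContinuousOn f (closure S.carrier)) :
    S.IsL2 f := by
  obtain ⟨C, -, hC⟩ := exists_bound hf
  refine MemLp.of_bound (integrable_of_continuousOn hf).aestronglyMeasurable C ?_
  filter_upwards [S.ae_mem] with x hx
  exact hC x (subset_closure hx)

theorem integrable_mul_of_continuousOn {f g : Plane → ℝ} (hg : Integrable g S.μ)
    (hf : ContinuousOn f (closure S.carrier)) : Integrable (fun x => g x * f x) S.μ := by
  obtain ⟨C, -, hC⟩ := exists_bound hf
  refine hg.mul_bdd (c := C) (integrable_of_continuousOn hf).aestronglyMeasurable ?_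
  filter_upwards [S.ae_mem] with x hx
  exact hC x (subset_closure hx)

theorem integral_congr_carrier {f g : Plane → ℝ} (h : ∀ x ∈ S.carrier, f x = g x) :
    ∫ x, f x ∂S.μ = ∫ x, g x ∂S.μ := by
  refine integral_congr_ae ?_
  filter_upwards [S.ae_mem] with x hx
  exact h x hx

theorem IsL2.integrable {f : Plane → ℝ} (hf : S.IsL2 f) : Integrable f S.μ :=
  MemLp.integrable (by norm_num) hf

theorem continuousOn_comp_edgePt {f : Plane → ℝ} (hf : ContinuousOn f (closure S.carrier))
    (i : Fin S.numEdges) : ContinuousOn (fun s => f (S.edgePt i s)) (Set.Icc 0 1) :=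
  hf.comp (S.continuous_edgePt i).continuousOn fun _ hs => S.edgePt_mem_closure i hs

theorem intervalIntegrable_comp_edgePt {f : Plane → ℝ} (hf : ContinuousOn f (closure S.carrier))
    (i : Fin S.numEdges) : IntervalIntegrable (fun s => f (S.edgePt i s)) volume 0 1 := by
  refine ContinuousOn.intervalIntegrable ?_
  rw [Set.uIcc_of_le zero_le_one]
  exact continuousOn_comp_edgePt hf i

/-! ### Green's formula -/

/-- `g` is the weak divergence of the vector field `F`. -/
def IsWeakDiv (S : PolygonalDomain) (F : Fin 2 → Plane → ℝ) (g : Plane → ℝ) : Prop :=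
  ∀ φ, S.IsTest φ → ∫ x, ∑ j, F j x * pd j φ x ∂S.μ = -∫ x, g x * φ x ∂S.μ

/-- The normal component of the vector field `F` on the edge `i`. -/
def flux (S : PolygonalDomain) (F : Fin 2 → Plane → ℝ) (i : Fin S.numEdges) (x : Plane) : ℝ :=
  ∑ j, F j x * S.normal i j

/-- The difference of the two sides of Green's formula for the field `F` with weak divergence `g`
and the function `φ`. -/
def greenDefect (S : PolygonalDomain) (F : Fin 2 → Plane → ℝ) (g φ : Plane → ℝ) : ℝ :=
  ∫ x, (∑ j, F j x * pd j φ x + g x * φ x) ∂S.μ -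
    ∑ i, S.len i * ∫ s in (0 : ℝ)..1, φ (S.edgePt i s) * S.flux F i (S.edgePt i s)

theorem continuousOn_flux {F : Fin 2 → Plane → ℝ}
    (hF : ∀ j, ContinuousOn (F j) (closure S.carrier)) (i : Fin S.numEdges) :
    ContinuousOn (S.flux F i) (closure S.carrier) :=
  continuousOn_finsetSum _ fun j _ => (hF j).mul continuousOn_const

theorem continuousOn_smooth {φ : Plane → ℝ} (hφ : ContDiff ℝ ∞ φ) :
    ContinuousOn φ (closure S.carrier) := hφ.continuous.continuousOn

theorem integrable_green {F : Fin 2 → Plane → ℝ} {g φ : Plane → ℝ}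
    (hF : ∀ j, ContinuousOn (F j) (closure S.carrier)) (hg : Integrable g S.μ)
    (hφ : ContDiff ℝ ∞ φ) :
    Integrable (fun x => ∑ j, F j x * pd j φ x + g x * φ x) S.μ := by
  refine Integrable.add (integrable_finsetSum _ fun j _ => ?_)
    (integrable_mul_of_continuousOn hg (continuousOn_smooth hφ))
  exact integrable_of_continuousOn ((hF j).mul (continuousOn_smooth (contDiff_pd hφ j)))

theorem greenDefect_congr {F : Fin 2 → Plane → ℝ} {g φ ψ : Plane → ℝ}
    (h : ∀ x ∈ closure S.carrier, φ x = ψ x) :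
    S.greenDefect F g φ = S.greenDefect F g ψ := by
  unfold greenDefect
  congr 1
  · refine integral_congr_carrier fun x hx => ?_
    rw [h x (subset_closure hx)]
    congr 1
    refine Finset.sum_congr rfl fun j _ => ?_
    rw [pd_congr j]
    filter_upwards [S.isOpen.mem_nhds hx] with y hy
    exact h y (subset_closure hy)
  · refine Finset.sum_congr rfl fun i _ => ?_
    congr 1
    refine intervalIntegral.integral_congr fun s hs => ?_
    rw [Set.uIcc_of_le zero_le_one] at hs
    rw [h _ (S.edgePt_mem_closure i hs)]

theorem greenDefect_sum {ι : Type*} (t : Finset ι) {F : Fin 2 → Plane → ℝ} {g : Plane → ℝ}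
    {φ : ι → Plane → ℝ} (hF : ∀ j, ContinuousOn (F j) (closure S.carrier))
    (hg : Integrable g S.μ) (hφ : ∀ i ∈ t, ContDiff ℝ ∞ (φ i)) :
    S.greenDefect F g (fun x => ∑ i ∈ t, φ i x) = ∑ i ∈ t, S.greenDefect F g (φ i) := by
  unfold greenDefect
  rw [Finset.sum_sub_distrib]
  congr 1
  · rw [← integral_finsetSum _ fun i hi => integrable_green hF hg (hφ i hi)]
    congr 1
    funext x
    rw [Finset.sum_add_distrib, Finset.mul_sum]
    congr 1
    rw [Finset.sum_comm]
    refine Finset.sum_congr rfl fun j _ => ?_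
    rw [pd_sum t j fun i hi => ContDiff.diffAt (hφ i hi) x, Finset.mul_sum]
  · rw [Finset.sum_comm]
    refine Finset.sum_congr rfl fun k _ => ?_
    rw [← Finset.mul_sum, ← intervalIntegral.integral_finsetSum]
    · congr 2
      funext s
      rw [Finset.sum_mul]
    · intro i hi
      exact intervalIntegrable_comp_edgePt (f := fun x => φ i x * S.flux F k x)
        ((continuousOn_smooth (hφ i hi)).mul (continuousOn_flux hF k)) k

theorem greenDefect_add {F : Fin 2 → Plane → ℝ} {g φ ψ : Plane → ℝ}
    (hF : ∀ j, ContinuousOn (F j) (closure S.carrier)) (hg : Integrable g S.μ)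
    (hφ : ContDiff ℝ ∞ φ) (hψ : ContDiff ℝ ∞ ψ) :
    S.greenDefect F g (fun x => φ x + ψ x) = S.greenDefect F g φ + S.greenDefect F g ψ := by
  have := greenDefect_sum (S := S) (Finset.univ : Finset (Fin 2)) (F := F) (g := g)
    (φ := ![φ, ψ]) hF hg (by
      intro i _
      fin_cases i
      · exact hφ
      · exact hψ)
  simpa [Fin.sum_univ_two] using this

theorem greenDefect_eq_zero_of_tsupport_subset {F : Fin 2 → Plane → ℝ} {g φ : Plane → ℝ}
    (hF : ∀ j, ContinuousOn (F j) (closure S.carrier)) (hg : Integrable g S.μ)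
    (hdiv : S.IsWeakDiv F g) (hφ : ContDiff ℝ ∞ φ) (hsupp : tsupport φ ⊆ S.carrier) :
    S.greenDefect F g φ = 0 := by
  have hcomp : HasCompactSupport φ :=
    S.isCompact_closure.of_isClosed_subset (isClosed_tsupport _) (hsupp.trans subset_closure)
  unfold greenDefect
  have h1 : Integrable (fun x => ∑ j, F j x * pd j φ x) S.μ :=
    integrable_finsetSum _ fun j _ => integrable_of_continuousOn
      ((hF j).mul (continuousOn_smooth (contDiff_pd hφ j)))
  rw [integral_add h1 (integrable_mul_of_continuousOn hg (continuousOn_smooth hφ)),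
    hdiv φ ⟨hφ, hcomp, hsupp⟩]
  rw [Finset.sum_eq_zero, neg_add_cancel, sub_zero]
  intro i _
  rw [intervalIntegral.integral_congr (g := fun _ => 0), intervalIntegral.integral_zero, mul_zero]
  intro s hs
  rw [Set.uIcc_of_le zero_le_one] at hs
  have : φ (S.edgePt i s) = 0 := image_eq_zero_of_notMem_tsupport fun h =>
    S.notMem_of_mem_segment (S.edgePt_mem_segment i hs) (hsupp h)
  simp only
  rw [this, zero_mul]

variable (S) in
/-- Orthonormal coordinates adapted to the edge `i`: arc length along the edge and distance from
the edge to the inside. -/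
def edgeFrame (i : Fin S.numEdges) (z : ℝ × ℝ) : Plane :=
  S.vert i + (z.1 • S.tangent i - z.2 • S.normal i)

theorem integral_edgeFrame (i : Fin S.numEdges) (f : Plane → ℝ) :
    ∫ x, f x = ∫ z : ℝ × ℝ, f (S.edgeFrame i z) := by
  have hon : Orthonormal ℝ ![S.tangent i, -S.normal i] := by
    rw [orthonormal_iff_ite]
    intro a b
    fin_cases a <;> fin_cases b
    · simp [S.norm_tangent i]
    · simp [S.inner_tangent_normal i]
    · simpa [real_inner_comm] using S.inner_tangent_normal i
    · simp [S.norm_normal i]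
  let b : OrthonormalBasis (Fin 2) ℝ Plane := OrthonormalBasis.mk hon (by
    rw [hon.linearIndependent.span_eq_top_of_card_eq_finrank' (by simp)])
  have hb : ∀ z : ℝ × ℝ, S.edgeFrame i z = S.vert i + b.repr.symm (WithLp.toLp 2 ![z.1, z.2]) := by
    intro z
    rw [← b.sum_repr_symm]
    simp [b, Fin.sum_univ_two, edgeFrame, sub_eq_add_neg]
  have e1 := (volume_preserving_finTwoArrow ℝ).symm
  have e2 := (EuclideanSpace.volume_preserving_symm_measurableEquiv_toLp (Fin 2)).symm
  have e3 := b.measurePreserving_repr_symm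
  rw [← integral_add_left_eq_self f (S.vert i)]
  rw [← e3.integral_comp b.repr.symm.toHomeomorph.measurableEmbedding]
  rw [← e2.integral_comp (MeasurableEquiv.measurableEmbedding _)]
  rw [← e1.integral_comp (MeasurableEquiv.measurableEmbedding _)]
  congr 1
  funext z
  rw [hb]
  rfl

end PolygonalDomain

namespace PolygonalDomain

/-! ### Green's formula near an open edge -/

/-- A smooth transition from zero to one, the derivative of which is supported in `[1, 2]`. -/
def ramp (u : ℝ) : ℝ := Real.smoothTransition (u - 1)

theorem contDiff_ramp : ContDiff ℝ ∞ ramp :=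
  Real.smoothTransition.contDiff.comp (contDiff_id.sub contDiff_const)

theorem ramp_of_le {u : ℝ} (hu : u ≤ 1) : ramp u = 0 :=
  Real.smoothTransition.zero_of_nonpos (by linarith)

theorem ramp_of_ge {u : ℝ} (hu : 2 ≤ u) : ramp u = 1 :=
  Real.smoothTransition.one_of_one_le (by linarith)

theorem abs_ramp_le (u : ℝ) : |ramp u| ≤ 1 := by
  rw [ramp, abs_of_nonneg (Real.smoothTransition.nonneg _)]
  exact Real.smoothTransition.le_one _

theorem hasDerivAt_ramp (u : ℝ) : HasDerivAt ramp (deriv ramp u) u :=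
  ((contDiff_ramp.differentiable (by simp)).differentiableAt).hasDerivAt

theorem continuous_deriv_ramp : Continuous (deriv ramp) :=
  contDiff_ramp.continuous_deriv (by simp)

theorem deriv_ramp_eq_zero {u : ℝ} (hu : u ∉ Set.Icc (1 : ℝ) 2) : deriv ramp u = 0 := by
  rw [Set.mem_Icc, not_and_or, not_le, not_le] at hu
  rcases hu with hu | hu
  · have : ramp =ᶠ[𝓝 u] fun _ => 0 := by
      filter_upwards [Iio_mem_nhds hu] with v hv
      exact ramp_of_le (le_of_lt hv)
    rw [this.deriv_eq, deriv_const]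
  · have : ramp =ᶠ[𝓝 u] fun _ => 1 := by
      filter_upwards [Ioi_mem_nhds hu] with v hv
      exact ramp_of_ge (le_of_lt hv)
    rw [this.deriv_eq, deriv_const]

theorem support_deriv_ramp : Function.support (deriv ramp) ⊆ Set.Icc 1 2 := fun u hu => by
  by_contra h
  exact hu (deriv_ramp_eq_zero h)

theorem integrable_deriv_ramp : Integrable (deriv ramp) :=
  continuous_deriv_ramp.integrable_of_hasCompactSupport
    (isCompact_Icc.of_isClosed_subset (isClosed_tsupport _)
      (closure_minimal support_deriv_ramp isClosed_Icc))

theorem integral_deriv_ramp : ∫ u, deriv ramp u = 1 := by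
  have h : Function.support (deriv ramp) ⊆ Set.Ioc 0 2 := support_deriv_ramp.trans fun u hu =>
    ⟨by linarith [hu.1], hu.2⟩
  rw [← intervalIntegral.integral_eq_integral_of_support_subset h,
    intervalIntegral.integral_eq_sub_of_hasDerivAt (fun u _ => hasDerivAt_ramp u)
      (continuous_deriv_ramp.intervalIntegrable _ _),
    ramp_of_ge le_rfl, ramp_of_le zero_le_one, sub_zero]

variable {S : PolygonalDomain}

variable (S) in
/-- The signed distance to the line through the edge `i`, positive inside. -/
def depth (i : Fin S.numEdges) (x : Plane) : ℝ := -inner ℝ (x - S.vert i) (S.normal i)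

theorem depth_edgeFrame (i : Fin S.numEdges) (z : ℝ × ℝ) : S.depth i (S.edgeFrame i z) = z.2 := by
  rw [depth, edgeFrame, add_sub_cancel_left, inner_sub_left, inner_smul_left, inner_smul_left,
    inner_tangent_normal, inner_normal_self]
  simp

theorem continuous_edgeFrame (i : Fin S.numEdges) : Continuous (S.edgeFrame i) := by
  unfold edgeFrame
  fun_prop

theorem contDiff_depth (i : Fin S.numEdges) : ContDiff ℝ ∞ (S.depth i) := by
  unfold depth
  exact ((contDiff_id.sub contDiff_const).inner ℝ contDiff_const).neg

theorem pd_depth (i : Fin S.numEdges) (j : Fin 2) (x : Plane) :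
    pd j (S.depth i) x = -S.normal i j := by
  have h : HasFDerivAt (S.depth i) (-(innerSL ℝ (S.normal i))) x := by
    have h1 : S.depth i = fun y => (-(innerSL ℝ (S.normal i))) y
        + inner ℝ (S.vert i) (S.normal i) := by
      funext y
      simp [depth, inner_sub_left, real_inner_comm]
      ring
    rw [h1]
    exact (ContinuousLinearMap.hasFDerivAt _).add_const _
  rw [pd, h.fderiv]
  simp [e, EuclideanSpace.inner_single_right]

theorem edgeFrame_zero (i : Fin S.numEdges) (s : ℝ) :
    S.edgeFrame i (s, 0) = S.edgePt i (s / S.len i) := by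
  rw [edgeFrame, edgePt_eq, div_mul_cancel₀ _ (S.len_pos i).ne']
  simp

/-- Averages over thin layers parallel to an edge converge to the integral over the line through
that edge. -/
theorem tendsto_integral_layer (i : Fin S.numEdges) {H : Plane → ℝ} (hm : Measurable H) {C A : ℝ}
    (hC : ∀ x, |H x| ≤ C) (hA : ∀ z : ℝ × ℝ, A < |z.1| → H (S.edgeFrame i z) = 0)
    (hlim : ∀ s, Tendsto (fun r => H (S.edgeFrame i (s, r))) (𝓝[>] 0)
      (𝓝 (H (S.edgeFrame i (s, 0))))) :
    Tendsto (fun n : ℕ => ∫ x, H x * (deriv ramp ((n + 1) * S.depth i x) * (n + 1))) atTop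
      (𝓝 (∫ s, H (S.edgeFrame i (s, 0)))) := by
  have hmf : Measurable fun z => H (S.edgeFrame i z) := hm.comp (continuous_edgeFrame i).measurable
  have hdm : Measurable (deriv ramp) := continuous_deriv_ramp.measurable
  have hC0 : 0 ≤ C := (abs_nonneg _).trans (hC 0)
  obtain ⟨D, hD⟩ : ∃ D, ∀ u, |deriv ramp u| ≤ D :=
    continuous_deriv_ramp.bounded_above_of_compact_support
      (isCompact_Icc.of_isClosed_subset (isClosed_tsupport _)
      (closure_minimal support_deriv_ramp isClosed_Icc))
  have key : ∀ n : ℕ, ∫ x, H x * (deriv ramp ((n + 1) * S.depth i x) * (n + 1)) =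
      ∫ s, ∫ u, H (S.edgeFrame i (s, ((n : ℝ) + 1)⁻¹ * u)) * deriv ramp u := by
    intro n
    have hn : (0 : ℝ) < n + 1 := by positivity
    rw [integral_edgeFrame i]
    simp only [depth_edgeFrame]
    rw [Measure.volume_eq_prod, integral_prod]
    · congr 1
      funext s
      have := Measure.integral_comp_mul_left
        (fun u => H (S.edgeFrame i (s, ((n : ℝ) + 1)⁻¹ * u)) * deriv ramp u) ((n : ℝ) + 1)
      rw [abs_of_pos (inv_pos.2 hn), smul_eq_mul, eq_inv_mul_iff_mul_eq₀ hn.ne',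
        ← integral_const_mul] at this
      rw [← this]
      congr 1
      funext r
      rw [inv_mul_cancel_left₀ hn.ne']
      ring
    · have hsupp : Function.support (fun z : ℝ × ℝ => H (S.edgeFrame i z) *
          (deriv ramp ((n + 1) * z.2) * (n + 1))) ⊆ Set.Icc (-A) A ×ˢ Set.Icc 0 2 := by
        intro z hz
        rw [Function.mem_support] at hz
        have hz1 := left_ne_zero_of_mul hz
        have hz2 := support_deriv_ramp (left_ne_zero_of_mul (right_ne_zero_of_mul hz))
        refine ⟨abs_le.1 (not_lt.1 fun h => hz1 (hA z h)), ?_, ?_⟩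
        · exact (pos_of_mul_pos_right (zero_lt_one.trans_le hz2.1) hn.le).le
        · by_contra hlt
          push Not at hlt
          have := hz2.2
          have hn1 : (0 : ℝ) ≤ n := by positivity
          nlinarith
      rw [← integrableOn_iff_integrable_of_support_subset hsupp]
      refine Measure.integrableOn_of_bounded (M := C * (D * (n + 1))) ?_ ?_ ?_
      · exact (isCompact_Icc.prod isCompact_Icc).measure_lt_top.ne
      · exact (hmf.mul ((hdm.comp (measurable_snd.const_mul _)).mul_const _)).aestronglyMeasurable
      · refine Eventually.of_forall fun z => ?_
        rw [norm_mul, norm_mul, Real.norm_of_nonneg hn.le]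
        exact mul_le_mul (hC _) (mul_le_mul_of_nonneg_right (hD _) hn.le) (by positivity) hC0
  simp only [key]
  refine tendsto_integral_of_dominated_convergence
    (fun s => (Set.Icc (-A) A).indicator (fun _ => C * ∫ u, |deriv ramp u|) s) ?_ ?_ ?_ ?_
  · intro n
    have : Measurable fun z : ℝ × ℝ =>
        H (S.edgeFrame i (z.1, ((n : ℝ) + 1)⁻¹ * z.2)) * deriv ramp z.2 :=
      (hmf.comp (measurable_fst.prodMk (measurable_snd.const_mul _))).mul (hdm.comp measurable_snd)
    exact this.stronglyMeasurable.integral_prod_right'.aestronglyMeasurable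
  · rw [integrable_indicator_iff measurableSet_Icc]
    exact integrableOn_const (by simp)
  · intro n
    refine Eventually.of_forall fun s => ?_
    by_cases hs : s ∈ Set.Icc (-A) A
    · rw [Set.indicator_of_mem hs, ← integral_const_mul]
      refine norm_integral_le_of_norm_le (integrable_deriv_ramp.abs.const_mul C)
        (Eventually.of_forall fun u => ?_)
      rw [norm_mul]
      exact mul_le_mul_of_nonneg_right (hC _) (abs_nonneg _)
    · rw [Set.indicator_of_notMem hs]
      have hs' : A < |s| := by
        by_contra hle
        exact hs (abs_le.1 (not_lt.1 hle))
      simp [hA (s, _) hs']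
  · refine Eventually.of_forall fun s => ?_
    have h1 : H (S.edgeFrame i (s, 0)) = ∫ u, H (S.edgeFrame i (s, 0)) * deriv ramp u := by
      rw [integral_const_mul, integral_deriv_ramp, mul_one]
    rw [h1]
    refine tendsto_integral_of_dominated_convergence (fun u => C * |deriv ramp u|) ?_
      (integrable_deriv_ramp.abs.const_mul C) ?_ ?_
    · intro n
      exact ((hmf.comp (measurable_const.prodMk (measurable_id.const_mul _))).mul
        hdm).aestronglyMeasurable
    · intro n
      refine Eventually.of_forall fun u => ?_
      rw [norm_mul]
      exact mul_le_mul_of_nonneg_right (hC _) (abs_nonneg _)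
    · refine Eventually.of_forall fun u => ?_
      by_cases hu : u ∈ Set.Icc (1 : ℝ) 2
      · refine Tendsto.mul_const _ ((hlim s).comp ?_)
        rw [tendsto_nhdsWithin_iff]
        constructor
        · have := (tendsto_one_div_add_atTop_nhds_zero_nat (𝕜 := ℝ)).mul_const u
          simpa using this
        · refine Eventually.of_forall fun n => ?_
          have : (0 : ℝ) < n + 1 := by positivity
          exact mul_pos (inv_pos.2 this) (by linarith [hu.1])
      · simp [deriv_ramp_eq_zero hu]

/-- Near an interior point of an edge, the domain is the half plane of positive depth, there are no
other edges, and the points of depth zero belong to the edge. -/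
theorem exists_edge_nhd {i : Fin S.numEdges} {x₀ : Plane}
    (hx : x₀ ∈ openSegment ℝ (S.vert i) (S.vert (S.next i))) :
    ∃ δ > 0, (∀ y ∈ Metric.ball x₀ δ, (y ∈ S.carrier ↔ 0 < S.depth i y)) ∧
      (∀ j, j ≠ i → ∀ y ∈ Metric.ball x₀ δ, y ∉ segment ℝ (S.vert j) (S.vert (S.next j))) ∧
      ∀ y ∈ Metric.ball x₀ δ, S.depth i y = 0 →
        y ∈ segment ℝ (S.vert i) (S.vert (S.next i)) := by
  have h1 := S.locally_left i x₀ hx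
  have h2 : ∀ᶠ y in 𝓝 x₀, ∀ j, j ≠ i → y ∉ segment ℝ (S.vert j) (S.vert (S.next j)) := by
    rw [eventually_all]
    intro j
    by_cases hj : j = i
    · exact Eventually.of_forall fun _ h => absurd hj h
    · have := Set.disjoint_left.1 (S.edges_disjoint i j (Ne.symm hj)) hx
      filter_upwards [(S.isCompact_segment j).isClosed.isOpen_compl.mem_nhds this] with y hy _
      exact hy
  obtain ⟨δ, hδ, hball⟩ := Metric.eventually_nhds_iff_ball.1 (h1.and h2)
  have hdep : ∀ y ∈ Metric.ball x₀ δ, (y ∈ S.carrier ↔ 0 < S.depth i y) := by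
    intro y hy
    rw [(hball y hy).1, depth, neg_pos]
    rfl
  refine ⟨δ, hδ, hdep, fun j hj y hy => (hball y hy).2 j hj, fun y hy h0 => ?_⟩
  have hfr : y ∈ frontier S.carrier := by
    rw [S.isOpen.frontier_eq]
    refine ⟨?_, fun h => ((hdep y hy).1 h).ne' h0⟩
    have hc : Tendsto (fun σ : ℝ => y - σ • S.normal i) (𝓝[>] 0) (𝓝 y) := by
      have : Tendsto (fun σ : ℝ => y - σ • S.normal i) (𝓝 0) (𝓝 (y - (0 : ℝ) • S.normal i)) :=
        (continuous_const.sub (continuous_id.smul continuous_const)).tendsto 0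
      rw [zero_smul, sub_zero] at this
      exact this.mono_left nhdsWithin_le_nhds
    refine mem_closure_of_tendsto hc ?_
    filter_upwards [hc.eventually (Metric.isOpen_ball.mem_nhds hy), self_mem_nhdsWithin] with σ h3 h4
    rw [hdep _ h3]
    have : S.depth i (y - σ • S.normal i) = S.depth i y + σ := by
      unfold depth
      rw [sub_right_comm, inner_sub_left, inner_smul_left, inner_normal_self]
      simp
      ring
    rw [this, h0, zero_add]
    exact h4
  rw [S.frontier_eq] at hfr
  obtain ⟨j, hj⟩ := Set.mem_iUnion.1 hfr
  by_cases hji : j = i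
  · rwa [hji] at hj
  · exact absurd hj ((hball y hy).2 j hji)

/-- Green's formula for functions `φ` that are supported near an interior point of an edge. The
definition of the weak divergence is used for `φ` times a ramp in a layer of width of order
`1 / n` along the edge; the gradient of the ramp concentrates to the boundary integral. -/
theorem exists_greenDefect_eq_zero_of_edge {F : Fin 2 → Plane → ℝ} {g : Plane → ℝ}
    (hF : ∀ j, ContinuousOn (F j) (closure S.carrier)) (hg : Integrable g S.μ)
    (hdiv : S.IsWeakDiv F g) {i : Fin S.numEdges} {x₀ : Plane}
    (hx : x₀ ∈ openSegment ℝ (S.vert i) (S.vert (S.next i))) :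
    ∃ U, IsOpen U ∧ x₀ ∈ U ∧ ∀ φ, ContDiff ℝ ∞ φ → tsupport φ ⊆ U → S.greenDefect F g φ = 0 := by
  obtain ⟨δ, hδ, hdep, hother, hline⟩ := exists_edge_nhd hx
  refine ⟨Metric.ball x₀ δ, Metric.isOpen_ball, Metric.mem_ball_self hδ, fun φ hφ hsupp => ?_⟩
  have hcomp : IsCompact (tsupport φ) :=
    (isCompact_closedBall x₀ δ).of_isClosed_subset (isClosed_tsupport _)
      (hsupp.trans Metric.ball_subset_closedBall)
  have hzero : ∀ x, x ∉ Metric.ball x₀ δ → φ x = 0 := fun x hx =>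
    image_eq_zero_of_notMem_tsupport fun h => hx (hsupp h)
  -- the integrand of the boundary term, extended by zero
  set H : Plane → ℝ := (closure S.carrier).indicator fun x => φ x * S.flux F i x with hH
  have hGc : ContinuousOn (fun x => φ x * S.flux F i x) (closure S.carrier) :=
    (continuousOn_smooth hφ).mul (continuousOn_flux hF i)
  have hHm : Measurable H := by
    classical
    rw [hH, ← Set.piecewise_eq_indicator]
    exact hGc.measurable_piecewise continuousOn_const isClosed_closure.measurableSet
  have hH0 : ∀ x, φ x = 0 → H x = 0 := by
    intro x hx
    rw [hH]
    by_cases h : x ∈ closure S.carrier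
    · rw [Set.indicator_of_mem h, hx, zero_mul]
    · rw [Set.indicator_of_notMem h]
  obtain ⟨C, hC0, hC⟩ := exists_bound hGc
  have hlay := tendsto_integral_layer i hHm (C := C) (A := δ + ‖x₀ - S.vert i‖)
    (fun x => by
      by_cases h : x ∈ closure S.carrier
      · rw [hH, Set.indicator_of_mem h]
        exact hC x h
      · rw [hH, Set.indicator_of_notMem h, abs_zero]
        exact hC0)
    (fun z hz => hH0 _ (hzero _ fun hmem => by
      rw [Metric.mem_ball, dist_eq_norm] at hmem
      have h1 : z.1 = inner ℝ (S.edgeFrame i z - S.vert i) (S.tangent i) := by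
        rw [edgeFrame, add_sub_cancel_left, inner_sub_left, inner_smul_left, inner_smul_left,
          real_inner_comm, real_inner_self_eq_norm_sq, norm_tangent, real_inner_comm,
          inner_tangent_normal]
        simp
      have h2 : |z.1| ≤ ‖S.edgeFrame i z - S.vert i‖ := by
        rw [h1]
        refine (abs_real_inner_le_norm _ _).trans ?_
        rw [norm_tangent, mul_one]
      have h3 : ‖S.edgeFrame i z - S.vert i‖ ≤ ‖S.edgeFrame i z - x₀‖ + ‖x₀ - S.vert i‖ := by
        rw [← sub_add_sub_cancel]
        exact norm_add_le _ _
      linarith))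
    (fun s => by
      have hcont : Tendsto (fun r => S.edgeFrame i (s, r)) (𝓝[>] 0) (𝓝 (S.edgeFrame i (s, 0))) :=
        (((continuous_edgeFrame i).comp (Continuous.prodMk_right s)).tendsto 0).mono_left
          nhdsWithin_le_nhds
      by_cases hs : S.edgeFrame i (s, 0) ∈ tsupport φ
      · have hsU := hsupp hs
        have hseg := hline _ hsU (depth_edgeFrame i _)
        have hcl := frontier_subset_closure (S.segment_subset_frontier i hseg)
        have hev : ∀ᶠ r in 𝓝[>] (0 : ℝ), S.edgeFrame i (s, r) ∈ closure S.carrier := by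
          filter_upwards [hcont.eventually (Metric.isOpen_ball.mem_nhds hsU),
            self_mem_nhdsWithin] with r h1 h2
          apply subset_closure
          rw [hdep _ h1, depth_edgeFrame]
          exact h2
        rw [hH, Set.indicator_of_mem hcl]
        refine ((hGc _ hcl).tendsto.comp (tendsto_nhdsWithin_iff.2 ⟨hcont, hev⟩)).congr' ?_
        filter_upwards [hev] with r hr
        rw [Set.indicator_of_mem hr]
        rfl
      · rw [hH0 _ (image_eq_zero_of_notMem_tsupport hs)]
        refine tendsto_const_nhds.congr' ?_
        filter_upwards [hcont.eventually ((isClosed_tsupport φ).isOpen_compl.mem_nhds hs)] with r hr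
        exact (hH0 _ (image_eq_zero_of_notMem_tsupport hr)).symm)
  -- the boundary term
  have hbd : ∫ s, H (S.edgeFrame i (s, 0)) =
      ∑ j, S.len j * ∫ s in (0 : ℝ)..1, φ (S.edgePt j s) * S.flux F j (S.edgePt j s) := by
    have hl := S.len_pos i
    rw [Finset.sum_eq_single i]
    · have hsub : Function.support (fun s => H (S.edgeFrame i (s, 0))) ⊆ Set.Ioc 0 (S.len i) := by
        intro s hs
        have hU : S.edgeFrame i (s, 0) ∈ Metric.ball x₀ δ := by
          by_contra h
          exact hs (hH0 _ (hzero _ h))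
        have hseg := hline _ hU (depth_edgeFrame i _)
        rw [edgeFrame_zero] at hseg hU
        rw [segment_eq] at hseg
        obtain ⟨σ, hσ, hσs⟩ := hseg
        have hσ' := S.edgePt_injective i hσs
        rw [hσ'] at hσ
        have h0 : s ≠ 0 := by
          rintro rfl
          rw [zero_div, edgePt_zero] at hU
          refine hother (S.prev i) (S.prev_ne i) _ hU ?_
          rw [S.next_prev]
          exact right_mem_segment _ _ _
        rw [Set.mem_Icc, div_le_one hl] at hσ
        refine ⟨lt_of_le_of_ne ?_ h0.symm, hσ.2⟩
        by_contra hneg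
        exact absurd hσ.1 (not_le.2 (div_neg_of_neg_of_pos (not_le.1 hneg) hl))
      rw [← intervalIntegral.integral_eq_integral_of_support_subset hsub]
      have := intervalIntegral.mul_integral_comp_mul_left (a := 0) (b := 1)
        (f := fun s => H (S.edgeFrame i (s, 0))) (S.len i)
      rw [mul_zero, mul_one] at this
      rw [← this]
      congr 1
      refine intervalIntegral.integral_congr fun s hs => ?_
      rw [Set.uIcc_of_le zero_le_one] at hs
      rw [edgeFrame_zero, mul_div_cancel_left₀ _ hl.ne', hH,
        Set.indicator_of_mem (S.edgePt_mem_closure i hs)]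
    · intro j _ hji
      rw [intervalIntegral.integral_congr (g := fun _ => 0), intervalIntegral.integral_zero,
        mul_zero]
      intro s hs
      rw [Set.uIcc_of_le zero_le_one] at hs
      have : φ (S.edgePt j s) = 0 := hzero _ fun h =>
        hother j hji _ h (S.edgePt_mem_segment j hs)
      simp only
      rw [this, zero_mul]
    · simp
  -- the domain term, by dominated convergence
  set f : Plane → ℝ := fun x => ∑ j, F j x * pd j φ x + g x * φ x with hf
  have hfi : Integrable f S.μ := integrable_green hF hg hφ
  have hrs : ∀ n : ℕ, ContDiff ℝ ∞ fun x => ramp ((n + 1) * S.depth i x) := fun n =>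
    contDiff_ramp.comp (contDiff_const.mul (contDiff_depth i))
  have hdom : Tendsto (fun n : ℕ => ∫ x, f x * ramp ((n + 1) * S.depth i x) ∂S.μ) atTop
      (𝓝 (∫ x, f x ∂S.μ)) := by
    refine tendsto_integral_of_dominated_convergence (fun x => |f x|) ?_ hfi.abs ?_ ?_
    · intro n
      exact hfi.aestronglyMeasurable.mul (hrs n).continuous.aestronglyMeasurable
    · intro n
      refine Eventually.of_forall fun x => ?_
      rw [norm_mul]
      exact mul_le_of_le_one_right (norm_nonneg _) (abs_ramp_le _)
    · filter_upwards [S.ae_mem] with x hxS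
      by_cases hxs : x ∈ tsupport φ
      · have hpos := (hdep x (hsupp hxs)).1 hxS
        obtain ⟨N, hN⟩ := exists_nat_gt (2 / S.depth i x)
        refine tendsto_const_nhds.congr' ?_
        filter_upwards [eventually_ge_atTop N] with n hn
        rw [ramp_of_ge, mul_one]
        rw [div_lt_iff₀ hpos] at hN
        have : (N : ℝ) ≤ n := by exact_mod_cast hn
        nlinarith
      · have : f x = 0 := by
          simp [hf, pd_eq_zero_of_notMem_tsupport _ hxs, image_eq_zero_of_notMem_tsupport hxs]
        simp [this]
  have hident : ∀ n : ℕ, ∫ x, f x * ramp ((n + 1) * S.depth i x) ∂S.μ =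
      ∫ x, H x * (deriv ramp ((n + 1) * S.depth i x) * (n + 1)) := by
    intro n
    have hn : (0 : ℝ) < n + 1 := by positivity
    set ψ : Plane → ℝ := fun x => φ x * ramp ((n + 1) * S.depth i x) with hψ
    have hψs : ContDiff ℝ ∞ ψ := hφ.mul (hrs n)
    have hψsupp : tsupport ψ ⊆ tsupport φ ∩ {x | 1 ≤ (n + 1) * S.depth i x} := by
      refine closure_minimal ?_ ((isClosed_tsupport φ).inter (isClosed_le continuous_const
        (continuous_const.mul (contDiff_depth i).continuous)))
      intro x hx
      refine ⟨subset_tsupport _ (left_ne_zero_of_mul hx), ?_⟩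
      by_contra h
      exact right_ne_zero_of_mul hx (ramp_of_le (not_le.1 h).le)
    have hψS : tsupport ψ ⊆ S.carrier := by
      intro x hx
      obtain ⟨h1, h2⟩ := hψsupp hx
      rw [hdep x (hsupp h1)]
      exact pos_of_mul_pos_right (zero_lt_one.trans_le h2) hn.le
    have hψd : ∀ j x, pd j ψ x = pd j φ x * ramp ((n + 1) * S.depth i x) +
        φ x * (deriv ramp ((n + 1) * S.depth i x) * ((n + 1) * -S.normal i j)) := by
      intro j x
      rw [hψ, pd_mul j (ContDiff.diffAt hφ x) (ContDiff.diffAt (hrs n) x)]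
      congr 2
      have h1 : HasFDerivAt (fun y => (n + 1) * S.depth i y)
          (((n : ℝ) + 1) • fderiv ℝ (S.depth i) x) x :=
        (ContDiff.diffAt (contDiff_depth i) x).hasFDerivAt.const_mul _
      have h2 := (hasDerivAt_ramp ((n + 1) * S.depth i x)).comp_hasFDerivAt x h1
      have h3 := h2.fderiv
      simp only [Function.comp_def] at h3
      rw [pd, h3]
      change deriv ramp _ • (((n : ℝ) + 1) • pd j (S.depth i) x) = _
      rw [pd_depth]
      rfl
    have h2 : ∫ x, (∑ j, F j x * pd j ψ x + g x * ψ x) ∂S.μ = 0 := by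
      have h3 := hdiv ψ ⟨hψs, hcomp.of_isClosed_subset (isClosed_tsupport _)
        (hψsupp.trans Set.inter_subset_left), hψS⟩
      have h4 : Integrable (fun x => ∑ j, F j x * pd j ψ x) S.μ :=
        integrable_finsetSum _ fun j _ => integrable_of_continuousOn
          ((hF j).mul (continuousOn_smooth (contDiff_pd hψs j)))
      rw [integral_add h4 (integrable_mul_of_continuousOn hg (continuousOn_smooth hψs)), h3]
      ring
    have h5 : ∀ x, ∑ j, F j x * pd j ψ x + g x * ψ x = f x * ramp ((n + 1) * S.depth i x) -
        φ x * S.flux F i x * (deriv ramp ((n + 1) * S.depth i x) * (n + 1)) := by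
      intro x
      have h6 : ψ x = φ x * ramp ((n + 1) * S.depth i x) := rfl
      simp only [hψd, h6, hf, flux, Fin.sum_univ_two]
      ring
    simp only [h5] at h2
    have hdr : Continuous fun x => deriv ramp ((n + 1) * S.depth i x) * (n + 1) :=
      (continuous_deriv_ramp.comp (continuous_const.mul (contDiff_depth i).continuous)).mul
        continuous_const
    have h7 : Integrable (fun x => φ x * S.flux F i x *
        (deriv ramp ((n + 1) * S.depth i x) * (n + 1))) S.μ :=
      integrable_of_continuousOn (hGc.mul hdr.continuousOn)
    rw [integral_sub (integrable_mul_of_continuousOn hfi (continuousOn_smooth (hrs n))) h7,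
      sub_eq_zero] at h2
    rw [h2, μ, ← integral_indicator S.isOpen.measurableSet]
    congr 1
    funext x
    by_cases hxS : x ∈ S.carrier
    · rw [Set.indicator_of_mem hxS, hH, Set.indicator_of_mem (subset_closure hxS)]
    · rw [Set.indicator_of_notMem hxS]
      by_cases hxU : x ∈ Metric.ball x₀ δ
      · rw [deriv_ramp_eq_zero, zero_mul, mul_zero]
        rintro ⟨h, -⟩
        exact hxS ((hdep x hxU).2 (pos_of_mul_pos_right (zero_lt_one.trans_le h) hn.le))
      · rw [hH0 x (hzero x hxU), zero_mul]
  have heq := tendsto_nhds_unique (hdom.congr hident) hlay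
  unfold greenDefect
  rw [← hbd, ← heq, sub_self]

end PolygonalDomain

namespace PolygonalDomain

variable {S : PolygonalDomain}

/-! ### Green's formula on the whole domain -/

/-- Green's formula for smooth functions that vanish near all vertices. -/
theorem greenDefect_eq_zero_of_avoid_vert {F : Fin 2 → Plane → ℝ} {g φ : Plane → ℝ}
    (hF : ∀ j, ContinuousOn (F j) (closure S.carrier)) (hg : Integrable g S.μ)
    (hdiv : S.IsWeakDiv F g) (hφ : ContDiff ℝ ∞ φ) (hv : ∀ i, S.vert i ∉ tsupport φ) :
    S.greenDefect F g φ = 0 := by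
  set K := tsupport φ ∩ closure S.carrier with hK
  have hKc : IsCompact K := S.isCompact_closure.inter_left (isClosed_tsupport _)
  have hloc : ∀ x ∈ K, ∃ U, IsOpen U ∧ x ∈ U ∧
      ∀ ψ, ContDiff ℝ ∞ ψ → tsupport ψ ⊆ U → S.greenDefect F g ψ = 0 := by
    intro x hx
    by_cases hxS : x ∈ S.carrier
    · exact ⟨S.carrier, S.isOpen, hxS, fun ψ hψ hsub =>
        greenDefect_eq_zero_of_tsupport_subset hF hg hdiv hψ hsub⟩
    · have hfr : x ∈ frontier S.carrier := by
        rw [S.isOpen.frontier_eq]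
        exact ⟨hx.2, hxS⟩
      rw [S.frontier_eq] at hfr
      obtain ⟨i, hi⟩ := Set.mem_iUnion.1 hfr
      refine exists_greenDefect_eq_zero_of_edge hF hg hdiv (S.mem_openSegment_of_ne hi ?_)
      rintro j rfl
      exact hv j hx.1
  choose! U hUo hxU hU using hloc
  obtain ⟨t, η, htK, hη, -, hηU, hsum⟩ := exists_partition hKc U hUo hxU
  have h1 : S.greenDefect F g φ = S.greenDefect F g fun y => ∑ x ∈ t, η x y * φ y := by
    refine greenDefect_congr fun y hy => ?_
    rw [← Finset.sum_mul]
    by_cases hys : y ∈ tsupport φ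
    · rw [hsum y ⟨hys, hy⟩, one_mul]
    · rw [image_eq_zero_of_notMem_tsupport hys, mul_zero]
  rw [h1, greenDefect_sum t hF hg fun x _ => (hη x).mul hφ]
  refine Finset.sum_eq_zero fun x hx => hU x (htK x hx) _ ((hη x).mul hφ) ?_
  exact (tsupport_mul_subset_left).trans (hηU x hx)

/-- A vertex does not contribute to Green's formula: the gradient of a cutoff function
of radius `r` is of size `1 / r` on a set of area `r ^ 2`. -/
theorem tendsto_greenDefect_radialBump {F : Fin 2 → Plane → ℝ} {g φ : Plane → ℝ}
    (hF : ∀ j, ContinuousOn (F j) (closure S.carrier)) (hg : Integrable g S.μ)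
    (hφ : ContDiff ℝ ∞ φ) (c : Plane) :
    Tendsto (fun n : ℕ => S.greenDefect F g
      (fun x => φ x * radialBump c (1 / ((n : ℝ) + 1)) x)) atTop (𝓝 0) := by
  have hr : ∀ n : ℕ, (0 : ℝ) < 1 / ((n : ℝ) + 1) := fun n => by positivity
  have hr0 : Tendsto (fun n : ℕ => 1 / ((n : ℝ) + 1)) atTop (𝓝 0) :=
    tendsto_one_div_add_atTop_nhds_zero_nat
  have hb : ∀ n : ℕ, ContDiff ℝ ∞ (radialBump c (1 / ((n : ℝ) + 1))) := fun n =>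
    contDiff_radialBump _ _
  have hlim : ∀ x, x ≠ c →
      Tendsto (fun n : ℕ => radialBump c (1 / ((n : ℝ) + 1)) x) atTop (𝓝 0) := by
    intro x hx
    have hpos : 0 < ‖x - c‖ := norm_pos_iff.2 (sub_ne_zero.2 hx)
    refine tendsto_const_nhds.congr' ?_
    filter_upwards [hr0.eventually (Iio_mem_nhds hpos)] with n hn
    exact (radialBump_eq_zero (hr n) (le_of_lt hn)).symm
  have hle : ∀ (n : ℕ) x, |radialBump c (1 / ((n : ℝ) + 1)) x| ≤ 1 := by
    intro n x
    rw [abs_of_nonneg (radialBump_nonneg _ _ _)]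
    exact radialBump_le_one _ _ _
  set f : Plane → ℝ := fun x => ∑ j, F j x * pd j φ x + g x * φ x with hf
  have hfi : Integrable f S.μ := integrable_green hF hg hφ
  have hdom : Tendsto (fun n : ℕ => ∫ x, f x * radialBump c (1 / ((n : ℝ) + 1)) x ∂S.μ) atTop
      (𝓝 0) := by
    rw [← integral_zero Plane ℝ (μ := S.μ)]
    refine tendsto_integral_of_dominated_convergence (fun x => |f x|) ?_ hfi.abs ?_ ?_
    · intro n
      exact hfi.aestronglyMeasurable.mul (hb n).continuous.aestronglyMeasurable
    · intro n
      refine Eventually.of_forall fun x => ?_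
      rw [norm_mul]
      exact mul_le_of_le_one_right (norm_nonneg _) (hle n x)
    · have hne : ∀ᵐ x ∂S.μ, x ≠ c := ae_restrict_of_ae (Measure.ae_ne volume c)
      filter_upwards [hne] with x hx
      simpa using (hlim x hx).const_mul (f x)
  obtain ⟨D, hD0, hD⟩ := exists_abs_pd_radialBump_le
  have hGj : ∀ j, ∃ C, 0 ≤ C ∧ ∀ x ∈ closure S.carrier, |φ x * F j x| ≤ C := fun j =>
    exists_bound ((continuousOn_smooth hφ).mul (hF j))
  choose C hC0 hC using hGj
  have hgrad : Tendsto (fun n : ℕ => ∫ x, φ x * ∑ j, F j x *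
      pd j (radialBump c (1 / ((n : ℝ) + 1))) x ∂S.μ) atTop (𝓝 0) := by
    set V := (volume (Metric.ball (0 : Plane) 1)).toReal
    have hbound : ∀ n : ℕ, ‖∫ x, φ x * ∑ j, F j x *
        pd j (radialBump c (1 / ((n : ℝ) + 1))) x ∂S.μ‖ ≤
        (C 0 + C 1) * D * V * (1 / ((n : ℝ) + 1)) := by
      intro n
      set r : ℝ := 1 / ((n : ℝ) + 1) with hrn
      have hrpos : 0 < r := hr n
      have h1 : Integrable ((Metric.closedBall c r).indicator
          fun _ => (C 0 + C 1) * (D / r)) S.μ :=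
        (integrable_const _).indicator Metric.isClosed_closedBall.measurableSet
      refine (norm_integral_le_of_norm_le h1 ?_).trans ?_
      · filter_upwards [S.ae_mem] with x hx
        by_cases hxb : x ∈ Metric.closedBall c r
        · rw [Set.indicator_of_mem hxb, Finset.mul_sum, Fin.sum_univ_two, add_mul]
          refine (norm_add_le _ _).trans (add_le_add ?_ ?_) <;>
          · rw [← mul_assoc, norm_mul]
            exact mul_le_mul (hC _ x (subset_closure hx)) (hD c r hrpos _ x) (norm_nonneg _)
              (hC0 _)
        · rw [Set.indicator_of_notMem hxb]
          have h2 : ∀ j, pd j (radialBump c r) x = 0 := fun j =>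
            pd_eq_zero_of_notMem_tsupport j fun h => hxb (tsupport_radialBump_subset c hrpos h)
          simp [h2]
      · rw [integral_indicator Metric.isClosed_closedBall.measurableSet, setIntegral_const,
          smul_eq_mul]
        have h3 : S.μ.real (Metric.closedBall c r) ≤ r ^ 2 * V := by
          have h4 : S.μ (Metric.closedBall c r) ≤ volume (Metric.closedBall c r) :=
            Measure.restrict_apply_le _ _
          refine (ENNReal.toReal_mono (isCompact_closedBall c r).measure_lt_top.ne h4).trans_eq ?_
          rw [Measure.addHaar_closedBall _ _ hrpos.le, ENNReal.toReal_mul,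
            ENNReal.toReal_ofReal (by positivity)]
          simp [V]
        calc S.μ.real (Metric.closedBall c r) * ((C 0 + C 1) * (D / r))
            ≤ r ^ 2 * V * ((C 0 + C 1) * (D / r)) := by
              refine mul_le_mul_of_nonneg_right h3 ?_
              have := hC0 0
              have := hC0 1
              positivity
          _ = (C 0 + C 1) * D * V * r := by
              field_simp
    refine squeeze_zero_norm hbound ?_
    simpa using hr0.const_mul ((C 0 + C 1) * D * V)
  have hbdry : ∀ i, Tendsto (fun n : ℕ => ∫ s in (0 : ℝ)..1,
      φ (S.edgePt i s) * radialBump c (1 / ((n : ℝ) + 1)) (S.edgePt i s) *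
        S.flux F i (S.edgePt i s)) atTop (𝓝 0) := by
    intro i
    have hc : ContinuousOn (fun x => φ x * S.flux F i x) (closure S.carrier) :=
      (continuousOn_smooth hφ).mul (continuousOn_flux hF i)
    have hz : 𝓝 (0 : ℝ) = 𝓝 (∫ _ in (0 : ℝ)..1, (0 : ℝ)) := by simp
    rw [hz]
    refine intervalIntegral.tendsto_integral_filter_of_dominated_convergence
      (fun s => |φ (S.edgePt i s) * S.flux F i (S.edgePt i s)|) ?_ ?_ ?_ ?_
    · refine Eventually.of_forall fun n => ?_
      have := (intervalIntegrable_comp_edgePt (((continuousOn_smooth hφ).mul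
        (continuousOn_smooth (hb n))).mul (continuousOn_flux hF i)) i).aestronglyMeasurable
      rwa [Set.uIoc_of_le zero_le_one]
    · refine Eventually.of_forall fun n => Eventually.of_forall fun s _ => ?_
      rw [norm_mul, norm_mul, abs_mul]
      refine mul_le_mul_of_nonneg_right ?_ (abs_nonneg _)
      exact mul_le_of_le_one_right (norm_nonneg _) (hle n _)
    · exact (intervalIntegrable_comp_edgePt hc i).abs
    · by_cases hex : ∃ s₀, S.edgePt i s₀ = c
      · obtain ⟨s₀, hs₀⟩ := hex
        filter_upwards [Measure.ae_ne volume s₀] with s hs _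
        have hne : S.edgePt i s ≠ c := fun h => hs (S.edgePt_injective i (h.trans hs₀.symm))
        simpa using ((hlim _ hne).const_mul (φ (S.edgePt i s))).mul_const
          (S.flux F i (S.edgePt i s))
      · push Not at hex
        refine Eventually.of_forall fun s _ => ?_
        simpa using ((hlim _ (hex s)).const_mul (φ (S.edgePt i s))).mul_const
          (S.flux F i (S.edgePt i s))
  have hsplit : ∀ n : ℕ, S.greenDefect F g (fun x => φ x * radialBump c (1 / ((n : ℝ) + 1)) x) =
      ∫ x, f x * radialBump c (1 / ((n : ℝ) + 1)) x ∂S.μ +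
      ∫ x, φ x * ∑ j, F j x * pd j (radialBump c (1 / ((n : ℝ) + 1))) x ∂S.μ -
      ∑ i, S.len i * ∫ s in (0 : ℝ)..1,
      φ (S.edgePt i s) * radialBump c (1 / ((n : ℝ) + 1)) (S.edgePt i s) *
        S.flux F i (S.edgePt i s) := by
    intro n
    unfold greenDefect
    congr 1
    rw [← integral_add (integrable_mul_of_continuousOn hfi (continuousOn_smooth (hb n)))]
    · congr 1
      funext x
      simp only [hf, pd_mul _ (ContDiff.diffAt hφ x) (ContDiff.diffAt (hb n) x),
        Fin.sum_univ_two]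
      ring
    · exact integrable_of_continuousOn ((continuousOn_smooth hφ).mul
        (continuousOn_finsetSum _ fun j _ => (hF j).mul
          (continuousOn_smooth (contDiff_pd (hb n) j))))
  simp only [hsplit]
  have := (hdom.add hgrad).sub (tendsto_finsetSum (Finset.univ : Finset (Fin S.numEdges))
    fun i _ => (hbdry i).const_mul (S.len i))
  simpa using this

/-- **Green's formula** on a polygonal domain, for vector fields that are continuous up to the
boundary and have an integrable weak divergence. -/
theorem green {F : Fin 2 → Plane → ℝ} {g φ : Plane → ℝ}
    (hF : ∀ j, ContinuousOn (F j) (closure S.carrier)) (hg : Integrable g S.μ)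
    (hdiv : S.IsWeakDiv F g) (hφ : ContDiff ℝ ∞ φ) :
    ∫ x, (∑ j, F j x * pd j φ x + g x * φ x) ∂S.μ =
      ∑ i, S.len i * ∫ s in (0 : ℝ)..1, φ (S.edgePt i s) * S.flux F i (S.edgePt i s) := by
  classical
  -- the vertices in `A`, near which `φ` need not vanish, are cut off one after the other
  have key : ∀ (A : Finset (Fin S.numEdges)) (φ : Plane → ℝ), ContDiff ℝ ∞ φ →
      (∀ i, i ∉ A → S.vert i ∉ tsupport φ) → S.greenDefect F g φ = 0 := by
    intro A
    induction A using Finset.induction_on with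
    | empty => exact fun φ hφ hv =>
        greenDefect_eq_zero_of_avoid_vert hF hg hdiv hφ fun i => hv i (Finset.notMem_empty i)
    | insert a A _ ih =>
      intro φ hφ hv
      have h1 : ∀ n : ℕ, S.greenDefect F g
          (fun x => φ x * radialBump (S.vert a) (1 / ((n : ℝ) + 1)) x) = S.greenDefect F g φ := by
        intro n
        set b := radialBump (S.vert a) (1 / ((n : ℝ) + 1)) with hb
        have hbs : ContDiff ℝ ∞ b := contDiff_radialBump _ _
        have hcs : ContDiff ℝ ∞ fun x => φ x * (1 - b x) := hφ.mul (contDiff_const.sub hbs)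
        have h2 : S.greenDefect F g (fun x => φ x * (1 - b x)) = 0 := by
          refine ih _ hcs fun i hi => ?_
          by_cases hia : i = a
          · rw [notMem_tsupport_iff_eventuallyEq, hia]
            filter_upwards [radialBump_eventually_eq_one (S.vert a) (1 / ((n : ℝ) + 1))] with x hx
            simp only [hb, hx, sub_self, mul_zero, Pi.zero_apply]
          · intro hmem
            refine hv i ?_ (tsupport_mul_subset_left hmem)
            simp [hia, hi]
        have h3 := greenDefect_add hF hg (hφ.mul hbs) hcs
        rw [h2, add_zero] at h3
        rw [← h3]
        congr 1
        funext x
        ring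
      have h2 := tendsto_greenDefect_radialBump hF hg hφ (S.vert a)
      simp only [h1] at h2
      exact tendsto_nhds_unique tendsto_const_nhds h2
  have := key Finset.univ φ hφ fun i hi => absurd (Finset.mem_univ i) hi
  unfold greenDefect at this
  linarith

end PolygonalDomain

namespace PolygonalDomain

variable {S : PolygonalDomain}

/-! ### Traces -/

/-- Multiplying a function that is continuous in the domain by a continuous function with support
in the domain gives a continuous function on the plane. -/
theorem continuous_mul_of_tsupport_subset {f η : Plane → ℝ} (hf : ContinuousOn f S.carrier)
    (hη : Continuous η) (hsupp : tsupport η ⊆ S.carrier) :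
    Continuous fun x => f x * η x := by
  rw [continuous_iff_continuousAt]
  intro x
  by_cases hx : x ∈ S.carrier
  · exact (hf.continuousAt (S.isOpen.mem_nhds hx)).mul hη.continuousAt
  · have hxη : x ∉ tsupport η := fun h => hx (hsupp h)
    refine (continuousAt_const (y := (0 : ℝ))).congr ?_
    filter_upwards [(isClosed_tsupport η).isOpen_compl.mem_nhds hxη] with y hy
    rw [image_eq_zero_of_notMem_tsupport hy, mul_zero]

/-- Integration by parts for a `C¹` function and a test function. -/
theorem integral_mul_pd_of_contDiffOn {f φ : Plane → ℝ} (hf : ContDiffOn ℝ 1 f S.carrier)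
    (hφ : S.IsTest φ) (j : Fin 2) :
    ∫ x, f x * pd j φ x ∂S.μ = -∫ x, pd j f x * φ x ∂S.μ := by
  obtain ⟨hφs, hφc, hφS⟩ := hφ
  have hφd := contDiff_pd hφs j
  have hφdS := (tsupport_pd_subset φ j).trans hφS
  have hφdc : HasCompactSupport (pd j φ) :=
    hφc.of_isClosed_subset (isClosed_tsupport _) (tsupport_pd_subset φ j)
  have hfd : ContinuousOn (pd j f) S.carrier :=
    (hf.continuousOn_fderiv_of_isOpen S.isOpen (by simp)).clm_apply continuousOn_const
  have hparts := integral_mul_fderiv_eq_neg_fderiv_mul_of_integrable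
    (μ := (volume : Measure Plane)) (f := f) (g := φ) (v := e j)
    ((continuous_mul_of_tsupport_subset hfd hφs.continuous
      hφS).integrable_of_hasCompactSupport hφc.mul_left)
    ((continuous_mul_of_tsupport_subset hf.continuousOn hφd.continuous
      hφdS).integrable_of_hasCompactSupport hφdc.mul_left)
    ((continuous_mul_of_tsupport_subset hf.continuousOn hφs.continuous
      hφS).integrable_of_hasCompactSupport hφc.mul_left)
    (fun x hx => (hf.differentiableOn (by simp)).differentiableAt (S.isOpen.mem_nhds (hφS hx)))
    (fun x _ => ContDiff.diffAt hφs x)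
  have hμ : ∀ h ψ : Plane → ℝ, tsupport ψ ⊆ S.carrier →
      ∫ x, h x * ψ x ∂S.μ = ∫ x, h x * ψ x := by
    intro h ψ hψ
    refine setIntegral_eq_integral_of_forall_compl_eq_zero fun x hx => ?_
    rw [image_eq_zero_of_notMem_tsupport fun hm => hx (hψ hm), mul_zero]
  rw [hμ _ _ hφdS, hμ _ _ hφS]
  exact hparts

theorem isWeakDiv_of_contDiffOn {F : Fin 2 → Plane → ℝ}
    (hF : ∀ j, ContDiffOn ℝ 1 (F j) S.carrier)
    (hFi : ∀ j, ContinuousOn (F j) (closure S.carrier))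
    (hFd : ∀ j, Integrable (pd j (F j)) S.μ) :
    S.IsWeakDiv F fun x => ∑ j, pd j (F j) x := by
  intro φ hφ
  have h1 : ∀ j, Integrable (fun x => F j x * pd j φ x) S.μ := fun j =>
    integrable_of_continuousOn ((hFi j).mul (continuousOn_smooth (contDiff_pd hφ.1 j)))
  have h2 : ∀ j, Integrable (fun x => pd j (F j) x * φ x) S.μ := fun j =>
    integrable_mul_of_continuousOn (hFd j) (continuousOn_smooth hφ.1)
  rw [integral_finsetSum _ fun j _ => h1 j]
  simp only [Finset.sum_mul]
  rw [integral_finsetSum _ fun j _ => h2 j, ← Finset.sum_neg_distrib]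
  exact Finset.sum_congr rfl fun j _ => integral_mul_pd_of_contDiffOn (hF j) hφ j

variable (S) in
/-- A smooth vector field that points strictly outwards on the whole boundary. -/
theorem exists_transversal :
    ∃ X : Fin 2 → Plane → ℝ, (∀ j, ContDiff ℝ ∞ (X j)) ∧
      ∀ i, ∀ s ∈ Set.Icc (0 : ℝ) 1, 0 < S.flux X i (S.edgePt i s) := by
  choose h c δ hc hδ _ hin using S.exists_cone
  obtain ⟨t, η, -, hη, hη0, hηU, hsum⟩ := exists_partition S.isCompact_closure
    (fun x => Metric.ball x (δ x)) (fun _ _ => Metric.isOpen_ball)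
    (fun x _ => Metric.mem_ball_self (hδ x))
  refine ⟨fun j y => -∑ x ∈ t, η x y * h x j, fun j =>
    (ContDiff.sum fun x _ => (hη x).mul contDiff_const).neg, fun i s hs => ?_⟩
  set y := S.edgePt i s
  have h1 : S.flux (fun j y => -∑ x ∈ t, η x y * h x j) i y =
      ∑ x ∈ t, η x y * -inner ℝ (h x) (S.normal i) := by
    simp only [flux, Fin.sum_univ_two, inner_eq]
    rw [neg_mul, neg_mul, Finset.sum_mul, Finset.sum_mul, ← neg_add, ← Finset.sum_add_distrib,
      ← Finset.sum_neg_distrib]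
    exact Finset.sum_congr rfl fun x _ => by ring
  rw [h1]
  have hyc := S.edgePt_mem_closure i hs
  have hpos : ∀ x ∈ t, η x y ≠ 0 → 0 < -inner ℝ (h x) (S.normal i) := by
    intro x hx hne
    rw [neg_pos]
    exact hin x i y (S.edgePt_mem_segment i hs) (hηU x hx (subset_tsupport _ hne))
  refine Finset.sum_pos' (fun x hx => ?_) ?_
  · by_cases hne : η x y = 0
    · rw [hne, zero_mul]
    · exact mul_nonneg (hη0 x y) (hpos x hx hne).le
  · have : ∑ x ∈ t, η x y ≠ 0 := by rw [hsum y hyc]; exact one_ne_zero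
    obtain ⟨x, hx, hne⟩ := Finset.exists_ne_zero_of_sum_ne_zero this
    exact ⟨x, hx, mul_pos (lt_of_le_of_ne (hη0 x y) (Ne.symm hne)) (hpos x hx hne)⟩

variable (S) in
/-- The trace inequality: Green's formula for `φ² X` with a transversal field `X`. -/
theorem exists_trace_bound (i : Fin S.numEdges) :
    ∃ C, 0 ≤ C ∧ ∀ φ : Plane → ℝ, ContDiff ℝ ∞ φ →
      ∫ s in (0 : ℝ)..1, φ (S.edgePt i s) ^ 2 ≤
        C * (∫ x, φ x ^ 2 ∂S.μ + ∑ j, ∫ x, pd j φ x ^ 2 ∂S.μ) := by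
  obtain ⟨X, hX, hpos⟩ := S.exists_transversal
  have hXc : ∀ j, ContinuousOn (X j) (closure S.carrier) := fun j => continuousOn_smooth (hX j)
  obtain ⟨s₀, hs₀, hmin⟩ := (isCompact_Icc (a := (0 : ℝ)) (b := 1)).exists_isMinOn
    (Set.nonempty_Icc.2 zero_le_one) (continuousOn_comp_edgePt (continuousOn_flux hXc i) i)
  set m := S.flux X i (S.edgePt i s₀) with hm
  have hm0 : 0 < m := hpos i s₀ hs₀
  choose B hB0 hB using fun j => exists_bound (hXc j)
  have hdc : ContinuousOn (fun x => ∑ j, pd j (X j) x) (closure S.carrier) :=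
    continuousOn_smooth (ContDiff.sum fun j _ => contDiff_pd (hX j) j)
  obtain ⟨D, hD0, hD⟩ := exists_bound hdc
  have hl := S.len_pos i
  refine ⟨(S.len i * m)⁻¹ * (B 0 + B 1 + D), by have := hB0 0; have := hB0 1; positivity,
    fun φ hφ => ?_⟩
  have hφ2 : ContDiff ℝ ∞ fun x => φ x * φ x := hφ.mul hφ
  have hgreen := green hXc (integrable_of_continuousOn hdc) (isWeakDiv_of_contDiffOn
    (fun j => ((hX j).of_le (by simp)).contDiffOn) hXc
    fun j => integrable_of_continuousOn (continuousOn_smooth (contDiff_pd (hX j) j))) hφ2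
  have hi1 : Integrable (fun x => φ x ^ 2) S.μ :=
    integrable_of_continuousOn (hφ.continuous.pow 2).continuousOn
  have hi2 : ∀ j, Integrable (fun x => pd j φ x ^ 2) S.μ := fun j =>
    integrable_of_continuousOn ((contDiff_pd hφ j).continuous.pow 2).continuousOn
  have hdom : ∫ x, (∑ j, X j x * pd j (fun x => φ x * φ x) x + (∑ j, pd j (X j) x) * (φ x * φ x))
      ∂S.μ ≤ (B 0 + B 1 + D) * (∫ x, φ x ^ 2 ∂S.μ + ∑ j, ∫ x, pd j φ x ^ 2 ∂S.μ) := by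
    rw [← integral_finsetSum _ fun j _ => hi2 j, ← integral_add hi1 (integrable_finsetSum _
      fun j _ => hi2 j), ← integral_const_mul]
    refine integral_mono_ae (integrable_green hXc (integrable_of_continuousOn hdc) hφ2)
      ((hi1.add (integrable_finsetSum _ fun j _ => hi2 j)).const_mul _) ?_
    filter_upwards [S.ae_mem] with x hx
    have hxc := subset_closure hx
    simp only [Fin.sum_univ_two]
    rw [pd_mul _ (ContDiff.diffAt hφ x) (ContDiff.diffAt hφ x),
      pd_mul _ (ContDiff.diffAt hφ x) (ContDiff.diffAt hφ x)]
    have e0 := abs_le.1 (hB 0 x hxc)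
    have e1 := abs_le.1 (hB 1 x hxc)
    have e2 := abs_le.1 (hD x hxc)
    simp only [Fin.sum_univ_two] at e2
    set a := φ x
    set p := pd 0 φ x
    set q := pd 1 φ x
    have f0 : X 0 x * (p * a + a * p) ≤ B 0 * (a ^ 2 + p ^ 2) := by
      nlinarith [mul_nonneg (sub_nonneg.2 e0.2) (sq_nonneg (a + p)),
        mul_nonneg (neg_le_iff_add_nonneg.1 e0.1) (sq_nonneg (a - p))]
    have f1 : X 1 x * (q * a + a * q) ≤ B 1 * (a ^ 2 + q ^ 2) := by
      nlinarith [mul_nonneg (sub_nonneg.2 e1.2) (sq_nonneg (a + q)),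
        mul_nonneg (neg_le_iff_add_nonneg.1 e1.1) (sq_nonneg (a - q))]
    have f2 : (pd 0 (X 0) x + pd 1 (X 1) x) * (a * a) ≤ D * a ^ 2 := by
      nlinarith [mul_nonneg (sub_nonneg.2 e2.2) (sq_nonneg a)]
    have g0 := mul_nonneg (hB0 0) (sq_nonneg q)
    have g1 := mul_nonneg (hB0 1) (sq_nonneg p)
    have g2 := mul_nonneg hD0 (add_nonneg (sq_nonneg p) (sq_nonneg q))
    nlinarith
  have hφe : ∀ k, ContinuousOn (fun s => φ (S.edgePt k s) ^ 2) (Set.Icc 0 1) := fun k =>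
    ((hφ.continuous.comp (S.continuous_edgePt k)).pow 2).continuousOn
  have hflow : S.len i * m * ∫ s in (0 : ℝ)..1, φ (S.edgePt i s) ^ 2 ≤
      ∑ k, S.len k * ∫ s in (0 : ℝ)..1, φ (S.edgePt k s) * φ (S.edgePt k s) *
        S.flux X k (S.edgePt k s) := by
    have hnn : ∀ k ∈ Finset.univ, 0 ≤ S.len k * ∫ s in (0 : ℝ)..1,
        φ (S.edgePt k s) * φ (S.edgePt k s) * S.flux X k (S.edgePt k s) := fun k _ =>
      mul_nonneg (S.len_pos k).le (intervalIntegral.integral_nonneg zero_le_one fun s hs =>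
        mul_nonneg (mul_self_nonneg _) (hpos k s hs).le)
    refine le_trans ?_ (Finset.single_le_sum hnn (Finset.mem_univ i))
    rw [mul_assoc, ← intervalIntegral.integral_const_mul]
    refine mul_le_mul_of_nonneg_left ?_ hl.le
    refine intervalIntegral.integral_mono_on zero_le_one ?_ ?_ fun s hs => ?_
    · refine ContinuousOn.intervalIntegrable ?_
      rw [Set.uIcc_of_le zero_le_one]
      exact continuousOn_const.mul (hφe i)
    · exact intervalIntegrable_comp_edgePt
        (f := fun x => φ x * φ x * S.flux X i x)
        ((continuousOn_smooth hφ2).mul (continuousOn_flux hXc i)) i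
    · have := hmin hs
      simp only [Set.mem_ofPred_eq] at this
      nlinarith [sq_nonneg (φ (S.edgePt i s))]
  rw [mul_assoc, ← div_eq_inv_mul, le_div_iff₀ (by positivity), mul_comm]
  refine hflow.trans ?_
  rw [← hgreen]
  exact hdom

end PolygonalDomain

theorem tendsto_eLpNorm_two_iff {α : Type*} [MeasurableSpace α] {ν : Measure α}
    {f : ℕ → α → ℝ} (hf : ∀ k, MemLp (f k) 2 ν) :
    Tendsto (fun k => eLpNorm (f k) 2 ν) atTop (𝓝 0) ↔
      Tendsto (fun k => ∫ x, f k x ^ 2 ∂ν) atTop (𝓝 0) := by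
  have h1 : ∀ k, eLpNorm (f k) 2 ν = ENNReal.ofReal (√(∫ x, f k x ^ 2 ∂ν)) := by
    intro k
    rw [(hf k).eLpNorm_eq_integral_rpow_norm two_ne_zero ENNReal.ofNat_ne_top, Real.sqrt_eq_rpow]
    norm_num
  have h2 : ∀ k, 0 ≤ ∫ x, f k x ^ 2 ∂ν := fun k => integral_nonneg fun x => sq_nonneg _
  constructor
  · intro h
    have h3 := (ENNReal.tendsto_toReal ENNReal.zero_ne_top).comp h
    have h4 := h3.pow 2
    simp only [ENNReal.toReal_zero, ne_eq, OfNat.ofNat_ne_zero, not_false_eq_true,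
      zero_pow] at h4
    refine h4.congr fun k => ?_
    simp only [Function.comp_apply]
    rw [h1, ENNReal.toReal_ofReal (Real.sqrt_nonneg _), Real.sq_sqrt (h2 k)]
  · intro h
    simp only [h1]
    have h3 := (ENNReal.continuous_ofReal.comp Real.continuous_sqrt).tendsto 0
    simp only [Function.comp_apply, Real.sqrt_zero, ENNReal.ofReal_zero] at h3
    exact h3.comp h

/-- The smooth functions `φ k` converge to `u` in `H¹`. -/
def ConvH1 {S : PolygonalDomain} (φ : ℕ → Plane → ℝ) (u : H1Fun S) : Prop :=
  Tendsto (fun k => eLpNorm (fun x => φ k x - u.val x) 2 S.μ) atTop (𝓝 0) ∧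
  ∀ j, Tendsto (fun k => eLpNorm (fun x => pd j (φ k) x - u.grad j x) 2 S.μ) atTop (𝓝 0)

theorem tendsto_eLpNorm_sub_of_common_limit {α : Type*} [MeasurableSpace α] {ν : Measure α}
    {f g : ℕ → α → ℝ} {u : α → ℝ} (hf : ∀ k, AEStronglyMeasurable (f k) ν)
    (hg : ∀ k, AEStronglyMeasurable (g k) ν) (hu : AEStronglyMeasurable u ν)
    (h1 : Tendsto (fun k => eLpNorm (fun x => f k x - u x) 2 ν) atTop (𝓝 0))
    (h2 : Tendsto (fun k => eLpNorm (fun x => g k x - u x) 2 ν) atTop (𝓝 0)) :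
    Tendsto (fun k => eLpNorm (fun x => f k x - g k x) 2 ν) atTop (𝓝 0) := by
  have h3 := h1.add h2
  rw [add_zero] at h3
  refine tendsto_of_tendsto_of_tendsto_of_le_of_le tendsto_const_nhds h3 (fun _ => zero_le)
    fun k => ?_
  have h4 : (fun x => f k x - g k x) = (fun x => f k x - u x) - fun x => g k x - u x := by
    funext x
    simp
  rw [h4]
  exact eLpNorm_sub_le ((hf k).sub hu) ((hg k).sub hu) one_le_two

theorem setIntegral_Icc_eq (f : ℝ → ℝ) :
    ∫ s, f s ∂(volume.restrict (Set.Icc (0 : ℝ) 1)) = ∫ s in (0 : ℝ)..1, f s := by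
  rw [intervalIntegral.integral_of_le zero_le_one, integral_Icc_eq_integral_Ioc]

theorem memLp_Icc_of_continuousOn {f : ℝ → ℝ} (hf : ContinuousOn f (Set.Icc 0 1)) :
    MemLp f 2 (volume.restrict (Set.Icc (0 : ℝ) 1)) := by
  obtain ⟨C, hC⟩ := isCompact_Icc.exists_bound_of_continuousOn hf
  refine MemLp.of_bound (hf.aestronglyMeasurable measurableSet_Icc) C ?_
  filter_upwards [ae_restrict_mem measurableSet_Icc] with s hs
  exact hC s hs

/-- Traces are limits of the restrictions of every approximating sequence of smooth functions. -/
theorem HasTrace.tendsto {S : PolygonalDomain} {u : H1Fun S} {i : Fin S.numEdges} {g : ℝ → ℝ}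
    (h : HasTrace u i g) {φ : ℕ → Plane → ℝ} (hφ : ∀ k, ContDiff ℝ ∞ (φ k)) (hφu : ConvH1 φ u) :
    Tendsto (fun k => eLpNorm (fun s => φ k (S.edgePt i s) - g s) 2
      (volume.restrict (Set.Icc 0 1))) atTop (𝓝 0) := by
  obtain ⟨hg, ψ, hψ, hψu, hψd, hψg⟩ := h
  have hsm : ∀ k, ContDiff ℝ ∞ fun x => φ k x - ψ k x := fun k => (hφ k).sub (hψ k)
  have hpd : ∀ k j x, pd j (fun x => φ k x - ψ k x) x = pd j (φ k) x - pd j (ψ k) x := by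
    intro k j x
    unfold pd
    rw [fderiv_fun_sub (ContDiff.diffAt (hφ k) x) (ContDiff.diffAt (hψ k) x)]
    rfl
  have aes : ∀ {f : Plane → ℝ}, ContDiff ℝ ∞ f → AEStronglyMeasurable f S.μ := fun hf =>
    hf.continuous.aestronglyMeasurable
  have h0 : Tendsto (fun k => ∫ x, (φ k x - ψ k x) ^ 2 ∂S.μ) atTop (𝓝 0) :=
    (tendsto_eLpNorm_two_iff fun k =>
      PolygonalDomain.memLp_of_continuousOn (PolygonalDomain.continuousOn_smooth (hsm k))).1
    (tendsto_eLpNorm_sub_of_common_limit (fun k => aes (hφ k)) (fun k => aes (hψ k))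
      u.val_mem.aestronglyMeasurable hφu.1 hψu)
  have h1 : ∀ j, Tendsto (fun k => ∫ x, (pd j (φ k) x - pd j (ψ k) x) ^ 2 ∂S.μ) atTop (𝓝 0) :=
    fun j => (tendsto_eLpNorm_two_iff fun k =>
      PolygonalDomain.memLp_of_continuousOn (PolygonalDomain.continuousOn_smooth
        ((contDiff_pd (hφ k) j).sub (contDiff_pd (hψ k) j)))).1
    (tendsto_eLpNorm_sub_of_common_limit (fun k => aes (contDiff_pd (hφ k) j))
      (fun k => aes (contDiff_pd (hψ k) j)) (u.grad_mem j).aestronglyMeasurable (hφu.2 j) (hψd j))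
  obtain ⟨C, hC0, hC⟩ := S.exists_trace_bound i
  have hcont : ∀ k, Continuous fun s => φ k (S.edgePt i s) - ψ k (S.edgePt i s) := fun k =>
    (hsm k).continuous.comp (S.continuous_edgePt i)
  have h2 : Tendsto (fun k => eLpNorm (fun s => φ k (S.edgePt i s) - ψ k (S.edgePt i s)) 2
      (volume.restrict (Set.Icc 0 1))) atTop (𝓝 0) := by
    rw [tendsto_eLpNorm_two_iff fun k => memLp_Icc_of_continuousOn (hcont k).continuousOn]
    simp only [setIntegral_Icc_eq]
    have h3 := (h0.add (tendsto_finsetSum (Finset.univ : Finset (Fin 2))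
      fun j _ => h1 j)).const_mul C
    simp only [Finset.sum_const_zero, add_zero, mul_zero] at h3
    refine squeeze_zero (fun k => intervalIntegral.integral_nonneg zero_le_one
      fun s _ => sq_nonneg _) (fun k => ?_) h3
    have := hC _ (hsm k)
    simpa only [hpd] using this
  have h3 := h2.add hψg
  rw [add_zero] at h3
  refine tendsto_of_tendsto_of_tendsto_of_le_of_le tendsto_const_nhds h3 (fun _ => zero_le)
    fun k => ?_
  have h4 : (fun s => φ k (S.edgePt i s) - g s) = (fun s => φ k (S.edgePt i s) -
      ψ k (S.edgePt i s)) + fun s => ψ k (S.edgePt i s) - g s := by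
    funext s
    simp
  rw [h4]
  exact eLpNorm_add_le (hcont k).aestronglyMeasurable
    (((hψ k).continuous.comp (S.continuous_edgePt i)).aestronglyMeasurable.sub
      hg.aestronglyMeasurable) one_le_two

/-! ### Density of smooth functions -/

theorem continuous_translate_L2 {f : Plane → ℝ} (hf : MemLp f 2 (volume : Measure Plane)) :
    Tendsto (fun w : Plane => eLpNorm (fun y => f (y - w) - f y) 2 (volume : Measure Plane)) (𝓝 0)
      (𝓝 0) := by
  let g : Plane → C(Plane, Plane) := fun w => ⟨fun y => y - w, by fun_prop⟩
  have hg : Continuous g := by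
    refine ContinuousMap.continuous_of_continuous_uncurry _ ?_
    exact continuous_snd.sub continuous_fst
  have hgm : ∀ w, MeasurePreserving (g w) (volume : Measure Plane) volume := fun w =>
    measurePreserving_sub_right volume w
  have h1 : Tendsto (fun w => Lp.compMeasurePreserving (g w) (hgm w) (hf.toLp f)) (𝓝 0)
      (𝓝 (Lp.compMeasurePreserving (g 0) (hgm 0) (hf.toLp f))) :=
    tendsto_const_nhds.compMeasurePreservingLp hg.continuousAt hgm (hgm 0) ENNReal.ofNat_ne_top
  simp only [Lp.toLp_compMeasurePreserving hf] at h1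
  rw [Lp.tendsto_Lp_iff_tendsto_eLpNorm''] at h1
  refine h1.congr fun w => ?_
  congr 1
  funext y
  simp [g]

/-- Averaging over small translations changes a square integrable function little. -/
theorem eLpNorm_average_sub_le {f : Plane → ℝ} (hfm : Measurable f) {ν : Measure Plane}
    [IsProbabilityMeasure ν] {ε : ENNReal} (hν : ∀ᵐ w ∂ν,
      eLpNorm (fun y => f (y - w) - f y) 2 (volume : Measure Plane) ≤ ε) :
    eLpNorm (fun y => ∫ w, (f (y - w) - f y) ∂ν) 2 (volume : Measure Plane) ≤ ε := by
  have hm : Measurable fun z : Plane × Plane => ‖f (z.1 - z.2) - f z.1‖ₑ ^ 2 :=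
    (((hfm.comp (measurable_fst.sub measurable_snd)).sub (hfm.comp measurable_fst)).enorm).pow_const 2
  have hsq : ∀ {m : Measure Plane} (h : Plane → ℝ), ∫⁻ y, ‖h y‖ₑ ^ 2 ∂m = eLpNorm h 2 m ^ 2 := by
    intro m h
    rw [eLpNorm_eq_lintegral_rpow_enorm_toReal two_ne_zero ENNReal.ofNat_ne_top,
      ← ENNReal.rpow_natCast, ← ENNReal.rpow_mul]
    norm_num
  have hjensen : ∀ y, ‖∫ w, (f (y - w) - f y) ∂ν‖ₑ ^ 2 ≤ ∫⁻ w, ‖f (y - w) - f y‖ₑ ^ 2 ∂ν := by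
    intro y
    rw [hsq fun w => f (y - w) - f y]
    refine pow_le_pow_left₀ zero_le ?_ 2
    refine (enorm_integral_le_lintegral_enorm _).trans ?_
    rw [← eLpNorm_one_eq_lintegral_enorm]
    refine eLpNorm_le_eLpNorm_of_exponent_le one_le_two ?_
    exact ((hfm.comp (measurable_const.sub measurable_id)).sub
      measurable_const).aestronglyMeasurable
  have h1 : eLpNorm (fun y => ∫ w, (f (y - w) - f y) ∂ν) 2 (volume : Measure Plane) ^ 2 ≤ ε ^ 2 := by
    rw [← hsq]
    calc ∫⁻ y, ‖∫ w, (f (y - w) - f y) ∂ν‖ₑ ^ 2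
        ≤ ∫⁻ y, (∫⁻ w, ‖f (y - w) - f y‖ₑ ^ 2 ∂ν) := lintegral_mono hjensen
      _ = ∫⁻ w, (∫⁻ y, ‖f (y - w) - f y‖ₑ ^ 2) ∂ν := by
          rw [lintegral_lintegral_swap]
          exact hm.aemeasurable
      _ ≤ ∫⁻ _, ε ^ 2 ∂ν := by
          refine lintegral_mono_ae ?_
          filter_upwards [hν] with w hw
          rw [hsq fun y => f (y - w) - f y]
          exact pow_le_pow_left₀ zero_le hw 2
      _ = ε ^ 2 := by simp
  exact (ENNReal.pow_le_pow_left_iff two_ne_zero).1 h1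

/-- The convolution of `f` with the kernel `ρ`. -/
def moll (f ρ : Plane → ℝ) (y : Plane) : ℝ := ∫ w, f w * ρ (y - w)

theorem moll_eq (f ρ : Plane → ℝ) :
    moll f ρ = convolution f ρ (ContinuousLinearMap.mul ℝ ℝ) volume := rfl

theorem moll_eq_swap (f ρ : Plane → ℝ) (y : Plane) : moll f ρ y = ∫ w, ρ w * f (y - w) := by
  unfold moll
  rw [← integral_sub_left_eq_self _ volume y]
  congr 1
  funext w
  rw [sub_sub_cancel, mul_comm]

theorem contDiff_moll {f ρ : Plane → ℝ} (hf : LocallyIntegrable f volume)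
    (hρ : ContDiff ℝ ∞ ρ) (hc : HasCompactSupport ρ) : ContDiff ℝ ∞ (moll f ρ) := by
  rw [moll_eq]
  exact hc.contDiff_convolution_right _ hf hρ

theorem pd_moll {f ρ : Plane → ℝ} (hf : LocallyIntegrable f volume)
    (hρ : ContDiff ℝ ∞ ρ) (hc : HasCompactSupport ρ) (j : Fin 2) (y : Plane) :
    pd j (moll f ρ) y = moll f (pd j ρ) y := by
  have h := hc.hasFDerivAt_convolution_right (ContinuousLinearMap.mul ℝ ℝ) hf
    (hρ.of_le (m := 1) (by simp)) y
  rw [pd, moll_eq, h.fderiv, convolution_precompR_apply _ hf (hc.fderiv ℝ)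
    (hρ.continuous_fderiv (by simp))]
  rfl

/-- Mollification approximates in `L²` if the kernels shrink to the origin. -/
theorem tendsto_moll {f : Plane → ℝ} (hf : MemLp f 2 (volume : Measure Plane))
    {ρ : ℕ → Plane → ℝ} (hρ : ∀ n, Continuous (ρ n)) (hc : ∀ n, HasCompactSupport (ρ n))
    (h0 : ∀ n x, 0 ≤ ρ n x) (h1 : ∀ n, ∫ x, ρ n x = 1) {R : ℕ → ℝ}
    (hR : Tendsto R atTop (𝓝 0)) (hsupp : ∀ n x, ρ n x ≠ 0 → ‖x‖ ≤ R n) :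
    Tendsto (fun n => eLpNorm (fun y => moll f (ρ n) y - f y) 2 (volume : Measure Plane)) atTop
      (𝓝 0) := by
  -- pass to a measurable representative
  obtain ⟨f', hf'm, hff'⟩ := hf.aestronglyMeasurable
  have hf' : MemLp f' 2 (volume : Measure Plane) := (memLp_congr_ae hff').1 hf
  have hmoll : ∀ n, moll f (ρ n) = moll f' (ρ n) := fun n => by
    rw [moll_eq, moll_eq]
    exact convolution_congr _ hff' (ae_eq_refl _)
  have hcongr : ∀ n, eLpNorm (fun y => moll f (ρ n) y - f y) 2 (volume : Measure Plane) =
      eLpNorm (fun y => moll f' (ρ n) y - f' y) 2 (volume : Measure Plane) := by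
    intro n
    rw [hmoll]
    refine eLpNorm_congr_ae ?_
    filter_upwards [hff'] with y hy
    rw [hy]
  simp only [hcongr]
  have htr := continuous_translate_L2 hf'
  rw [ENNReal.tendsto_nhds_zero] at htr ⊢
  intro ε hε
  obtain ⟨r, hr, hball⟩ := Metric.eventually_nhds_iff.1 (htr ε hε)
  filter_upwards [hR.eventually (Iio_mem_nhds hr)] with n hn
  let ν : Measure Plane := volume.withDensity fun x => ENNReal.ofReal (ρ n x)
  have hρi : Integrable (ρ n) := (hρ n).integrable_of_hasCompactSupport (hc n)
  have hνp : IsProbabilityMeasure ν := by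
    refine ⟨?_⟩
    rw [withDensity_apply _ MeasurableSet.univ, Measure.restrict_univ,
      ← ofReal_integral_eq_lintegral_ofReal hρi (Eventually.of_forall (h0 n)), h1,
      ENNReal.ofReal_one]
  have hint : ∀ g : Plane → ℝ, ∫ w, g w ∂ν = ∫ w, ρ n w * g w := by
    intro g
    rw [integral_withDensity_eq_integral_toReal_smul (hρ n).measurable.ennreal_ofReal
      (Eventually.of_forall fun _ => ENNReal.ofReal_lt_top)]
    congr 1
    funext w
    rw [ENNReal.toReal_ofReal (h0 n w), smul_eq_mul]
  have hloc : LocallyIntegrable f' (volume : Measure Plane) := hf'.locallyIntegrable one_le_two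
  have heq : (fun y => moll f' (ρ n) y - f' y) = fun y => ∫ w, (f' (y - w) - f' y) ∂ν := by
    funext y
    rw [hint, moll_eq_swap]
    simp only [mul_sub]
    rw [integral_sub, integral_mul_const, h1, one_mul]
    · have := (hc n).convolutionExists_left (ContinuousLinearMap.mul ℝ ℝ) (hρ n) hloc y
      exact this
    · exact hρi.mul_const _
  rw [heq]
  refine eLpNorm_average_sub_le hf'm.measurable ?_
  rw [ae_withDensity_iff (hρ n).measurable.ennreal_ofReal]
  refine Eventually.of_forall fun w hw => hball ?_
  rw [dist_zero_right]
  refine (hsupp n w fun h => hw (by rw [h, ENNReal.ofReal_zero])).trans_lt hn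

namespace PolygonalDomain

variable {S : PolygonalDomain}

theorem memLp_indicator {u : Plane → ℝ} (hu : S.IsL2 u) :
    MemLp (S.carrier.indicator u) 2 (volume : Measure Plane) :=
  (memLp_indicator_iff_restrict S.isOpen.measurableSet).2 hu

theorem locallyIntegrable_indicator {u : Plane → ℝ} (hu : S.IsL2 u) :
    LocallyIntegrable (S.carrier.indicator u) (volume : Measure Plane) :=
  (memLp_indicator hu).locallyIntegrable one_le_two

theorem moll_indicator (u ρ : Plane → ℝ) (y : Plane) :
    moll (S.carrier.indicator u) ρ y = ∫ w, u w * ρ (y - w) ∂S.μ := by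
  rw [moll, μ, ← integral_indicator S.isOpen.measurableSet]
  congr 1
  funext w
  by_cases hw : w ∈ S.carrier <;> simp [hw]

/-- Mollification commutes with weak derivatives at points that the kernel, centred there, sees
only from inside the domain. -/
theorem pd_moll_indicator {u g ρ : Plane → ℝ} {j : Fin 2} (hu : S.IsL2 u)
    (hw : IsWeakDeriv S j u g) (hρ : ContDiff ℝ ∞ ρ) (hc : HasCompactSupport ρ) {y : Plane}
    (hy : ∀ w ∈ tsupport ρ, y - w ∈ S.carrier) :
    pd j (moll (S.carrier.indicator u) ρ) y = moll (S.carrier.indicator g) ρ y := by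
  rw [pd_moll (locallyIntegrable_indicator hu) hρ hc, moll_indicator, moll_indicator]
  have hφ : ContDiff ℝ ∞ fun w => ρ (y - w) := hρ.comp (contDiff_const.sub contDiff_id)
  have hsub : tsupport (fun w => ρ (y - w)) ⊆ (fun w => y - w) '' tsupport ρ := by
    have hcl : IsClosed ((fun w => y - w) '' tsupport ρ) :=
      (hc.isCompact.image (by fun_prop)).isClosed
    refine closure_minimal (fun w hw => ⟨y - w, subset_tsupport _ hw, by simp⟩) hcl
  have htest : S.IsTest fun w => ρ (y - w) := by
    refine ⟨hφ, (hc.isCompact.image (by fun_prop : Continuous fun w => y - w)).of_isClosed_subset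
      (isClosed_tsupport _) hsub, hsub.trans ?_⟩
    rintro _ ⟨w, hw, rfl⟩
    exact hy w hw
  have h1 := hw _ htest
  have h2 : ∀ w, pd j (fun w => ρ (y - w)) w = -pd j ρ (y - w) := by
    intro w
    have h3 : HasFDerivAt (fun w : Plane => y - w) (-ContinuousLinearMap.id ℝ Plane) w :=
      (hasFDerivAt_id w).const_sub y
    have h4 := (ContDiff.diffAt hρ (y - w)).hasFDerivAt.comp w h3
    have h5 := h4.fderiv
    simp only [Function.comp_def] at h5
    rw [pd, h5]
    simp [pd]
  simp only [h2, mul_neg, integral_neg, neg_inj] at h1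
  exact h1

variable (S) in
/-- A finite partition of unity near the closed domain and, for each of its members, a sequence of
mollifiers that are shifted so that near the support of that member only points of the
domain are involved. -/
theorem exists_mollifiers :
    ∃ (t : Finset Plane) (η : Plane → Plane → ℝ) (ρ : Plane → ℕ → Plane → ℝ),
      (∀ x, ContDiff ℝ ∞ (η x)) ∧ (∀ x n, ContDiff ℝ ∞ (ρ x n)) ∧
      (∀ x n, HasCompactSupport (ρ x n)) ∧ (∀ y ∈ S.carrier, ∑ x ∈ t, η x y = 1) ∧
      (∀ x ∈ t, ∀ y ∈ S.carrier, y ∈ tsupport (η x) → ∀ n, ∀ w ∈ tsupport (ρ x n),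
        y - w ∈ S.carrier) ∧
      ∀ x f, MemLp f 2 (volume : Measure Plane) →
        Tendsto (fun n => eLpNorm (fun y => moll f (ρ x n) y - f y) 2 (volume : Measure Plane))
          atTop (𝓝 0) := by
  choose h c δ hc hδ hcone _ using S.exists_cone
  obtain ⟨t, η, -, hη, -, hηU, hsum⟩ := exists_partition S.isCompact_closure
    (fun x => Metric.ball x (δ x)) (fun _ _ => Metric.isOpen_ball)
    (fun x _ => Metric.mem_ball_self (hδ x))
  let τ : Plane → ℕ → ℝ := fun x n => δ x / 2 * (1 / ((n : ℝ) + 1))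
  have hτ0 : ∀ x n, 0 < τ x n := fun x n => by have := hδ x; positivity
  have hτ1 : ∀ x n, τ x n < δ x := by
    intro x n
    have h1 : 1 / ((n : ℝ) + 1) ≤ 1 := by
      rw [div_le_one (by positivity)]
      have : (0 : ℝ) ≤ n := by positivity
      linarith
    have := hδ x
    have := mul_le_mul_of_nonneg_left h1 (by positivity : 0 ≤ δ x / 2)
    change δ x / 2 * (1 / ((n : ℝ) + 1)) < δ x
    linarith
  let b : ∀ x n, ContDiffBump (-(τ x n • h x)) := fun x n =>
    ⟨τ x n * c x / 4, τ x n * c x / 2, by have := hτ0 x n; have := hc x; positivity, by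
      have := mul_pos (hτ0 x n) (hc x); linarith⟩
  refine ⟨t, η, fun x n => (b x n).normed volume, hη, fun x n => (b x n).contDiff_normed,
    fun x n => (b x n).hasCompactSupport_normed, fun y hy => hsum y (subset_closure hy), ?_, ?_⟩
  · intro x hx y hyS hy n w hw
    rw [(b x n).tsupport_normed_eq, Metric.mem_closedBall, dist_eq_norm] at hw
    change ‖w - -(τ x n • h x)‖ ≤ τ x n * c x / 2 at hw
    have hyx : dist y x < δ x := hηU x hx hy
    have := hcone x y hyS hyx (-((τ x n)⁻¹ • w)) (by
      have h1 : -((τ x n)⁻¹ • w) - h x = -((τ x n)⁻¹ • (w - -(τ x n • h x))) := by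
        rw [sub_neg_eq_add, smul_add, smul_smul, inv_mul_cancel₀ (hτ0 x n).ne', one_smul]
        abel
      rw [dist_eq_norm, h1, norm_neg, norm_smul, norm_inv, Real.norm_of_nonneg (hτ0 x n).le,
        inv_mul_lt_iff₀ (hτ0 x n)]
      have := mul_pos (hτ0 x n) (hc x)
      linarith) (τ x n) ⟨hτ0 x n, hτ1 x n⟩
    rwa [smul_neg, smul_smul, mul_inv_cancel₀ (hτ0 x n).ne', one_smul, ← sub_eq_add_neg] at this
  · intro x f hf
    refine tendsto_moll hf (fun n => (b x n).continuous_normed)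
      (fun n => (b x n).hasCompactSupport_normed) (fun n => (b x n).nonneg_normed)
      (fun n => (b x n).integral_normed) (R := fun n => τ x n * (‖h x‖ + c x)) ?_ ?_
    · have h1 : Tendsto (fun n : ℕ => δ x / 2 * (1 / ((n : ℝ) + 1))) atTop (𝓝 (δ x / 2 * 0)) :=
        tendsto_one_div_add_atTop_nhds_zero_nat.const_mul _
      rw [mul_zero] at h1
      have h2 := h1.mul_const (‖h x‖ + c x)
      rwa [zero_mul] at h2
    · intro n w hw
      have hw' : w ∈ Function.support ((b x n).normed volume) := hw
      rw [(b x n).support_normed_eq, Metric.mem_ball, dist_eq_norm] at hw'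
      change ‖w - -(τ x n • h x)‖ < τ x n * c x / 2 at hw'
      have h1 := norm_le_norm_add_norm_sub' w (-(τ x n • h x))
      rw [norm_neg, norm_smul, Real.norm_of_nonneg (hτ0 x n).le] at h1
      have := mul_pos (hτ0 x n) (hc x)
      nlinarith

/-- A sequence of functions that tends to zero in `L²` of the domain. -/
def L2Null (S : PolygonalDomain) (f : ℕ → Plane → ℝ) : Prop :=
  (∀ n, AEStronglyMeasurable (f n) S.μ) ∧ Tendsto (fun n => eLpNorm (f n) 2 S.μ) atTop (𝓝 0)

theorem L2Null.add {f g : ℕ → Plane → ℝ} (hf : S.L2Null f) (hg : S.L2Null g) :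
    S.L2Null fun n x => f n x + g n x := by
  refine ⟨fun n => (hf.1 n).add (hg.1 n), ?_⟩
  have h := hf.2.add hg.2
  rw [add_zero] at h
  exact tendsto_of_tendsto_of_tendsto_of_le_of_le tendsto_const_nhds h (fun _ => zero_le)
    fun n => eLpNorm_add_le (hf.1 n) (hg.1 n) one_le_two

theorem L2Null.sum {ι : Type*} (t : Finset ι) {f : ι → ℕ → Plane → ℝ}
    (hf : ∀ i ∈ t, S.L2Null (f i)) : S.L2Null fun n x => ∑ i ∈ t, f i n x := by
  classical
  induction t using Finset.induction_on with
  | empty => exact ⟨fun n => by simpa using aestronglyMeasurable_const, by simp⟩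
  | insert a t ha ih =>
    simp only [Finset.sum_insert ha]
    exact (hf a (Finset.mem_insert_self a t)).add
      (ih fun i hi => hf i (Finset.mem_insert_of_mem hi))

theorem L2Null.congr {f g : ℕ → Plane → ℝ} (hf : S.L2Null f)
    (h : ∀ n, ∀ x ∈ S.carrier, f n x = g n x) : S.L2Null g := by
  have hae : ∀ n, f n =ᵐ[S.μ] g n := fun n => by
    filter_upwards [S.ae_mem] with x hx
    exact h n x hx
  exact ⟨fun n => (hf.1 n).congr (hae n), hf.2.congr fun n => eLpNorm_congr_ae (hae n)⟩

theorem L2Null.mul_left {f : ℕ → Plane → ℝ} (hf : S.L2Null f) {a : Plane → ℝ}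
    (ha : ContinuousOn a (closure S.carrier)) : S.L2Null fun n x => a x * f n x := by
  obtain ⟨C, hC0, hC⟩ := exists_bound ha
  refine ⟨fun n => (integrable_of_continuousOn ha).aestronglyMeasurable.mul (hf.1 n), ?_⟩
  have h := ENNReal.Tendsto.const_mul (a := ENNReal.ofReal C) hf.2 (Or.inr ENNReal.ofReal_ne_top)
  rw [mul_zero] at h
  refine tendsto_of_tendsto_of_tendsto_of_le_of_le tendsto_const_nhds h (fun _ => zero_le)
    fun n => ?_
  refine eLpNorm_le_mul_eLpNorm_of_ae_le_mul ?_ 2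
  filter_upwards [S.ae_mem] with x hx
  rw [norm_mul]
  exact mul_le_mul_of_nonneg_right (hC x (subset_closure hx)) (norm_nonneg _)

theorem l2Null_moll {ρ : ℕ → Plane → ℝ} {u : Plane → ℝ} (hu : S.IsL2 u)
    (hs : ∀ n, ContDiff ℝ ∞ (ρ n)) (hc : ∀ n, HasCompactSupport (ρ n))
    (h : Tendsto (fun n => eLpNorm (fun y => moll (S.carrier.indicator u) (ρ n) y -
      S.carrier.indicator u y) 2 (volume : Measure Plane)) atTop (𝓝 0)) :
    S.L2Null fun n y => moll (S.carrier.indicator u) (ρ n) y - u y := by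
  have h1 : S.L2Null fun n y => moll (S.carrier.indicator u) (ρ n) y -
      S.carrier.indicator u y := by
    refine ⟨fun n => ?_, ?_⟩
    · exact (contDiff_moll (locallyIntegrable_indicator hu) (hs n)
        (hc n)).continuous.aestronglyMeasurable.sub
        (memLp_indicator hu).aestronglyMeasurable.restrict
    · exact tendsto_of_tendsto_of_tendsto_of_le_of_le tendsto_const_nhds h (fun _ => zero_le)
        fun n => eLpNorm_mono_measure _ Measure.restrict_le_self
  refine h1.congr fun n x hx => ?_
  rw [Set.indicator_of_mem hx]

theorem pd_eq_of_eqOn {f g : Plane → ℝ} (h : ∀ y ∈ S.carrier, f y = g y) {y : Plane}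
    (hy : y ∈ S.carrier) (j : Fin 2) : pd j f y = pd j g y := by
  refine pd_congr j ?_
  filter_upwards [S.isOpen.mem_nhds hy] with z hz
  exact h z hz

end PolygonalDomain

open PolygonalDomain in
/-- Smooth functions are dense in `H¹` of a polygonal domain, and one and the same construction
yields approximations in `H²`: the pieces of a function given by a partition of unity are mollified
with kernels shifted into the domain. -/
theorem exists_smoothing (S : PolygonalDomain) :
    ∃ A : ℕ → (Plane → ℝ) → Plane → ℝ,
      (∀ u : H1Fun S, (∀ n, ContDiff ℝ ∞ (A n u.val)) ∧ ConvH1 (fun n => A n u.val) u) ∧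
      ∀ (w : H2Fun S) (i : Fin 2), ConvH1 (fun n => pd i (A n w.val)) (w.partialH1 i) := by
  obtain ⟨t, η, ρ, hη, hρ, hρc, hsum, hin, hconv⟩ := S.exists_mollifiers
  let m : Plane → ℕ → (Plane → ℝ) → Plane → ℝ := fun x n u =>
    moll (S.carrier.indicator u) (ρ x n)
  have hms : ∀ x n {u : Plane → ℝ}, S.IsL2 u → ContDiff ℝ ∞ (m x n u) := fun x n u hu =>
    contDiff_moll (locallyIntegrable_indicator hu) (hρ x n) (hρc x n)
  have hnull : ∀ x {u : Plane → ℝ}, S.IsL2 u → S.L2Null fun n y => m x n u y - u y :=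
    fun x u hu => l2Null_moll hu (hρ x) (hρc x) (hconv x _ (memLp_indicator hu))
  -- derivatives of the partition of unity sum up to zero
  have hs1 : ∀ j, ∀ y ∈ S.carrier, ∑ x ∈ t, pd j (η x) y = 0 := by
    intro j y hy
    rw [← pd_sum t j fun x _ => ContDiff.diffAt (hη x) y, pd_eq_of_eqOn (g := fun _ => 1) hsum hy]
    simp [pd]
  have hs2 : ∀ i j, ∀ y ∈ S.carrier, ∑ x ∈ t, pd j (pd i (η x)) y = 0 := by
    intro i j y hy
    rw [← pd_sum t j fun x _ => ContDiff.diffAt (contDiff_pd (hη x) i) y,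
      pd_eq_of_eqOn (g := fun _ => 0) (hs1 i) hy]
    simp [pd]
  have hmd : ∀ x ∈ t, ∀ n j {u g : Plane → ℝ}, S.IsL2 u → IsWeakDeriv S j u g →
      ∀ y ∈ S.carrier, y ∈ tsupport (η x) → pd j (m x n u) y = m x n g y :=
    fun x hx n j u g hu hg y hyS hy => pd_moll_indicator hu hg (hρ x n) (hρc x n)
      (hin x hx y hyS hy n)
  have hd1 : ∀ (u : H1Fun S) n j, ∀ y ∈ S.carrier,
      pd j (fun y => ∑ x ∈ t, η x y * m x n u.val y) y =
        ∑ x ∈ t, (pd j (η x) y * m x n u.val y + η x y * m x n (u.grad j) y) := by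
    intro u n j y hy
    rw [pd_sum t j fun x _ => ContDiff.diffAt ((hη x).mul (hms x n u.val_mem)) y]
    refine Finset.sum_congr rfl fun x hx => ?_
    rw [pd_mul j (ContDiff.diffAt (hη x) y) (ContDiff.diffAt (hms x n u.val_mem) y)]
    congr 1
    by_cases hyt : y ∈ tsupport (η x)
    · rw [hmd x hx n j u.val_mem (u.weak j) y hy hyt]
    · rw [image_eq_zero_of_notMem_tsupport hyt, zero_mul, zero_mul]
  have hd2 : ∀ (w : H2Fun S) n i j, ∀ y ∈ S.carrier,
      pd j (pd i (fun y => ∑ x ∈ t, η x y * m x n w.val y)) y =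
        ∑ x ∈ t, (pd j (pd i (η x)) y * m x n w.val y + pd i (η x) y * m x n (w.grad j) y +
          pd j (η x) y * m x n (w.grad i) y + η x y * m x n (w.hess i j) y) := by
    intro w n i j y hy
    rw [pd_eq_of_eqOn (hd1 w.toH1Fun n i) hy, pd_sum t j fun x _ => ContDiff.diffAt
      (((contDiff_pd (hη x) i).mul (hms x n w.val_mem)).add
        ((hη x).mul (hms x n (w.grad_mem i)))) y]
    refine Finset.sum_congr rfl fun x hx => ?_
    rw [pd_add j (ContDiff.diffAt ((contDiff_pd (hη x) i).mul (hms x n w.val_mem)) y)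
      (ContDiff.diffAt ((hη x).mul (hms x n (w.grad_mem i))) y),
      pd_mul j (ContDiff.diffAt (contDiff_pd (hη x) i) y) (ContDiff.diffAt (hms x n w.val_mem) y),
      pd_mul j (ContDiff.diffAt (hη x) y) (ContDiff.diffAt (hms x n (w.grad_mem i)) y)]
    by_cases hyt : y ∈ tsupport (η x)
    · rw [hmd x hx n j w.val_mem (w.weak j) y hy hyt,
        hmd x hx n j (w.grad_mem i) (w.weak_hess i j) y hy hyt]
      ring
    · rw [image_eq_zero_of_notMem_tsupport hyt, pd_eq_zero_of_notMem_tsupport i hyt]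
      ring
  have hval : ∀ u : H1Fun S, S.L2Null fun n y => ∑ x ∈ t, η x y * m x n u.val y - u.val y := by
    intro u
    refine (L2Null.sum t fun x _ => (hnull x u.val_mem).mul_left
      (continuousOn_smooth (hη x))).congr fun n y hy => ?_
    simp only [mul_sub, Finset.sum_sub_distrib, ← Finset.sum_mul, hsum y hy, one_mul]
  have hgrad : ∀ (u : H1Fun S) j, S.L2Null fun n y =>
      pd j (fun y => ∑ x ∈ t, η x y * m x n u.val y) y - u.grad j y := by
    intro u j
    refine (L2Null.sum t fun x _ => ((hnull x u.val_mem).mul_left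
      (continuousOn_smooth (contDiff_pd (hη x) j))).add ((hnull x (u.grad_mem j)).mul_left
      (continuousOn_smooth (hη x)))).congr fun n y hy => ?_
    rw [hd1 u n j y hy]
    simp only [mul_sub, Finset.sum_add_distrib, Finset.sum_sub_distrib, ← Finset.sum_mul,
      hsum y hy, hs1 j y hy]
    ring
  refine ⟨fun n u y => ∑ x ∈ t, η x y * m x n u y, fun u => ⟨fun n => ContDiff.sum fun x _ =>
    (hη x).mul (hms x n u.val_mem), (hval u).2, fun j => (hgrad u j).2⟩,
    fun w i => ⟨(hgrad w.toH1Fun i).2, fun j => ?_⟩⟩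
  refine ((L2Null.sum t fun x _ => ((((hnull x w.val_mem).mul_left
      (continuousOn_smooth (contDiff_pd (contDiff_pd (hη x) i) j))).add
      ((hnull x (w.grad_mem j)).mul_left (continuousOn_smooth (contDiff_pd (hη x) i)))).add
      ((hnull x (w.grad_mem i)).mul_left (continuousOn_smooth (contDiff_pd (hη x) j)))).add
      ((hnull x (w.hess_mem i j)).mul_left (continuousOn_smooth (hη x)))).congr
        fun n y hy => ?_).2
  change _ = pd j (pd i (fun y => ∑ x ∈ t, η x y * m x n w.val y)) y - w.hess i j y
  rw [hd2 w n i j y hy]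
  simp only [mul_sub, Finset.sum_add_distrib, Finset.sum_sub_distrib, ← Finset.sum_mul,
    hsum y hy, hs1 j y hy, hs1 i y hy, hs2 i j y hy]
  ring

namespace PolygonalDomain

variable {S : PolygonalDomain}

/-! ### Green's formulas on a plate -/

variable (S) in
/-- The normal derivative `∂ₙ φ` on the edge `i`. -/
def dn (i : Fin S.numEdges) (φ : Plane → ℝ) (x : Plane) : ℝ := ∑ j, S.normal i j * pd j φ x

variable (S) in
/-- The row-wise divergence `Div M`, continuously extended to the closed domain. -/
def rowDiv (M : Plane → Mat) (k : Fin 2) (x : Plane) : ℝ :=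
  ∑ j, fderivWithin ℝ (fun y => M y k j) (closure S.carrier) x (e j)

variable (S) in
/-- The boundary terms that the forces `N n` contribute to Green's formula. -/
def forceBdry (N : Plane → Mat) (v : Fin 2 → Plane → ℝ) : ℝ :=
  ∑ i, S.len i * ∫ s in (0 : ℝ)..1, ∑ k, v k (S.edgePt i s) * S.conormal N i (S.edgePt i s) k

variable (S) in
/-- The boundary terms that the bending moments contribute to Green's formula: integrals over the
edges and forces at the vertices. -/
def momentBdry (M : Plane → Mat) (φ : Plane → ℝ) : ℝ :=
  ∑ i, S.len i * (∫ s in (0 : ℝ)..1, (S.dn i φ (S.edgePt i s) * S.nn M i (S.edgePt i s) -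
      φ (S.edgePt i s) * S.shear M i (S.edgePt i s))) +
    ∑ i, φ (S.vert i) * S.jumpNt M i

theorem continuousOn_conormal {A : Plane → Mat}
    (hA : ∀ i j, ContinuousOn (fun x => A x i j) (closure S.carrier)) (i : Fin S.numEdges)
    (k : Fin 2) : ContinuousOn (fun x => S.conormal A i x k) (closure S.carrier) := by
  simp only [conormal, Matrix.mulVec, dotProduct]
  exact continuousOn_finsetSum _ fun j _ => (hA k j).mul continuousOn_const

theorem continuousOn_nn {A : Plane → Mat}
    (hA : ∀ i j, ContinuousOn (fun x => A x i j) (closure S.carrier)) (i : Fin S.numEdges) :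
    ContinuousOn (S.nn A i) (closure S.carrier) :=
  continuousOn_finsetSum _ fun k _ => (continuousOn_conormal hA i k).mul continuousOn_const

theorem contDiffOn_nt {M : Plane → Mat}
    (hM : ∀ i j, ContDiffOn ℝ 1 (fun x => M x i j) (closure S.carrier)) (i : Fin S.numEdges) :
    ContDiffOn ℝ 1 (S.nt M i) (closure S.carrier) := by
  unfold nt conormal
  simp only [Matrix.mulVec, dotProduct]
  exact ContDiffOn.sum fun k _ => (ContDiffOn.sum fun j _ =>
    (hM k j).mul contDiffOn_const).mul contDiffOn_const

theorem continuousOn_fderivWithin_apply {m : Plane → ℝ}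
    (hm : ContDiffOn ℝ 1 m (closure S.carrier)) (v : Plane) :
    ContinuousOn (fun x => fderivWithin ℝ m (closure S.carrier) x v) (closure S.carrier) :=
  (hm.continuousOn_fderivWithin S.uniqueDiffOn_closure (by simp)).clm_apply continuousOn_const

theorem continuousOn_rowDiv {M : Plane → Mat}
    (hM : ∀ i j, ContDiffOn ℝ 1 (fun x => M x i j) (closure S.carrier)) (k : Fin 2) :
    ContinuousOn (S.rowDiv M k) (closure S.carrier) :=
  continuousOn_finsetSum _ fun j _ => continuousOn_fderivWithin_apply (hM k j) _

theorem continuousOn_shear {M : Plane → Mat}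
    (hM : ∀ i j, ContDiffOn ℝ 1 (fun x => M x i j) (closure S.carrier)) (i : Fin S.numEdges) :
    ContinuousOn (S.shear M i) (closure S.carrier) := by
  refine ContinuousOn.add (continuousOn_finsetSum _ fun k _ =>
    (continuousOn_rowDiv hM k).mul continuousOn_const) ?_
  exact continuousOn_fderivWithin_apply (contDiffOn_nt hM i) _

theorem contDiff_dn {φ : Plane → ℝ} (hφ : ContDiff ℝ ∞ φ) (i : Fin S.numEdges) :
    ContDiff ℝ ∞ (S.dn i φ) :=
  ContDiff.sum fun j _ => contDiff_const.mul (contDiff_pd hφ j)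

theorem isWeakDiv_row {M : Plane → Mat}
    (hM : ∀ i j, ContDiffOn ℝ 1 (fun x => M x i j) (closure S.carrier)) (k : Fin 2) :
    S.IsWeakDiv (fun j x => M x k j) (S.rowDiv M k) := by
  have hpd : ∀ j, ∀ x ∈ S.carrier, pd j (fun y => M y k j) x =
      fderivWithin ℝ (fun y => M y k j) (closure S.carrier) x (e j) := by
    intro j x hx
    rw [pd, fderivWithin_of_mem_nhds (mem_of_superset (S.isOpen.mem_nhds hx) subset_closure)]
  have h := isWeakDiv_of_contDiffOn (S := S) (F := fun j x => M x k j)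
    (fun j => (hM k j).mono subset_closure) (fun j => (hM k j).continuousOn) (fun j => by
      refine (integrable_of_continuousOn
        (continuousOn_fderivWithin_apply (hM k j) (e j))).congr ?_
      filter_upwards [S.ae_mem] with x hx
      exact (hpd j x hx).symm)
  intro φ hφ
  rw [h φ hφ]
  congr 1
  refine integral_congr_carrier fun x hx => ?_
  simp only [rowDiv, hpd _ x hx]

/-- `Div M` has the weak divergence `div Div M`. -/
theorem isWeakDiv_rowDiv {M : Plane → Mat}
    (hM : ∀ i j, ContDiffOn ℝ 1 (fun x => M x i j) (closure S.carrier)) {g : Plane → ℝ}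
    (hdd : ∀ φ, S.IsTest φ →
      ∫ x, ∑ i, ∑ j, M x i j * pd i (pd j φ) x ∂S.μ = ∫ x, g x * φ x ∂S.μ) :
    S.IsWeakDiv (S.rowDiv M) g := by
  intro φ hφ
  have htest : ∀ k, S.IsTest (pd k φ) := fun k => ⟨contDiff_pd hφ.1 k,
    hφ.2.1.of_isClosed_subset (isClosed_tsupport _) (tsupport_pd_subset φ k),
    (tsupport_pd_subset φ k).trans hφ.2.2⟩
  have h1 : ∀ k, Integrable (fun x => S.rowDiv M k x * pd k φ x) S.μ := fun k =>
    integrable_of_continuousOn ((continuousOn_rowDiv hM k).mul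
      (continuousOn_smooth (contDiff_pd hφ.1 k)))
  have h2 : ∀ k, Integrable (fun x => ∑ j, M x k j * pd j (pd k φ) x) S.μ := fun k =>
    integrable_of_continuousOn (continuousOn_finsetSum _ fun j _ => (hM k j).continuousOn.mul
      (continuousOn_smooth (contDiff_pd (contDiff_pd hφ.1 k) j)))
  rw [integral_finsetSum _ fun k _ => h1 k, ← hdd φ hφ]
  have h3 : ∀ x, ∑ i, ∑ j, M x i j * pd i (pd j φ) x = ∑ k, ∑ j, M x k j * pd j (pd k φ) x := by
    intro x
    exact Finset.sum_congr rfl fun i _ => Finset.sum_congr rfl fun j _ => by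
      rw [pd_comm hφ.1]
  simp only [h3]
  rw [integral_finsetSum _ fun k _ => h2 k, ← Finset.sum_neg_distrib]
  refine Finset.sum_congr rfl fun k _ => ?_
  rw [isWeakDiv_row hM k (pd k φ) (htest k), neg_neg]

/-- Decomposition of a scalar product in the frame of an edge. -/
theorem sum_mul_eq_frame (i : Fin S.numEdges) (a c : Fin 2 → ℝ) :
    ∑ k, a k * c k = (∑ k, S.normal i k * a k) * (∑ k, c k * S.normal i k) +
      (∑ k, S.tangent i k * a k) * (∑ k, c k * S.tangent i k) := by
  simp only [Fin.sum_univ_two, normal_zero, normal_one]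
  have h := S.tangent_sq i
  linear_combination (-(a 0 * c 0) - a 1 * c 1) * h

theorem hasDerivAt_comp_edgePt {φ : Plane → ℝ} (hφ : ContDiff ℝ ∞ φ) (i : Fin S.numEdges)
    (s : ℝ) : HasDerivAt (fun s => φ (S.edgePt i s))
      (S.len i * ∑ k, S.tangent i k * pd k φ (S.edgePt i s)) s := by
  have h := (ContDiff.diffAt hφ (S.edgePt i s)).hasFDerivAt.comp_hasDerivAt s
    (S.hasDerivAt_edgePt i s)
  rwa [map_smul, fderiv_apply_eq_sum, smul_eq_mul] at h

theorem hasDerivWithinAt_nt {M : Plane → Mat}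
    (hM : ∀ i j, ContDiffOn ℝ 1 (fun x => M x i j) (closure S.carrier)) (i : Fin S.numEdges)
    {s : ℝ} (hs : s ∈ Set.Icc (0 : ℝ) 1) :
    HasDerivWithinAt (fun s => S.nt M i (S.edgePt i s))
      (S.len i * fderivWithin ℝ (S.nt M i) (closure S.carrier) (S.edgePt i s) (S.tangent i))
      (Set.Icc 0 1) s := by
  have h1 := (((contDiffOn_nt hM i).differentiableOn (by simp)) _
    (S.edgePt_mem_closure i hs)).hasFDerivWithinAt
  have h := h1.comp_hasDerivWithinAt s (S.hasDerivAt_edgePt i s).hasDerivWithinAt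
    fun r hr => S.edgePt_mem_closure i hr
  rwa [map_smul, smul_eq_mul] at h

/-- Integration by parts along an edge. -/
theorem integral_tangential {M : Plane → Mat}
    (hM : ∀ i j, ContDiffOn ℝ 1 (fun x => M x i j) (closure S.carrier)) {φ : Plane → ℝ}
    (hφ : ContDiff ℝ ∞ φ) (i : Fin S.numEdges) :
    S.len i * ∫ s in (0 : ℝ)..1,
      ((∑ k, S.tangent i k * pd k φ (S.edgePt i s)) * S.nt M i (S.edgePt i s) +
      φ (S.edgePt i s) *
        fderivWithin ℝ (S.nt M i) (closure S.carrier) (S.edgePt i s) (S.tangent i)) =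
    φ (S.vert (S.next i)) * S.nt M i (S.vert (S.next i)) - φ (S.vert i) * S.nt M i (S.vert i) := by
  have hcl : ContinuousOn (fun s => φ (S.edgePt i s) * S.nt M i (S.edgePt i s)) (Set.Icc 0 1) :=
    continuousOn_comp_edgePt (f := fun x => φ x * S.nt M i x)
      ((continuousOn_smooth hφ).mul (contDiffOn_nt hM i).continuousOn) i
  have hftc := intervalIntegral.integral_eq_sub_of_hasDerivAt_of_le zero_le_one hcl
    (f' := fun s => S.len i * ((∑ k, S.tangent i k * pd k φ (S.edgePt i s)) *
      S.nt M i (S.edgePt i s) + φ (S.edgePt i s) *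
      fderivWithin ℝ (S.nt M i) (closure S.carrier) (S.edgePt i s) (S.tangent i)))
    (fun s hs => by
      have h1 := hasDerivAt_comp_edgePt (S := S) hφ i s
      have h2 := (hasDerivWithinAt_nt hM i (Set.Ioo_subset_Icc_self hs)).hasDerivAt
        (Icc_mem_nhds hs.1 hs.2)
      refine (h1.mul h2).congr_deriv ?_
      ring)
    (intervalIntegrable_comp_edgePt (f := fun x => S.len i *
      ((∑ k, S.tangent i k * pd k φ x) * S.nt M i x + φ x *
      fderivWithin ℝ (S.nt M i) (closure S.carrier) x (S.tangent i)))
      (continuousOn_const.mul (((continuousOn_finsetSum _ fun k _ => continuousOn_const.mul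
        (continuousOn_smooth (contDiff_pd hφ k))).mul (contDiffOn_nt hM i).continuousOn).add
        ((continuousOn_smooth hφ).mul (continuousOn_fderivWithin_apply (contDiffOn_nt hM i) _)))) i)
  rw [intervalIntegral.integral_const_mul] at hftc
  rw [hftc, edgePt_one, edgePt_zero]

/-- Green's formula for the bending moments. -/
theorem green_moment {M : Plane → Mat}
    (hM : ∀ i j, ContDiffOn ℝ 1 (fun x => M x i j) (closure S.carrier)) {g : Plane → ℝ}
    (hg : Integrable g S.μ) (hdd : ∀ φ, S.IsTest φ →
      ∫ x, ∑ i, ∑ j, M x i j * pd i (pd j φ) x ∂S.μ = ∫ x, g x * φ x ∂S.μ)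
    {φ : Plane → ℝ} (hφ : ContDiff ℝ ∞ φ) :
    ∫ x, ∑ i, ∑ j, pd j (pd i φ) x * M x i j ∂S.μ = ∫ x, g x * φ x ∂S.μ + S.momentBdry M φ := by
  have hMc : ∀ i j, ContinuousOn (fun x => M x i j) (closure S.carrier) := fun i j =>
    (hM i j).continuousOn
  have hDc := continuousOn_rowDiv hM
  have g1 : ∀ k, _ := fun k => green (S := S) (F := fun j x => M x k j) (hMc k)
    (integrable_of_continuousOn (hDc k)) (isWeakDiv_row hM k) (contDiff_pd hφ k)
  have g2 := green hDc hg (isWeakDiv_rowDiv hM hdd) hφ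
  have i1 : ∀ k, Integrable (fun x => ∑ j, M x k j * pd j (pd k φ) x) S.μ := fun k =>
    integrable_of_continuousOn (continuousOn_finsetSum _ fun j _ => (hMc k j).mul
      (continuousOn_smooth (contDiff_pd (contDiff_pd hφ k) j)))
  have i2 : ∀ k, Integrable (fun x => S.rowDiv M k x * pd k φ x) S.μ := fun k =>
    integrable_of_continuousOn ((hDc k).mul (continuousOn_smooth (contDiff_pd hφ k)))
  have i3 : Integrable (fun x => g x * φ x) S.μ :=
    integrable_mul_of_continuousOn hg (continuousOn_smooth hφ)
  have e1 : ∀ k, ∫ x, ∑ j, M x k j * pd j (pd k φ) x ∂S.μ +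
      ∫ x, S.rowDiv M k x * pd k φ x ∂S.μ = ∑ i, S.len i * ∫ s in (0 : ℝ)..1,
        pd k φ (S.edgePt i s) * S.flux (fun j x => M x k j) i (S.edgePt i s) := by
    intro k
    rw [← integral_add (i1 k) (i2 k)]
    exact g1 k
  have e2 : ∑ k, ∫ x, S.rowDiv M k x * pd k φ x ∂S.μ + ∫ x, g x * φ x ∂S.μ =
      ∑ i, S.len i * ∫ s in (0 : ℝ)..1,
        φ (S.edgePt i s) * S.flux (S.rowDiv M) i (S.edgePt i s) := by
    rw [← integral_finsetSum _ fun k _ => i2 k, ← integral_add (integrable_finsetSum _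
      fun k _ => i2 k) i3]
    exact g2
  have e3 : ∫ x, ∑ i, ∑ j, pd j (pd i φ) x * M x i j ∂S.μ =
      ∑ k, ∫ x, ∑ j, M x k j * pd j (pd k φ) x ∂S.μ := by
    rw [← integral_finsetSum _ fun k _ => i1 k]
    simp only [mul_comm]
  -- on each edge: split into normal and tangential parts and integrate the latter by parts
  have hedge : ∀ i, (∑ k, S.len i * ∫ s in (0 : ℝ)..1,
        pd k φ (S.edgePt i s) * S.flux (fun j x => M x k j) i (S.edgePt i s)) -
      S.len i * ∫ s in (0 : ℝ)..1, φ (S.edgePt i s) * S.flux (S.rowDiv M) i (S.edgePt i s) =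
      S.len i * (∫ s in (0 : ℝ)..1, (S.dn i φ (S.edgePt i s) * S.nn M i (S.edgePt i s) -
        φ (S.edgePt i s) * S.shear M i (S.edgePt i s))) +
      (φ (S.vert (S.next i)) * S.nt M i (S.vert (S.next i)) -
        φ (S.vert i) * S.nt M i (S.vert i)) := by
    intro i
    have c1 : ∀ k, IntervalIntegrable (fun s => pd k φ (S.edgePt i s) *
        S.flux (fun j x => M x k j) i (S.edgePt i s)) volume 0 1 := fun k =>
      intervalIntegrable_comp_edgePt (f := fun x => pd k φ x * S.flux (fun j x => M x k j) i x)
        ((continuousOn_smooth (contDiff_pd hφ k)).mul (continuousOn_flux (hMc k) i)) i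
    have c2 : IntervalIntegrable (fun s => φ (S.edgePt i s) *
        S.flux (S.rowDiv M) i (S.edgePt i s)) volume 0 1 :=
      intervalIntegrable_comp_edgePt (f := fun x => φ x * S.flux (S.rowDiv M) i x)
        ((continuousOn_smooth hφ).mul (continuousOn_flux hDc i)) i
    have c3 : IntervalIntegrable (fun s => S.dn i φ (S.edgePt i s) * S.nn M i (S.edgePt i s) -
        φ (S.edgePt i s) * S.shear M i (S.edgePt i s)) volume 0 1 :=
      intervalIntegrable_comp_edgePt (f := fun x => S.dn i φ x * S.nn M i x - φ x * S.shear M i x)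
        (((continuousOn_smooth (contDiff_dn hφ i)).mul (continuousOn_nn hMc i)).sub
          ((continuousOn_smooth hφ).mul (continuousOn_shear hM i))) i
    have c4 : IntervalIntegrable (fun s => (∑ k, S.tangent i k * pd k φ (S.edgePt i s)) *
        S.nt M i (S.edgePt i s) + φ (S.edgePt i s) *
        fderivWithin ℝ (S.nt M i) (closure S.carrier) (S.edgePt i s) (S.tangent i))
        volume 0 1 :=
      intervalIntegrable_comp_edgePt (f := fun x =>
        (∑ k, S.tangent i k * pd k φ x) * S.nt M i x + φ x *
        fderivWithin ℝ (S.nt M i) (closure S.carrier) x (S.tangent i))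
        (((continuousOn_finsetSum _ fun k _ => continuousOn_const.mul
          (continuousOn_smooth (contDiff_pd hφ k))).mul (contDiffOn_nt hM i).continuousOn).add
          ((continuousOn_smooth hφ).mul (continuousOn_fderivWithin_apply (contDiffOn_nt hM i) _))) i
    have c5 : IntervalIntegrable (fun s => ∑ k, pd k φ (S.edgePt i s) *
        S.flux (fun j x => M x k j) i (S.edgePt i s)) volume 0 1 :=
      intervalIntegrable_comp_edgePt (f := fun x => ∑ k, pd k φ x *
        S.flux (fun j x => M x k j) i x) (continuousOn_finsetSum _ fun k _ =>
        (continuousOn_smooth (contDiff_pd hφ k)).mul (continuousOn_flux (hMc k) i)) i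
    rw [← integral_tangential hM hφ i, ← Finset.mul_sum, ← mul_sub, ← mul_add,
      ← intervalIntegral.integral_finsetSum fun k _ => c1 k,
      ← intervalIntegral.integral_sub c5 c2,
      ← intervalIntegral.integral_add c3 c4]
    congr 2
    funext s
    have h1 : ∀ k x, S.flux (fun j x => M x k j) i x = S.conormal M i x k := fun k x => rfl
    simp only [h1]
    rw [sum_mul_eq_frame i]
    change _ = (∑ j, S.normal i j * pd j φ (S.edgePt i s)) *
      (∑ k, S.conormal M i (S.edgePt i s) k * S.normal i k) - φ (S.edgePt i s) *
      (S.flux (S.rowDiv M) i (S.edgePt i s) +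
        fderivWithin ℝ (S.nt M i) (closure S.carrier) (S.edgePt i s) (S.tangent i)) +
      ((∑ k, S.tangent i k * pd k φ (S.edgePt i s)) *
        (∑ k, S.conormal M i (S.edgePt i s) k * S.tangent i k) + _)
    ring
  -- collect the contributions of the two edges at each vertex
  have hvert : ∑ i, (φ (S.vert (S.next i)) * S.nt M i (S.vert (S.next i)) -
      φ (S.vert i) * S.nt M i (S.vert i)) = ∑ i, φ (S.vert i) * S.jumpNt M i := by
    have h1 : ∑ i, φ (S.vert (S.next i)) * S.nt M i (S.vert (S.next i)) =
        ∑ i, φ (S.vert i) * S.nt M (S.prev i) (S.vert i) := by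
      rw [← Equiv.sum_comp S.next fun i => φ (S.vert i) * S.nt M (S.prev i) (S.vert i)]
      simp only [S.prev_next]
    rw [Finset.sum_sub_distrib, h1, ← Finset.sum_sub_distrib]
    exact Finset.sum_congr rfl fun i _ => by rw [jumpNt]; ring
  have hsum := Finset.sum_congr rfl fun i (_ : i ∈ Finset.univ) => hedge i
  rw [Finset.sum_sub_distrib, Finset.sum_comm, Finset.sum_add_distrib, hvert, ← e2] at hsum
  simp only [← e1] at hsum
  rw [Finset.sum_add_distrib] at hsum
  rw [e3, momentBdry]
  linarith

/-- Green's formula for the membrane forces. -/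
theorem green_force {N : Plane → Mat}
    (hN : ∀ i j, ContinuousOn (fun x => N x i j) (closure S.carrier))
    (hsymm : ∀ x ∈ closure S.carrier, (N x).IsSymm) {f : Fin 2 → Plane → ℝ}
    (hf : ∀ i, Integrable (f i) S.μ) (hdiv : ∀ i, S.IsWeakDiv (fun j x => N x i j) (f i))
    {v : Fin 2 → Plane → ℝ} (hv : ∀ k, ContDiff ℝ ∞ (v k)) :
    -∫ x, ∑ i, ∑ j, (pd j (v i) x + pd i (v j) x) / 2 * N x i j ∂S.μ =
      ∫ x, ∑ i, f i x * v i x ∂S.μ - S.forceBdry N v := by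
  have g1 : ∀ k, _ := fun k => green (S := S) (F := fun j x => N x k j) (hN k) (hf k) (hdiv k)
    (hv k)
  have i1 : ∀ k, Integrable (fun x => ∑ j, N x k j * pd j (v k) x) S.μ := fun k =>
    integrable_of_continuousOn (continuousOn_finsetSum _ fun j _ => (hN k j).mul
      (continuousOn_smooth (contDiff_pd (hv k) j)))
  have i2 : ∀ k, Integrable (fun x => f k x * v k x) S.μ := fun k =>
    integrable_mul_of_continuousOn (hf k) (continuousOn_smooth (hv k))
  have e1 : ∀ k, ∫ x, ∑ j, N x k j * pd j (v k) x ∂S.μ + ∫ x, f k x * v k x ∂S.μ =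
      ∑ i, S.len i * ∫ s in (0 : ℝ)..1, v k (S.edgePt i s) * S.conormal N i (S.edgePt i s) k := by
    intro k
    rw [← integral_add (i1 k) (i2 k)]
    exact g1 k
  have e2 : ∫ x, ∑ i, ∑ j, (pd j (v i) x + pd i (v j) x) / 2 * N x i j ∂S.μ =
      ∑ k, ∫ x, ∑ j, N x k j * pd j (v k) x ∂S.μ := by
    rw [← integral_finsetSum _ fun k _ => i1 k]
    refine integral_congr_carrier fun x hx => ?_
    have h := (hsymm x (subset_closure hx)).apply 0 1
    simp only [Fin.sum_univ_two]
    rw [h]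
    ring
  have e3 : S.forceBdry N v = ∑ k, ∑ i, S.len i * ∫ s in (0 : ℝ)..1,
      v k (S.edgePt i s) * S.conormal N i (S.edgePt i s) k := by
    rw [Finset.sum_comm]
    refine Finset.sum_congr rfl fun i _ => ?_
    rw [← Finset.mul_sum, intervalIntegral.integral_finsetSum fun k _ => ?_]
    exact intervalIntegrable_comp_edgePt (f := fun x => v k x * S.conormal N i x k)
      ((continuousOn_smooth (hv k)).mul (continuousOn_conormal hN i k)) i
  rw [e2, e3, integral_finsetSum _ fun k _ => i2 k]
  simp only [← e1]
  rw [Finset.sum_add_distrib]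
  ring

end PolygonalDomain

/-! ### Convergence in `L²` -/

theorem integrable_mul_of_memLp {α : Type*} [MeasurableSpace α] {ν : Measure α} {f g : α → ℝ}
    (hf : MemLp f 2 ν) (hg : MemLp g 2 ν) : Integrable (fun x => f x * g x) ν :=
  hf.integrable_mul hg

/-- Convergence in `L²(ν)` of a sequence of square integrable functions. -/
structure L2Tendsto {α : Type*} [MeasurableSpace α] (ν : Measure α) (f : ℕ → α → ℝ) (g : α → ℝ) :
    Prop where
  mem : ∀ n, MemLp (f n) 2 ν
  mem_lim : MemLp g 2 ν
  tendsto : Tendsto (fun n => eLpNorm (fun x => f n x - g x) 2 ν) atTop (𝓝 0)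

namespace L2Tendsto

variable {α : Type*} [MeasurableSpace α] {ν : Measure α} {f f' : ℕ → α → ℝ} {g g' : α → ℝ}

theorem const {g : α → ℝ} (hg : MemLp g 2 ν) : L2Tendsto ν (fun _ => g) g :=
  ⟨fun _ => hg, hg, by simp⟩

theorem add (h : L2Tendsto ν f g) (h' : L2Tendsto ν f' g') :
    L2Tendsto ν (fun n x => f n x + f' n x) (fun x => g x + g' x) := by
  refine ⟨fun n => (h.mem n).add (h'.mem n), h.mem_lim.add h'.mem_lim, ?_⟩
  have h3 := h.tendsto.add h'.tendsto
  rw [add_zero] at h3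
  refine tendsto_of_tendsto_of_tendsto_of_le_of_le tendsto_const_nhds h3 (fun _ => zero_le)
    fun n => ?_
  have h4 : (fun x => f n x + f' n x - (g x + g' x)) =
      (fun x => f n x - g x) + fun x => f' n x - g' x := by
    funext x
    simp only [Pi.add_apply]
    ring
  simp only [h4]
  exact eLpNorm_add_le ((h.mem n).sub h.mem_lim).1 ((h'.mem n).sub h'.mem_lim).1 (by norm_num)

theorem mul_left {b : α → ℝ} (hb : AEStronglyMeasurable b ν) {C : ℝ} (hC : ∀ᵐ x ∂ν, |b x| ≤ C)
    (h : L2Tendsto ν f g) : L2Tendsto ν (fun n x => b x * f n x) (fun x => b x * g x) := by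
  have hC' : ∀ᵐ x ∂ν, ‖b x‖ ≤ C := hC
  have hm : ∀ {u : α → ℝ}, MemLp u 2 ν → MemLp (fun x => b x * u x) 2 ν := by
    intro u hu
    refine MemLp.of_le_mul hu (hb.mul hu.1) ?_ (c := C)
    filter_upwards [hC'] with x hx
    rw [norm_mul]
    exact mul_le_mul_of_nonneg_right hx (norm_nonneg _)
  refine ⟨fun n => hm (h.mem n), hm h.mem_lim, ?_⟩
  have h3 := ENNReal.Tendsto.const_mul (a := ENNReal.ofReal C) h.tendsto
    (Or.inr ENNReal.ofReal_ne_top)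
  rw [mul_zero] at h3
  refine tendsto_of_tendsto_of_tendsto_of_le_of_le tendsto_const_nhds h3 (fun _ => zero_le)
    fun n => ?_
  refine eLpNorm_le_mul_eLpNorm_of_ae_le_mul ?_ 2
  filter_upwards [hC] with x hx
  rw [← mul_sub, norm_mul]
  exact mul_le_mul_of_nonneg_right hx (norm_nonneg _)

theorem const_mul (c : ℝ) (h : L2Tendsto ν f g) :
    L2Tendsto ν (fun n x => c * f n x) (fun x => c * g x) :=
  mul_left (b := fun _ => c) aestronglyMeasurable_const (Eventually.of_forall fun _ => le_rfl) h

theorem sum {ι : Type*} {t : Finset ι} {f : ι → ℕ → α → ℝ} {g : ι → α → ℝ}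
    (h : ∀ i ∈ t, L2Tendsto ν (f i) (g i)) :
    L2Tendsto ν (fun n x => ∑ i ∈ t, f i n x) (fun x => ∑ i ∈ t, g i x) := by
  classical
  induction t using Finset.induction_on with
  | empty => simpa using const (ν := ν) (g := fun _ => (0 : ℝ)) MemLp.zero
  | insert a t ha ih =>
    simp only [Finset.sum_insert ha]
    exact (h a (Finset.mem_insert_self a t)).add
      (ih fun i hi => h i (Finset.mem_insert_of_mem hi))

theorem integral_mul (h : L2Tendsto ν f g) (h' : L2Tendsto ν f' g') :
    Tendsto (fun n => ∫ x, f n x * f' n x ∂ν) atTop (𝓝 (∫ x, g x * g' x ∂ν)) := by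
  have h1 := (Lp.tendsto_Lp_iff_tendsto_eLpNorm'' f h.mem g h.mem_lim).2 h.tendsto
  have h2 := (Lp.tendsto_Lp_iff_tendsto_eLpNorm'' f' h'.mem g' h'.mem_lim).2 h'.tendsto
  have key : ∀ {a b : α → ℝ} (ha : MemLp a 2 ν) (hb : MemLp b 2 ν),
      inner ℝ (ha.toLp a) (hb.toLp b) = ∫ x, a x * b x ∂ν := by
    intro a b ha hb
    rw [L2.inner_def]
    refine integral_congr_ae ?_
    filter_upwards [ha.coeFn_toLp, hb.coeFn_toLp] with x hx hx'
    rw [hx, hx', real_inner_eq_re_inner, RCLike.inner_apply]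
    simp [mul_comm]
  have h3 := h1.inner h2 (𝕜 := ℝ)
  simpa only [key] using h3

theorem integral_mul_const {b : α → ℝ} (h : L2Tendsto ν f g) (hb : MemLp b 2 ν) :
    Tendsto (fun n => ∫ x, f n x * b x ∂ν) atTop (𝓝 (∫ x, g x * b x ∂ν)) :=
  h.integral_mul (const hb)

theorem integral_sum_mul {ι : Type*} {t : Finset ι} {f : ι → ℕ → α → ℝ} {g b : ι → α → ℝ}
    (h : ∀ i ∈ t, L2Tendsto ν (f i) (g i)) (hb : ∀ i ∈ t, MemLp (b i) 2 ν) :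
    Tendsto (fun n => ∫ x, ∑ i ∈ t, f i n x * b i x ∂ν) atTop
      (𝓝 (∫ x, ∑ i ∈ t, g i x * b i x ∂ν)) := by
  rw [integral_finsetSum _ fun i hi => integrable_mul_of_memLp (h i hi).mem_lim (hb i hi)]
  simp only [fun n => integral_finsetSum t (μ := ν) (f := fun i x => f i n x * b i x)
    fun i hi => integrable_mul_of_memLp ((h i hi).mem n) (hb i hi)]
  exact tendsto_finsetSum _ fun i hi => (h i hi).integral_mul_const (hb i hi)

end L2Tendsto

namespace PolygonalDomain

variable {S : PolygonalDomain}

theorem ConvH1.l2Tendsto {φ : ℕ → Plane → ℝ} {u : H1Fun S} (h : ConvH1 φ u)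
    (hφ : ∀ k, ContDiff ℝ ∞ (φ k)) : L2Tendsto S.μ φ u.val :=
  ⟨fun k => memLp_of_continuousOn (continuousOn_smooth (hφ k)), u.val_mem, h.1⟩

theorem ConvH1.l2Tendsto_pd {φ : ℕ → Plane → ℝ} {u : H1Fun S} (h : ConvH1 φ u)
    (hφ : ∀ k, ContDiff ℝ ∞ (φ k)) (j : Fin 2) :
    L2Tendsto S.μ (fun n => pd j (φ n)) (u.grad j) :=
  ⟨fun k => memLp_of_continuousOn (continuousOn_smooth (contDiff_pd (hφ k) j)), u.grad_mem j,
    h.2 j⟩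

/-- Lebesgue measure on the parameter interval of the edges. -/
abbrev unitMeasure : Measure ℝ := volume.restrict (Set.Icc (0 : ℝ) 1)

theorem l2Tendsto_trace {u : H1Fun S} {i : Fin S.numEdges} {g : ℝ → ℝ}
    (h : HasTrace u i g) {φ : ℕ → Plane → ℝ} (hφ : ∀ k, ContDiff ℝ ∞ (φ k)) (hφu : ConvH1 φ u) :
    L2Tendsto unitMeasure (fun k s => φ k (S.edgePt i s)) g :=
  ⟨fun k => memLp_Icc_of_continuousOn (continuousOn_comp_edgePt (continuousOn_smooth (hφ k)) i),
    h.1, h.tendsto hφ hφu⟩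

theorem l2Tendsto_normalTrace {w : H2Fun S} {i : Fin S.numEdges} {g : ℝ → ℝ}
    (h : HasNormalTrace w i g) {φ : ℕ → Plane → ℝ} (hφ : ∀ k, ContDiff ℝ ∞ (φ k))
    (hφw : ∀ j, ConvH1 (fun k => pd j (φ k)) (w.partialH1 j)) :
    L2Tendsto unitMeasure (fun k s => S.dn i (φ k) (S.edgePt i s)) g := by
  obtain ⟨d, hd, rfl⟩ := h
  exact L2Tendsto.sum fun j _ =>
    (l2Tendsto_trace (hd j) (fun k => contDiff_pd (hφ k) j) (hφw j)).const_mul _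

/-- If the trace of an `H²` function on an edge vanishes, then approximating smooth functions tend
to zero at both end points: along the edge they tend to zero in `H¹(0, 1)`. -/
theorem tendsto_vert_of_hasTrace_zero {w : H2Fun S} {i : Fin S.numEdges} {g : ℝ → ℝ}
    (h : HasTrace w.toH1Fun i 0) (hn : HasNormalTrace w i g) {φ : ℕ → Plane → ℝ}
    (hφ : ∀ k, ContDiff ℝ ∞ (φ k)) (hφw : ConvH1 φ w.toH1Fun)
    (hφd : ∀ j, ConvH1 (fun k => pd j (φ k)) (w.partialH1 j)) :
    Tendsto (fun k => φ k (S.vert i)) atTop (𝓝 0) ∧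
      Tendsto (fun k => φ k (S.vert (S.next i))) atTop (𝓝 0) := by
  obtain ⟨d, hd, -⟩ := hn
  let p : ℕ → ℝ → ℝ := fun k s => φ k (S.edgePt i s)
  let q : ℕ → ℝ → ℝ := fun k s => S.len i * ∑ j, S.tangent i j * pd j (φ k) (S.edgePt i s)
  have hp : L2Tendsto unitMeasure p 0 := l2Tendsto_trace h hφ hφw
  have hq : L2Tendsto unitMeasure q (fun s => S.len i * ∑ j, S.tangent i j * d j s) :=
    (L2Tendsto.sum fun j _ => (l2Tendsto_trace (hd j) (fun k => contDiff_pd (hφ k) j)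
      (hφd j)).const_mul _).const_mul _
  have hder : ∀ k s, HasDerivAt (p k) (q k s) s := fun k s => hasDerivAt_comp_edgePt (hφ k) i s
  have hpc : ∀ k, Continuous (p k) := fun k => (hφ k).continuous.comp (S.continuous_edgePt i)
  have hqc : ∀ k, Continuous (q k) := fun k => continuous_const.mul (continuous_finsetSum _
    fun j _ => continuous_const.mul ((contDiff_pd (hφ k) j).continuous.comp
      (S.continuous_edgePt i)))
  -- `(s - a) p²` is differentiated, with `a` the other end point
  have key : ∀ a ∈ Set.Icc (0 : ℝ) 1, Tendsto (fun k => (1 - a) * p k 1 ^ 2 + a * p k 0 ^ 2)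
      atTop (𝓝 0) := by
    intro a ha
    have h1 : ∀ k, (1 - a) * p k 1 ^ 2 + a * p k 0 ^ 2 =
        (∫ s, p k s * p k s ∂unitMeasure) + 2 * ∫ s, p k s * ((s - a) * q k s) ∂unitMeasure := by
      intro k
      have i1 : IntervalIntegrable (fun s => p k s * p k s) volume 0 1 :=
        ((hpc k).mul (hpc k)).intervalIntegrable _ _
      have i2 : IntervalIntegrable (fun s => 2 * (p k s * ((s - a) * q k s))) volume 0 1 :=
        (continuous_const.mul ((hpc k).mul ((continuous_id.sub continuous_const).mul
          (hqc k)))).intervalIntegrable _ _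
      rw [setIntegral_Icc_eq, setIntegral_Icc_eq, ← intervalIntegral.integral_const_mul,
        ← intervalIntegral.integral_add i1 i2]
      rw [intervalIntegral.integral_eq_sub_of_hasDerivAt (f := fun s => (s - a) * (p k s * p k s))
        (fun s _ => ?_) (i1.add i2)]
      · ring
      · refine (((hasDerivAt_id s).sub_const a).mul ((hder k s).mul (hder k s))).congr_deriv ?_
        simp only [id, Pi.mul_apply]
        ring
    simp only [h1]
    have h2 := hp.integral_mul hp
    have h3 := hp.integral_mul (hq.mul_left (b := fun s => s - a) (C := 1)
      (continuous_id.sub continuous_const).aestronglyMeasurable (by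
        filter_upwards [ae_restrict_mem measurableSet_Icc] with s hs
        rw [abs_le]
        constructor <;> linarith [hs.1, hs.2, ha.1, ha.2]))
    simpa using h2.add (h3.const_mul 2)
  have hsq : ∀ {x : ℕ → ℝ}, Tendsto (fun k => x k ^ 2) atTop (𝓝 0) → Tendsto x atTop (𝓝 0) := by
    intro x hx
    have := hx.sqrt
    simp only [Real.sqrt_sq_eq_abs, Real.sqrt_zero] at this
    exact (tendsto_zero_iff_abs_tendsto_zero x).2 this
  have h0 := hsq (x := fun k => p k 0) (by simpa using key 1 ⟨zero_le_one, le_rfl⟩)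
  have h1 := hsq (x := fun k => p k 1) (by simpa using key 0 ⟨le_rfl, zero_le_one⟩)
  exact ⟨by simpa [p] using h0, by simpa [p] using h1⟩

/-! ### Green's formulas for Sobolev displacements -/

variable (S) in
/-- The work of the boundary forces of `Φ` on the edge `i` for the boundary displacements `v`, `w`
and the normal slope `d`. -/
def edgeWork (Φ : PlateStress) (i : Fin S.numEdges) (v : Fin 2 → ℝ → ℝ) (w d : ℝ → ℝ) : ℝ :=
  S.len i * ∫ s in (0 : ℝ)..1, (d s * S.nn Φ.M i (S.edgePt i s) -
    w s * S.shear Φ.M i (S.edgePt i s) - ∑ k, v k s * S.conormal Φ.N i (S.edgePt i s) k)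

theorem edgeWork_congr {Φ : PlateStress} {i : Fin S.numEdges} {v v' : Fin 2 → ℝ → ℝ}
    {w d w' d' : ℝ → ℝ} (hv : ∀ k, v k =ᵐ[unitMeasure] v' k) (hw : w =ᵐ[unitMeasure] w')
    (hd : d =ᵐ[unitMeasure] d') : S.edgeWork Φ i v w d = S.edgeWork Φ i v' w' d' := by
  unfold edgeWork
  rw [← setIntegral_Icc_eq, ← setIntegral_Icc_eq]
  congr 1
  refine integral_congr_ae ?_
  filter_upwards [hv 0, hv 1, hw, hd] with s h0 h1 h2 h3
  rw [Fin.sum_univ_two, Fin.sum_univ_two, h0, h1, h2, h3]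

theorem edgeWork_eq_zero {Φ : PlateStress} {i : Fin S.numEdges}
    (h : ∀ s ∈ Set.Ioo (0 : ℝ) 1, S.conormal Φ.N i (S.edgePt i s) = 0 ∧
      S.shear Φ.M i (S.edgePt i s) = 0 ∧ S.nn Φ.M i (S.edgePt i s) = 0)
    (v : Fin 2 → ℝ → ℝ) (w d : ℝ → ℝ) : S.edgeWork Φ i v w d = 0 := by
  unfold edgeWork
  rw [intervalIntegral.integral_of_le zero_le_one, integral_Ioc_eq_integral_Ioo,
    setIntegral_congr_fun (g := fun _ => (0 : ℝ)) measurableSet_Ioo fun s hs => ?_]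
  · simp
  · simp [h s hs]

theorem tendsto_edgeWork {Φ : PlateStress} (hC : S.StressCs Φ) {i : Fin S.numEdges}
    {v : Fin 2 → ℝ → ℝ} {w d : ℝ → ℝ} {vn : Fin 2 → ℕ → ℝ → ℝ} {wn dn : ℕ → ℝ → ℝ}
    (hv : ∀ k, L2Tendsto unitMeasure (vn k) (v k)) (hw : L2Tendsto unitMeasure wn w)
    (hd : L2Tendsto unitMeasure dn d) :
    Tendsto (fun n => S.edgeWork Φ i (fun k => vn k n) (wn n) (dn n)) atTop
      (𝓝 (S.edgeWork Φ i v w d)) := by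
  unfold edgeWork
  have m1 : MemLp (fun s => S.nn Φ.M i (S.edgePt i s)) 2 unitMeasure := memLp_Icc_of_continuousOn
    (continuousOn_comp_edgePt (continuousOn_nn (fun a b => (hC.2.1 a b).continuousOn) i) i)
  have m2 : MemLp (fun s => S.shear Φ.M i (S.edgePt i s)) 2 unitMeasure :=
    memLp_Icc_of_continuousOn (continuousOn_comp_edgePt (continuousOn_shear hC.2.1 i) i)
  have m3 : ∀ k, MemLp (fun s => S.conormal Φ.N i (S.edgePt i s) k) 2 unitMeasure := fun k =>
    memLp_Icc_of_continuousOn (continuousOn_comp_edgePt (continuousOn_conormal hC.1 i k) i)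
  refine Tendsto.const_mul _ ?_
  simp only [← setIntegral_Icc_eq]
  have key : ∀ {v : Fin 2 → ℝ → ℝ} {w d : ℝ → ℝ}, (∀ k, MemLp (v k) 2 unitMeasure) →
      MemLp w 2 unitMeasure → MemLp d 2 unitMeasure →
      ∫ s, (d s * S.nn Φ.M i (S.edgePt i s) -
        w s * S.shear Φ.M i (S.edgePt i s) - ∑ k, v k s * S.conormal Φ.N i (S.edgePt i s) k)
        ∂unitMeasure =
      ∫ s, d s * S.nn Φ.M i (S.edgePt i s) ∂unitMeasure -
        ∫ s, w s * S.shear Φ.M i (S.edgePt i s) ∂unitMeasure -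
        ∫ s, ∑ k, v k s * S.conormal Φ.N i (S.edgePt i s) k ∂unitMeasure := by
    intro v w d hv hw hd
    rw [← integral_sub (integrable_mul_of_memLp hd m1) (integrable_mul_of_memLp hw m2),
      ← integral_sub]
    · exact (integrable_mul_of_memLp hd m1).sub (integrable_mul_of_memLp hw m2)
    · exact integrable_finsetSum _ fun k _ => integrable_mul_of_memLp (hv k) (m3 k)
  rw [key (fun k => (hv k).mem_lim) hw.mem_lim hd.mem_lim]
  simp only [fun n => key (fun k => (hv k).mem n) (hw.mem n) (hd.mem n)]
  exact ((hd.integral_mul_const m1).sub (hw.integral_mul_const m2)).sub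
    (L2Tendsto.integral_sum_mul (fun k _ => hv k) fun k _ => m3 k)

/-- The boundary terms in Green's formulas are the work on the edges and at the vertices. -/
theorem momentBdry_sub_forceBdry {Φ : PlateStress} (hC : S.StressCs Φ) {v : Fin 2 → Plane → ℝ}
    {φ : Plane → ℝ} (hv : ∀ k, ContDiff ℝ ∞ (v k)) (hφ : ContDiff ℝ ∞ φ) :
    S.momentBdry Φ.M φ - S.forceBdry Φ.N v =
      ∑ i, S.edgeWork Φ i (fun k s => v k (S.edgePt i s)) (fun s => φ (S.edgePt i s))
        (fun s => S.dn i φ (S.edgePt i s)) + ∑ i, φ (S.vert i) * S.jumpNt Φ.M i := by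
  have h : ∀ i, S.edgeWork Φ i (fun k s => v k (S.edgePt i s)) (fun s => φ (S.edgePt i s))
      (fun s => S.dn i φ (S.edgePt i s)) =
      S.len i * (∫ s in (0 : ℝ)..1, (S.dn i φ (S.edgePt i s) * S.nn Φ.M i (S.edgePt i s) -
        φ (S.edgePt i s) * S.shear Φ.M i (S.edgePt i s))) -
      S.len i * ∫ s in (0 : ℝ)..1, ∑ k, v k (S.edgePt i s) *
        S.conormal Φ.N i (S.edgePt i s) k := by
    intro i
    rw [edgeWork, ← mul_sub, ← intervalIntegral.integral_sub]
    · exact intervalIntegrable_comp_edgePt (f := fun x => S.dn i φ x * S.nn Φ.M i x -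
        φ x * S.shear Φ.M i x) (((continuousOn_smooth (contDiff_dn hφ i)).mul
          (continuousOn_nn (fun a b => (hC.2.1 a b).continuousOn) i)).sub
          ((continuousOn_smooth hφ).mul (continuousOn_shear hC.2.1 i))) i
    · exact intervalIntegrable_comp_edgePt (f := fun x => ∑ k, v k x * S.conormal Φ.N i x k)
        (continuousOn_finsetSum _ fun k _ => (continuousOn_smooth (hv k)).mul
          (continuousOn_conormal hC.1 i k)) i
  simp only [h, momentBdry, forceBdry, Finset.sum_sub_distrib]
  ring

/-- At a vertex with straight angle `M n · t` does not jump. -/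
theorem jumpNt_eq_zero_of_tangent_eq {M : Plane → Mat} {i : Fin S.numEdges}
    (h : S.tangent (S.prev i) = S.tangent i) : S.jumpNt M i = 0 := by
  have hn : S.normal (S.prev i) = S.normal i := by
    ext k
    fin_cases k
    · simp [normal_zero, h]
    · simp [normal_one, h]
  simp only [jumpNt, nt, conormal, h, hn, sub_self]

/-- `G` consists of the divergences `Div N` and `div Div M` of `Φ`. -/
def IsDivergence (Φ : PlateStress) (G : PlateL2 S) : Prop :=
  (∀ i, S.IsWeakDiv (fun j x => Φ.N x i j) (G.f i)) ∧ ∀ φ, S.IsTest φ →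
    ∫ x, ∑ i, ∑ j, Φ.M x i j * pd i (pd j φ) x ∂S.μ = ∫ x, G.f₃ x * φ x ∂S.μ

/-- The domain terms in Green's formulas are continuous in `H¹ × H²`. -/
theorem tendsto_pairing {Φ : PlateStress} (hC : S.StressCs Φ) (G : PlateL2 S) {ψ : PlateDisp S}
    {vn : Fin 2 → ℕ → Plane → ℝ} {φ : ℕ → Plane → ℝ} (hvs : ∀ k n, ContDiff ℝ ∞ (vn k n))
    (hφs : ∀ n, ContDiff ℝ ∞ (φ n)) (hvc : ∀ k, ConvH1 (vn k) (ψ.v k))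
    (hφc : ConvH1 φ ψ.w.toH1Fun)
    (hφd : ∀ j, ConvH1 (fun n => pd j (φ n)) (ψ.w.partialH1 j)) :
    Tendsto (fun n => -∫ x, ∑ i, ∑ j, (pd j (vn i n) x + pd i (vn j n) x) / 2 *
      Φ.N x i j ∂S.μ + ∫ x, ∑ i, ∑ j, pd j (pd i (φ n)) x * Φ.M x i j ∂S.μ -
      (∫ x, ∑ i, G.f i x * vn i n x ∂S.μ + ∫ x, G.f₃ x * φ n x ∂S.μ)) atTop
      (𝓝 (S.pairB ψ Φ - S.pairV G ψ)) := by
  have mN : ∀ i j, MemLp (fun x => Φ.N x i j) 2 S.μ := fun i j => memLp_of_continuousOn (hC.1 i j)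
  have mM : ∀ i j, MemLp (fun x => Φ.M x i j) 2 S.μ := fun i j =>
    memLp_of_continuousOn (hC.2.1 i j).continuousOn
  have t1 : Tendsto (fun n => ∫ x, ∑ i, ∑ j, (pd j (vn i n) x + pd i (vn j n) x) / 2 *
      Φ.N x i j ∂S.μ) atTop (𝓝 (∫ x, ∑ i, ∑ j, symGrad ψ.v x i j * Φ.N x i j ∂S.μ)) := by
    have hL : ∀ z : Fin 2 × Fin 2, L2Tendsto S.μ
        (fun n x => (pd z.2 (vn z.1 n) x + pd z.1 (vn z.2 n) x) / 2)
        (fun x => symGrad ψ.v x z.1 z.2) := by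
      intro z
      have := ((ConvH1.l2Tendsto_pd (hvc z.1) (hvs z.1) z.2).add
        (ConvH1.l2Tendsto_pd (hvc z.2) (hvs z.2) z.1)).const_mul 2⁻¹
      simpa only [inv_mul_eq_div, symGrad] using this
    have := L2Tendsto.integral_sum_mul (t := Finset.univ) (b := fun z x => Φ.N x z.1 z.2)
      (fun z _ => hL z) fun z _ => mN z.1 z.2
    simpa only [Fintype.sum_prod_type] using this
  have t2 : Tendsto (fun n => ∫ x, ∑ i, ∑ j, pd j (pd i (φ n)) x * Φ.M x i j ∂S.μ) atTop
      (𝓝 (∫ x, ∑ i, ∑ j, ψ.w.hess i j x * Φ.M x i j ∂S.μ)) := by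
    have hL : ∀ z : Fin 2 × Fin 2, L2Tendsto S.μ (fun n => pd z.2 (pd z.1 (φ n)))
        (ψ.w.hess z.1 z.2) := fun z =>
      ConvH1.l2Tendsto_pd (hφd z.1) (fun n => contDiff_pd (hφs n) z.1) z.2
    have := L2Tendsto.integral_sum_mul (t := Finset.univ) (b := fun z x => Φ.M x z.1 z.2)
      (fun z _ => hL z) fun z _ => mM z.1 z.2
    simpa only [Fintype.sum_prod_type] using this
  have t3 := L2Tendsto.integral_sum_mul (t := Finset.univ)
    (fun i _ => ConvH1.l2Tendsto (hvc i) (hvs i)) fun i _ => G.f_mem i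
  have t4 := (ConvH1.l2Tendsto hφc hφs).integral_mul_const G.f₃_mem
  simp only [mul_comm _ (G.f _ _)] at t3
  simp only [mul_comm _ (G.f₃ _)] at t4
  exact (t1.neg.add t2).sub (t3.add t4)

/-- Green's formulas for one plate whose free edges are stress free: only the junction `γ`
contributes. The traces of the displacement on `γ` are `v`, `w` and `d`. -/
theorem pairB_sub_pairV {Φ : PlateStress} (hC : S.StressCs Φ) {G : PlateL2 S}
    (hG : IsDivergence Φ G) {C : Set (Fin S.numEdges)} {γ : Fin S.numEdges}
    (hfree : S.FreeBoundary {i | i ∉ C ∧ i ≠ γ} Φ) (hj : S.jumpNt Φ.M γ = 0)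
    (hj' : S.jumpNt Φ.M (S.next γ) = 0) {ψ : PlateDisp S} (hψ : ∀ i ∈ C, S.ClampedOn ψ i)
    {v : Fin 2 → ℝ → ℝ} {w d : ℝ → ℝ} (hγ : γ ∉ C) (hv : ∀ k, HasTrace (ψ.v k) γ (v k))
    (hw : HasTrace ψ.w.toH1Fun γ w) (hd : HasNormalTrace ψ.w γ d) :
    S.pairB ψ Φ - S.pairV G ψ = S.edgeWork Φ γ v w d := by
  obtain ⟨A, hA1, hA2⟩ := exists_smoothing S
  let vn : Fin 2 → ℕ → Plane → ℝ := fun k n => A n (ψ.v k).val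
  let φ : ℕ → Plane → ℝ := fun n => A n ψ.w.val
  have hvs : ∀ k n, ContDiff ℝ ∞ (vn k n) := fun k n => (hA1 (ψ.v k)).1 n
  have hφs : ∀ n, ContDiff ℝ ∞ (φ n) := fun n => (hA1 ψ.w.toH1Fun).1 n
  have hvc : ∀ k, ConvH1 (vn k) (ψ.v k) := fun k => (hA1 (ψ.v k)).2
  have hφc : ConvH1 φ ψ.w.toH1Fun := (hA1 ψ.w.toH1Fun).2
  have hφd : ∀ j, ConvH1 (fun n => pd j (φ n)) (ψ.w.partialH1 j) := fun j => hA2 ψ.w j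
  -- Green's formulas for the approximating functions
  have hgreen : ∀ n, -∫ x, ∑ i, ∑ j, (pd j (vn i n) x + pd i (vn j n) x) / 2 * Φ.N x i j ∂S.μ +
      ∫ x, ∑ i, ∑ j, pd j (pd i (φ n)) x * Φ.M x i j ∂S.μ -
      (∫ x, ∑ i, G.f i x * vn i n x ∂S.μ + ∫ x, G.f₃ x * φ n x ∂S.μ) =
      ∑ i, S.edgeWork Φ i (fun k s => vn k n (S.edgePt i s)) (fun s => φ n (S.edgePt i s))
        (fun s => S.dn i (φ n) (S.edgePt i s)) + ∑ i, φ n (S.vert i) * S.jumpNt Φ.M i := by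
    intro n
    rw [green_force (v := fun k => vn k n) hC.1 (fun x hx => (hC.2.2 x hx).1)
      (fun i => (G.f_mem i).integrable)
      hG.1 (fun k => hvs k n), green_moment hC.2.1 G.f₃_mem.integrable hG.2 (hφs n),
      ← momentBdry_sub_forceBdry hC (v := fun k => vn k n) (fun k => hvs k n) (hφs n)]
    ring
  have hlim1 : Tendsto (fun n => -∫ x, ∑ i, ∑ j, (pd j (vn i n) x + pd i (vn j n) x) / 2 *
      Φ.N x i j ∂S.μ + ∫ x, ∑ i, ∑ j, pd j (pd i (φ n)) x * Φ.M x i j ∂S.μ -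
      (∫ x, ∑ i, G.f i x * vn i n x ∂S.μ + ∫ x, G.f₃ x * φ n x ∂S.μ)) atTop
      (𝓝 (S.pairB ψ Φ - S.pairV G ψ)) := by
    exact tendsto_pairing hC G hvs hφs hvc hφc hφd
  have hlim2 : Tendsto (fun n => ∑ i, S.edgeWork Φ i (fun k s => vn k n (S.edgePt i s))
      (fun s => φ n (S.edgePt i s)) (fun s => S.dn i (φ n) (S.edgePt i s)) +
      ∑ i, φ n (S.vert i) * S.jumpNt Φ.M i) atTop (𝓝 (S.edgeWork Φ γ v w d)) := by
    have t1 : ∀ i, Tendsto (fun n => S.edgeWork Φ i (fun k s => vn k n (S.edgePt i s))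
        (fun s => φ n (S.edgePt i s)) (fun s => S.dn i (φ n) (S.edgePt i s))) atTop
        (𝓝 (if i = γ then S.edgeWork Φ γ v w d else 0)) := by
      intro i
      by_cases hi : i = γ
      · subst hi
        rw [if_pos rfl]
        exact tendsto_edgeWork hC (vn := fun k n s => vn k n (S.edgePt i s))
          (fun k => l2Tendsto_trace (hv k) (hvs k) (hvc k))
          (l2Tendsto_trace hw hφs hφc) (l2Tendsto_normalTrace hd hφs hφd)
      rw [if_neg hi]
      by_cases hic : i ∈ C
      · obtain ⟨c1, c2, g, c3, c4⟩ := hψ i hic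
        have h0 : S.edgeWork Φ i (fun _ => 0) 0 g = 0 := by
          rw [edgeWork_congr (v' := fun _ => 0) (w' := 0) (d' := 0) (fun _ => EventuallyEq.rfl)
            EventuallyEq.rfl c4]
          simp [edgeWork]
        rw [← h0]
        exact tendsto_edgeWork hC (vn := fun k n s => vn k n (S.edgePt i s))
          (fun k => l2Tendsto_trace (c1 k) (hvs k) (hvc k))
          (l2Tendsto_trace c2 hφs hφc) (l2Tendsto_normalTrace c3 hφs hφd)
      · simp only [edgeWork_eq_zero (hfree.1 i ⟨hic, hi⟩)]
        exact tendsto_const_nhds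
    have t2 : ∀ i, Tendsto (fun n => φ n (S.vert i) * S.jumpNt Φ.M i) atTop (𝓝 0) := by
      intro i
      -- a vertex force vanishes, or is at the end point of a clamped edge
      have hcl : ∀ j ∈ C, Tendsto (fun n => φ n (S.vert j)) atTop (𝓝 0) ∧
          Tendsto (fun n => φ n (S.vert (S.next j))) atTop (𝓝 0) := by
        intro j hjc
        obtain ⟨-, c2, g, c3, -⟩ := hψ j hjc
        exact tendsto_vert_of_hasTrace_zero c2 c3 hφs hφc hφd
      by_cases h1 : i ∈ C
      · simpa using (hcl i h1).1.mul_const (S.jumpNt Φ.M i)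
      by_cases h2 : S.prev i ∈ C
      · have := (hcl _ h2).2
        rw [S.next_prev] at this
        simpa using this.mul_const (S.jumpNt Φ.M i)
      have h3 : S.jumpNt Φ.M i = 0 := by
        by_cases h4 : i = γ
        · rw [h4, hj]
        by_cases h5 : S.prev i = γ
        · rw [← S.next_prev i, h5, hj']
        by_cases h6 : S.tangent (S.prev i) = S.tangent i
        · exact jumpNt_eq_zero_of_tangent_eq h6
        · exact hfree.2 i ⟨h1, h4⟩ ⟨h2, h5⟩ h6
      simp [h3]
    have h := (tendsto_finsetSum Finset.univ fun i _ => t1 i).add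
      (tendsto_finsetSum Finset.univ fun i _ => t2 i)
    simpa using h
  simp only [hgreen] at hlim1
  exact tendsto_nhds_unique hlim1 hlim2

end PolygonalDomain

namespace PolygonalDomain

variable {S : PolygonalDomain}

/-! ### Junction conditions and sufficiency -/

variable (S) in
/-- The density of the work of the boundary forces of `Φ` at the point `x` of the edge `i`, for the
displacements `v`, `w` and the normal slope `d`. -/
def edgeDensity (Φ : PlateStress) (i : Fin S.numEdges) (v : Fin 2 → ℝ) (w d : ℝ) (x : Plane) : ℝ :=
  d * S.nn Φ.M i x - w * S.shear Φ.M i x - ∑ k, v k * S.conormal Φ.N i x k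

theorem edgeWork_eq (Φ : PlateStress) (i : Fin S.numEdges) (v : Fin 2 → ℝ → ℝ) (w d : ℝ → ℝ) :
    S.edgeWork Φ i v w d = S.len i * ∫ s in (0 : ℝ)..1,
      S.edgeDensity Φ i (fun k => v k s) (w s) (d s) (S.edgePt i s) := rfl

/-- The frame of an edge on the second coordinate axis. -/
theorem frame_of_vertical {i : Fin S.numEdges} {ℓ : ℝ} (hℓ : 0 < ℓ) (h0 : S.vert i = !₂[0, -ℓ])
    (h1 : S.vert (S.next i) = !₂[0, ℓ]) :
    S.tangent i 0 = 0 ∧ S.tangent i 1 = 1 ∧ S.len i = 2 * ℓ := by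
  have h := S.len_smul_tangent i
  rw [h0, h1] at h
  have h2 := congrFun (congrArg WithLp.ofLp h) 0
  have h3 := congrFun (congrArg WithLp.ofLp h) 1
  simp at h2 h3
  have hl := S.len_pos i
  have h4 : S.tangent i 0 = 0 := h2.resolve_left hl.ne'
  have h5 := S.tangent_sq i
  have h6 : S.tangent i 1 = 1 := by
    rw [h4] at h5
    have h7 : (S.tangent i 1 - 1) * (S.tangent i 1 + 1) = 0 := by linarith
    rcases mul_eq_zero.1 h7 with h8 | h8
    · linarith
    · have : S.tangent i 1 = -1 := by linarith
      rw [this] at h3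
      linarith
  rw [h6] at h3
  exact ⟨h4, h6, by linarith⟩

end PolygonalDomain

namespace CoupledPlates

variable (P : CoupledPlates)

/-- The kinematic conditions at a point of the junction. -/
def Kinematic (v : Fin 2 → ℝ) (w d : ℝ) (v' : Fin 2 → ℝ) (w' d' : ℝ) : Prop :=
  d = -d' ∧ v 0 = v' 0 * Real.cos P.θ - w' * Real.sin P.θ ∧ v 1 = -v' 1 ∧
    w = -(v' 0) * Real.sin P.θ - w' * Real.cos P.θ

theorem conormal_junction (A : Plane → Mat) (x : Plane) :
    P.S.conormal A P.Γ x 0 = P.S.nn A P.Γ x ∧ P.S.conormal A P.Γ x 1 = P.S.nt A P.Γ x := by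
  obtain ⟨h0, h1, -⟩ := P.S.frame_of_vertical P.ℓ_pos P.Γ_start P.Γ_end
  simp [PolygonalDomain.nn, PolygonalDomain.nt, Fin.sum_univ_two, P.S.normal_zero,
    P.S.normal_one, h0, h1]

theorem conormal_junction' (A : Plane → Mat) (x : Plane) :
    P.S'.conormal A P.Γ' x 0 = P.S'.nn A P.Γ' x ∧
      P.S'.conormal A P.Γ' x 1 = P.S'.nt A P.Γ' x := by
  obtain ⟨h0, h1, -⟩ := P.S'.frame_of_vertical P.ℓ_pos P.Γ'_start P.Γ'_end
  simp [PolygonalDomain.nn, PolygonalDomain.nt, Fin.sum_univ_two, P.S'.normal_zero,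
    P.S'.normal_one, h0, h1]

theorem len_junction : P.S.len P.Γ = P.S'.len P.Γ' := by
  rw [(P.S.frame_of_vertical P.ℓ_pos P.Γ_start P.Γ_end).2.2,
    (P.S'.frame_of_vertical P.ℓ_pos P.Γ'_start P.Γ'_end).2.2]

/-- The junction conditions at a point say that the boundary forces of the two plates do no work
for kinematically compatible displacements. -/
theorem junction_iff (Φ : PlateStress × PlateStress) (x x' : Plane) :
    (P.S'.nn Φ.2.M P.Γ' x' = P.S.nn Φ.1.M P.Γ x ∧
    P.S'.nn Φ.2.N P.Γ' x' =
      -(P.S.nn Φ.1.N P.Γ x) * Real.cos P.θ + P.S.shear Φ.1.M P.Γ x * Real.sin P.θ ∧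
    P.S'.nt Φ.2.N P.Γ' x' = P.S.nt Φ.1.N P.Γ x ∧
    P.S'.shear Φ.2.M P.Γ' x' =
      P.S.nn Φ.1.N P.Γ x * Real.sin P.θ + P.S.shear Φ.1.M P.Γ x * Real.cos P.θ) ↔
    ∀ v w d v' w' d', P.Kinematic v w d v' w' d' →
      P.S.edgeDensity Φ.1 P.Γ v w d x + P.S'.edgeDensity Φ.2 P.Γ' v' w' d' x' = 0 := by
  obtain ⟨hn, ht⟩ := P.conormal_junction Φ.1.N x
  obtain ⟨hn', ht'⟩ := P.conormal_junction' Φ.2.N x'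
  simp only [PolygonalDomain.edgeDensity, Fin.sum_univ_two, hn, ht, hn', ht']
  constructor
  · rintro ⟨h1, h2, h3, h4⟩ v w d v' w' d' ⟨k1, k2, k3, k4⟩
    rw [h1, h2, h3, h4, k1, k2, k3, k4]
    ring
  · intro h
    -- the displacements of the second plate are `v₁' = 1`, `v₂' = 1`, `w' = 1`, `∂ₙ'w' = 1` in turn
    have e1 := h ![Real.cos P.θ, 0] (-Real.sin P.θ) 0 ![1, 0] 0 0 (by simp [Kinematic])
    have e2 := h ![0, -1] 0 0 ![0, 1] 0 0 (by simp [Kinematic])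
    have e3 := h ![-Real.sin P.θ, 0] (-Real.cos P.θ) 0 ![0, 0] 1 0 (by simp [Kinematic])
    have e4 := h ![0, 0] 0 (-1) ![0, 0] 0 1 (by simp [Kinematic])
    simp at e1 e2 e3 e4
    refine ⟨by linarith, by linarith, by linarith, by linarith⟩

/-- The parameter `s` on the junction in the first plate is `1 - s` in the second one. -/
theorem edgeWork_junction {Φ : PlateStress × PlateStress} (hj : P.JunctionConditions Φ)
    {v v' : Fin 2 → ℝ → ℝ} {w d w' d' : ℝ → ℝ}
    (hk : ∀ᵐ s ∂volume.restrict (Set.Icc (0 : ℝ) 1), P.Kinematic (fun k => v k s) (w s) (d s)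
      (fun k => v' k (1 - s)) (w' (1 - s)) (d' (1 - s))) :
    P.S.edgeWork Φ.1 P.Γ v w d + P.S'.edgeWork Φ.2 P.Γ' v' w' d' = 0 := by
  rw [PolygonalDomain.edgeWork_eq, PolygonalDomain.edgeWork_eq, ← P.len_junction, ← mul_add]
  have h1 := intervalIntegral.integral_comp_sub_left (a := 0) (b := 1) (fun s =>
    P.S'.edgeDensity Φ.2 P.Γ' (fun k => v' k s) (w' s) (d' s) (P.S'.edgePt P.Γ' s)) 1
  rw [sub_self, sub_zero] at h1
  rw [← h1]
  have h2 : (∫ s in (0 : ℝ)..1, P.S.edgeDensity Φ.1 P.Γ (fun k => v k s) (w s) (d s)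
      (P.S.edgePt P.Γ s)) = ∫ s in (0 : ℝ)..1, -P.S'.edgeDensity Φ.2 P.Γ' (fun k => v' k (1 - s))
        (w' (1 - s)) (d' (1 - s)) (P.S'.edgePt P.Γ' (1 - s)) := by
    rw [intervalIntegral.integral_of_le zero_le_one, intervalIntegral.integral_of_le zero_le_one,
      integral_Ioc_eq_integral_Ioo, integral_Ioc_eq_integral_Ioo]
    refine integral_congr_ae ?_
    filter_upwards [ae_restrict_of_ae_restrict_of_subset Set.Ioo_subset_Icc_self hk,
      ae_restrict_mem measurableSet_Ioo] with s hs hs'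
    exact eq_neg_of_add_eq_zero_left ((P.junction_iff Φ _ _).1 (hj s hs') _ _ _ _ _ _ hs)
  rw [h2, intervalIntegral.integral_neg, neg_add_cancel, mul_zero]

theorem sin_ne_zero : Real.sin P.θ ≠ 0 := (Real.sin_pos_of_pos_of_lt_pi P.θ_pos P.θ_lt_pi).ne'

/-- The conditions are sufficient: by Green's formulas all boundary terms vanish. -/
theorem memSigma_of_conditions {Φ : PlateStress × PlateStress} (hC : P.MemCs Φ)
    (hs : P.MemHs Φ) (hf : P.FreeBoundaryConditions Φ) (hj : P.JunctionConditions Φ)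
    (hc : P.CornerConditions Φ) : P.MemSigma Φ := by
  obtain ⟨⟨hL, ⟨g, hg, hgd⟩, g₃, hg₃, hgd₃⟩, hL', ⟨g', hg', hgd'⟩, g₃', hg₃', hgd₃'⟩ := hs
  refine ⟨⟨hL, hL'⟩, ⟨⟨g, g₃, hg, hg₃⟩, ⟨g', g₃', hg', hg₃'⟩⟩, fun ψ hψ => ?_⟩
  obtain ⟨hcl, v, w, d, v', w', d', t1, t2, t3, t1', t2', t3', hk⟩ := hψ
  obtain ⟨⟨c1, c2⟩, c3, c4⟩ := hc
  have j1 := (mul_eq_zero.1 c1).resolve_right P.sin_ne_zero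
  have j2 := (mul_eq_zero.1 c3).resolve_right P.sin_ne_zero
  rw [j1, zero_mul, sub_zero] at c2
  rw [j2, zero_mul, sub_zero] at c4
  have e1 := PolygonalDomain.pairB_sub_pairV hC.1 (G := ⟨g, g₃, hg, hg₃⟩) ⟨hgd, hgd₃⟩ hf.1 j1 j2
    hcl P.Γ_not_clamped t1 t2 t3
  have hf' : P.S'.FreeBoundary {i | i ∉ (∅ : Set (Fin P.S'.numEdges)) ∧ i ≠ P.Γ'} Φ.2 := by
    have h : {i | i ∉ (∅ : Set (Fin P.S'.numEdges)) ∧ i ≠ P.Γ'} = P.free' := by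
      ext i
      simp [free']
    rw [h]
    exact hf.2
  have e2 := PolygonalDomain.pairB_sub_pairV hC.2 (G := ⟨g', g₃', hg', hg₃'⟩) ⟨hgd', hgd₃'⟩ hf'
    c4 c2 (fun i hi => absurd hi (Set.notMem_empty i)) (Set.notMem_empty _) t1' t2' t3'
  have e3 := P.edgeWork_junction hj hk
  linarith

end CoupledPlates

/-! ### Smooth admissible displacements -/

/-- A smooth function as an element of `H¹`. -/
def smoothH1 (S : PolygonalDomain) {φ : Plane → ℝ} (hφ : ContDiff ℝ ∞ φ) : H1Fun S where
  val := φ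
  grad j := pd j φ
  val_mem := PolygonalDomain.memLp_of_continuousOn (PolygonalDomain.continuousOn_smooth hφ)
  grad_mem j := PolygonalDomain.memLp_of_continuousOn
    (PolygonalDomain.continuousOn_smooth (contDiff_pd hφ j))
  weak j _ hη := PolygonalDomain.integral_mul_pd_of_contDiffOn
    (hφ.of_le (by exact_mod_cast le_top)).contDiffOn hη j

/-- A smooth function as an element of `H²`. -/
def smoothH2 (S : PolygonalDomain) {φ : Plane → ℝ} (hφ : ContDiff ℝ ∞ φ) : H2Fun S where
  toH1Fun := smoothH1 S hφ
  hess i j := pd j (pd i φ)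
  hess_mem i j := (smoothH1 S (contDiff_pd hφ i)).grad_mem j
  weak_hess i j := (smoothH1 S (contDiff_pd hφ i)).weak j

/-- A smooth displacement field. -/
def smoothDisp (S : PolygonalDomain) {v : Fin 2 → Plane → ℝ} {φ : Plane → ℝ}
    (hv : ∀ k, ContDiff ℝ ∞ (v k)) (hφ : ContDiff ℝ ∞ φ) : PlateDisp S where
  v k := smoothH1 S (hv k)
  w := smoothH2 S hφ

namespace PolygonalDomain

variable {S : PolygonalDomain}

theorem hasTrace_smooth {φ : Plane → ℝ} (hφ : ContDiff ℝ ∞ φ) (i : Fin S.numEdges) {g : ℝ → ℝ}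
    (hg : ∀ s ∈ Set.Icc (0 : ℝ) 1, φ (S.edgePt i s) = g s) : HasTrace (smoothH1 S hφ) i g := by
  have h0 : (fun s => φ (S.edgePt i s)) =ᵐ[unitMeasure] g := by
    filter_upwards [ae_restrict_mem measurableSet_Icc] with s hs
    exact hg s hs
  refine ⟨(memLp_congr_ae h0).1 (memLp_Icc_of_continuousOn
    (continuousOn_comp_edgePt (continuousOn_smooth hφ) i)), fun _ => φ, fun _ => hφ, ?_, ?_, ?_⟩
  · simp [smoothH1]
  · simp [smoothH1]
  · have h1 : (fun s => φ (S.edgePt i s) - g s) =ᵐ[unitMeasure] 0 := by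
      filter_upwards [h0] with s hs
      simp [hs]
    have h2 : eLpNorm (fun s => φ (S.edgePt i s) - g s) 2 unitMeasure = 0 := by
      rw [eLpNorm_congr_ae h1]
      simp
    simp only [h2]
    exact tendsto_const_nhds

theorem hasNormalTrace_smooth {φ : Plane → ℝ} (hφ : ContDiff ℝ ∞ φ) (i : Fin S.numEdges) :
    HasNormalTrace (smoothH2 S hφ) i (fun s => S.dn i φ (S.edgePt i s)) :=
  ⟨fun j s => pd j φ (S.edgePt i s),
    fun j => hasTrace_smooth (contDiff_pd hφ j) i fun _ _ => rfl, rfl⟩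

variable (S) in
/-- The smooth displacement `v`, `φ` is clamped on the edge `i`. -/
def SmoothClamped (i : Fin S.numEdges) (v : Fin 2 → Plane → ℝ) (φ : Plane → ℝ) : Prop :=
  ∀ s ∈ Set.Icc (0 : ℝ) 1, (∀ k, v k (S.edgePt i s) = 0) ∧ φ (S.edgePt i s) = 0 ∧
    S.dn i φ (S.edgePt i s) = 0

theorem clampedOn_smooth {v : Fin 2 → Plane → ℝ} {φ : Plane → ℝ}
    (hv : ∀ k, ContDiff ℝ ∞ (v k)) (hφ : ContDiff ℝ ∞ φ) {i : Fin S.numEdges}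
    (h : S.SmoothClamped i v φ) : S.ClampedOn (smoothDisp S hv hφ) i := by
  refine ⟨fun k => hasTrace_smooth (hv k) i fun s hs => (h s hs).1 k,
    hasTrace_smooth hφ i fun s hs => (h s hs).2.1, _, hasNormalTrace_smooth hφ i, ?_⟩
  filter_upwards [ae_restrict_mem measurableSet_Icc] with s hs
  exact (h s hs).2.2

theorem edgeWork_eq_zero_of_smoothClamped {v : Fin 2 → Plane → ℝ} {φ : Plane → ℝ}
    {i : Fin S.numEdges} (h : S.SmoothClamped i v φ) (Φ : PlateStress) :
    S.edgeWork Φ i (fun k s => v k (S.edgePt i s)) (fun s => φ (S.edgePt i s))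
      (fun s => S.dn i φ (S.edgePt i s)) = 0 := by
  have h0 : ∀ᵐ s ∂unitMeasure, s ∈ Set.Icc (0 : ℝ) 1 := ae_restrict_mem measurableSet_Icc
  have h1 : ∀ k, (fun s => v k (S.edgePt i s)) =ᵐ[unitMeasure] 0 := fun k => by
    filter_upwards [h0] with s hs using (h s hs).1 k
  have h2 : (fun s => φ (S.edgePt i s)) =ᵐ[unitMeasure] 0 := by
    filter_upwards [h0] with s hs using (h s hs).2.1
  have h3 : (fun s => S.dn i φ (S.edgePt i s)) =ᵐ[unitMeasure] 0 := by
    filter_upwards [h0] with s hs using (h s hs).2.2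
  rw [edgeWork_congr (v' := fun _ => 0) h1 h2 h3]
  simp [edgeWork]

theorem SmoothClamped.zero (i : Fin S.numEdges) : S.SmoothClamped i (fun _ _ => 0) (fun _ => 0) := by
  intro s _
  simp [dn, pd]

theorem smoothClamped_of_tsupport {v : Fin 2 → Plane → ℝ} {φ : Plane → ℝ} {i : Fin S.numEdges}
    (hv : ∀ k, ∀ s ∈ Set.Icc (0 : ℝ) 1, S.edgePt i s ∉ tsupport (v k))
    (hφ : ∀ s ∈ Set.Icc (0 : ℝ) 1, S.edgePt i s ∉ tsupport φ) : S.SmoothClamped i v φ := by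
  refine fun s hs => ⟨fun k => image_eq_zero_of_notMem_tsupport (hv k s hs),
    image_eq_zero_of_notMem_tsupport (hφ s hs), ?_⟩
  simp [dn, pd_eq_zero_of_notMem_tsupport _ (hφ s hs)]

theorem edgePt_notMem_tsupport {η : Plane → ℝ} (hη : S.IsTest η) (i : Fin S.numEdges) {s : ℝ}
    (hs : s ∈ Set.Icc (0 : ℝ) 1) : S.edgePt i s ∉ tsupport η :=
  fun h => S.notMem_of_mem_segment (S.edgePt_mem_segment i hs) (hη.2.2 h)

theorem pairB_smooth_sub_pairV {Φ : PlateStress} (hC : S.StressCs Φ) {G : PlateL2 S}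
    (hG : IsDivergence Φ G) {v : Fin 2 → Plane → ℝ} {φ : Plane → ℝ}
    (hv : ∀ k, ContDiff ℝ ∞ (v k)) (hφ : ContDiff ℝ ∞ φ) :
    S.pairB (smoothDisp S hv hφ) Φ - S.pairV G (smoothDisp S hv hφ) =
      ∑ i, S.edgeWork Φ i (fun k s => v k (S.edgePt i s)) (fun s => φ (S.edgePt i s))
        (fun s => S.dn i φ (S.edgePt i s)) + ∑ i, φ (S.vert i) * S.jumpNt Φ.M i := by
  rw [← momentBdry_sub_forceBdry hC hv hφ]
  have h1 := green_force hC.1 (fun x hx => (hC.2.2 x hx).1) (fun i => (G.f_mem i).integrable)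
    hG.1 hv
  have h2 := green_moment hC.2.1 G.f₃_mem.integrable hG.2 hφ
  have e1 : S.pairB (smoothDisp S hv hφ) Φ =
      -∫ x, ∑ i, ∑ j, (pd j (v i) x + pd i (v j) x) / 2 * Φ.N x i j ∂S.μ +
      ∫ x, ∑ i, ∑ j, pd j (pd i φ) x * Φ.M x i j ∂S.μ := rfl
  have e2 : S.pairV G (smoothDisp S hv hφ) =
      ∫ x, ∑ i, G.f i x * v i x ∂S.μ + ∫ x, G.f₃ x * φ x ∂S.μ := rfl
  rw [e1, e2, h1, h2]
  ring

/-- The identity `(B ψ, Φ) = (G, ψ)` for displacements with compact support in the domain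
determines the distributional divergences of `Φ`. -/
theorem isDivergence_of_pair {Φ : PlateStress} (hC : S.StressCs Φ) {G : PlateL2 S}
    (h : ∀ (v : Fin 2 → Plane → ℝ) (φ : Plane → ℝ) (hv : ∀ k, ContDiff ℝ ∞ (v k))
      (hφ : ContDiff ℝ ∞ φ), (∀ i, S.SmoothClamped i v φ) →
      S.pairB (smoothDisp S hv hφ) Φ = S.pairV G (smoothDisp S hv hφ)) : IsDivergence Φ G := by
  have hz : ContDiff ℝ ∞ (fun _ : Plane => (0 : ℝ)) := contDiff_const
  have hpd0 : ∀ j x, pd j (fun _ : Plane => (0 : ℝ)) x = 0 := by simp [pd]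
  constructor
  · intro i η hη
    let v : Fin 2 → Plane → ℝ := fun k => if k = i then η else fun _ => 0
    have hv : ∀ k, ContDiff ℝ ∞ (v k) := by
      intro k
      by_cases hk : k = i
      · simp only [v, if_pos hk]
        exact hη.1
      · simp only [v, if_neg hk]
        exact hz
    have h1 := h v (fun _ => 0) hv hz fun j => by
      refine smoothClamped_of_tsupport (fun k s hs => ?_) fun s hs => by simp [tsupport]
      by_cases hk : k = i
      · simp only [v, if_pos hk]
        exact edgePt_notMem_tsupport hη j hs
      · simp [v, if_neg hk, tsupport]
    have e1 : S.pairB (smoothDisp S hv hz) Φ =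
      -∫ x, ∑ i, ∑ j, (pd j (v i) x + pd i (v j) x) / 2 * Φ.N x i j ∂S.μ +
      ∫ x, ∑ i, ∑ j, pd j (pd i fun _ => 0) x * Φ.M x i j ∂S.μ := rfl
    have e2 : S.pairV G (smoothDisp S hv hz) =
      ∫ x, ∑ i, G.f i x * v i x ∂S.μ + ∫ x, G.f₃ x * 0 ∂S.μ := rfl
    have hpd00 : ∀ i j x, pd j (pd i fun _ : Plane => (0 : ℝ)) x = 0 := by
      intro i j x
      have : pd i (fun _ : Plane => (0 : ℝ)) = fun _ => 0 := funext (hpd0 i)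
      rw [this, hpd0]
    have e3 : ∫ x, ∑ i, ∑ j, (pd j (v i) x + pd i (v j) x) / 2 * Φ.N x i j ∂S.μ =
        ∫ x, ∑ j, Φ.N x i j * pd j η x ∂S.μ := by
      refine integral_congr_carrier fun x hx => ?_
      have hs := (hC.2.2 x (subset_closure hx)).1.apply 0 1
      have hvi : ∀ k j, pd j (v k) x = if k = i then pd j η x else 0 := by
        intro k j
        by_cases hk : k = i
        · simp only [v, if_pos hk]
        · simp only [v, if_neg hk, hpd0]
      simp only [hvi, Fin.sum_univ_two]
      fin_cases i <;> simp <;> rw [hs] <;> ring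
    have e4 : ∀ x, ∑ k, G.f k x * v k x = G.f i x * η x := by
      intro x
      rw [Finset.sum_eq_single i (fun k _ hk => by simp [v, hk]) (by simp)]
      simp [v]
    rw [e1, e2, e3] at h1
    simp only [hpd00, e4, zero_mul, mul_zero, Finset.sum_const_zero, integral_zero, add_zero] at h1
    linarith
  · intro η hη
    have h1 := h (fun _ _ => 0) η (fun _ => hz) hη.1 fun j =>
      smoothClamped_of_tsupport (fun k s hs => by simp [tsupport])
        fun s hs => edgePt_notMem_tsupport hη j hs
    have e1 : S.pairB (smoothDisp S (fun _ => hz) hη.1) Φ =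
      -∫ x, ∑ i : Fin 2, ∑ j : Fin 2, (pd j (fun _ : Plane => (0 : ℝ)) x +
        pd i (fun _ : Plane => (0 : ℝ)) x) / 2 * Φ.N x i j ∂S.μ +
      ∫ x, ∑ i, ∑ j, pd j (pd i η) x * Φ.M x i j ∂S.μ := rfl
    have e2 : S.pairV G (smoothDisp S (fun _ => hz) hη.1) =
      ∫ x, ∑ i, G.f i x * 0 ∂S.μ + ∫ x, G.f₃ x * η x ∂S.μ := rfl
    rw [e1, e2] at h1
    simp only [hpd0, add_zero, zero_div, zero_mul, mul_zero, Finset.sum_const_zero, integral_zero,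
      neg_zero, zero_add] at h1
    rw [← h1]
    refine integral_congr_ae (Eventually.of_forall fun x => ?_)
    refine Finset.sum_congr rfl fun i _ => Finset.sum_congr rfl fun j _ => ?_
    rw [pd_comm hη.1 i j x, mul_comm]

end PolygonalDomain

namespace CoupledPlates

variable (P : CoupledPlates)

/-- Smooth displacements of the two plates that satisfy the clamping and junction conditions
pointwise. -/
structure Admissible (v : Fin 2 → Plane → ℝ) (φ : Plane → ℝ) (v' : Fin 2 → Plane → ℝ)
    (φ' : Plane → ℝ) : Prop where
  smooth_v : ∀ k, ContDiff ℝ ∞ (v k)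
  smooth_w : ContDiff ℝ ∞ φ
  smooth_v' : ∀ k, ContDiff ℝ ∞ (v' k)
  smooth_w' : ContDiff ℝ ∞ φ'
  clamped : ∀ i ∈ P.clamped, P.S.SmoothClamped i v φ
  junction : ∀ s ∈ Set.Icc (0 : ℝ) 1, P.Kinematic (fun k => v k (P.S.edgePt P.Γ s))
    (φ (P.S.edgePt P.Γ s)) (P.S.dn P.Γ φ (P.S.edgePt P.Γ s))
    (fun k => v' k (P.S'.edgePt P.Γ' (1 - s))) (φ' (P.S'.edgePt P.Γ' (1 - s)))
    (P.S'.dn P.Γ' φ' (P.S'.edgePt P.Γ' (1 - s)))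

variable {P}

theorem Admissible.memW {v : Fin 2 → Plane → ℝ} {φ : Plane → ℝ} {v' : Fin 2 → Plane → ℝ}
    {φ' : Plane → ℝ} (h : P.Admissible v φ v' φ') :
    P.MemW (smoothDisp P.S h.smooth_v h.smooth_w, smoothDisp P.S' h.smooth_v' h.smooth_w') := by
  refine ⟨fun i hi => PolygonalDomain.clampedOn_smooth _ _ (h.clamped i hi), _, _, _, _, _, _,
    fun k => PolygonalDomain.hasTrace_smooth (h.smooth_v k) _ fun _ _ => rfl,
    PolygonalDomain.hasTrace_smooth h.smooth_w _ fun _ _ => rfl,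
    PolygonalDomain.hasNormalTrace_smooth h.smooth_w _,
    fun k => PolygonalDomain.hasTrace_smooth (h.smooth_v' k) _ fun _ _ => rfl,
    PolygonalDomain.hasTrace_smooth h.smooth_w' _ fun _ _ => rfl,
    PolygonalDomain.hasNormalTrace_smooth h.smooth_w' _, ?_⟩
  filter_upwards [ae_restrict_mem measurableSet_Icc] with s hs
  exact h.junction s hs

theorem kinematic_zero : P.Kinematic (fun _ => 0) 0 0 (fun _ => 0) 0 0 := by
  simp [Kinematic]

/-- A displacement of the first plate alone. -/
theorem admissible_left {v : Fin 2 → Plane → ℝ} {φ : Plane → ℝ} (hv : ∀ k, ContDiff ℝ ∞ (v k))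
    (hφ : ContDiff ℝ ∞ φ) (h : ∀ i, i ∈ P.clamped ∨ i = P.Γ → P.S.SmoothClamped i v φ) :
    P.Admissible v φ (fun _ _ => 0) (fun _ => 0) := by
  refine ⟨hv, hφ, fun _ => contDiff_const, contDiff_const, fun i hi => h i (Or.inl hi),
    fun s hs => ?_⟩
  obtain ⟨h1, h2, h3⟩ := h P.Γ (Or.inr rfl) s hs
  simp only [h1, h2, h3]
  simpa [PolygonalDomain.dn, pd] using kinematic_zero (P := P)

/-- A displacement of the second plate alone. -/
theorem admissible_right {v : Fin 2 → Plane → ℝ} {φ : Plane → ℝ} (hv : ∀ k, ContDiff ℝ ∞ (v k))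
    (hφ : ContDiff ℝ ∞ φ) (h : P.S'.SmoothClamped P.Γ' v φ) :
    P.Admissible (fun _ _ => 0) (fun _ => 0) v φ := by
  refine ⟨fun _ => contDiff_const, contDiff_const, hv, hφ,
    fun i _ => PolygonalDomain.SmoothClamped.zero i, fun s hs => ?_⟩
  obtain ⟨h1, h2, h3⟩ := h (1 - s) ⟨by linarith [hs.2], by linarith [hs.1]⟩
  simp only [h1, h2, h3]
  simpa [PolygonalDomain.dn, pd] using kinematic_zero (P := P)

/-- For `Φ ∈ Σ` the distributional divergences are square integrable, and the boundary terms in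
Green's formulas cancel for all smooth admissible displacements. -/
theorem MemSigma.boundary {Φ : PlateStress × PlateStress} (hC : P.MemCs Φ) (h : P.MemSigma Φ) :
    P.MemHs Φ ∧ ∀ v φ v' φ', P.Admissible v φ v' φ' →
      (∑ i, P.S.edgeWork Φ.1 i (fun k s => v k (P.S.edgePt i s)) (fun s => φ (P.S.edgePt i s))
        (fun s => P.S.dn i φ (P.S.edgePt i s)) + ∑ i, φ (P.S.vert i) * P.S.jumpNt Φ.1.M i) +
      (∑ i, P.S'.edgeWork Φ.2 i (fun k s => v' k (P.S'.edgePt i s))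
        (fun s => φ' (P.S'.edgePt i s)) (fun s => P.S'.dn i φ' (P.S'.edgePt i s)) +
        ∑ i, φ' (P.S'.vert i) * P.S'.jumpNt Φ.2.M i) = 0 := by
  obtain ⟨hV, G, hG⟩ := h
  have pB0 : ∀ (S : PolygonalDomain) (Ψ : PlateStress), S.pairB (smoothDisp S
      (v := fun _ _ => 0) (φ := fun _ => 0) (fun _ => contDiff_const) contDiff_const) Ψ = 0 := by
    intro S Ψ
    have : ∀ i : Fin 2, pd i (fun _ : Plane => (0 : ℝ)) = fun _ => 0 := by
      intro i
      funext x
      simp [pd]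
    simp [PolygonalDomain.pairB, smoothDisp, smoothH1, smoothH2, symGrad, this]
  have pV0 : ∀ (S : PolygonalDomain) (G : PlateL2 S), S.pairV G (smoothDisp S
      (v := fun _ _ => 0) (φ := fun _ => 0) (fun _ => contDiff_const) contDiff_const) = 0 := by
    intro S Ψ
    simp [PolygonalDomain.pairV, smoothDisp, smoothH1, smoothH2]
  have d1 : PolygonalDomain.IsDivergence Φ.1 G.1 := by
    refine PolygonalDomain.isDivergence_of_pair hC.1 fun v φ hv hφ hcl => ?_
    have := hG _ (admissible_left hv hφ fun i _ => hcl i).memW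
    rwa [pB0, pV0, add_zero, add_zero] at this
  have d2 : PolygonalDomain.IsDivergence Φ.2 G.2 := by
    refine PolygonalDomain.isDivergence_of_pair hC.2 fun v φ hv hφ hcl => ?_
    have := hG _ (admissible_right hv hφ (hcl P.Γ')).memW
    rwa [pB0, pV0, zero_add, zero_add] at this
  refine ⟨⟨⟨hV.1, ⟨G.1.f, G.1.f_mem, d1.1⟩, G.1.f₃, G.1.f₃_mem, d1.2⟩,
    ⟨hV.2, ⟨G.2.f, G.2.f_mem, d2.1⟩, G.2.f₃, G.2.f₃_mem, d2.2⟩⟩, fun v φ v' φ' ha => ?_⟩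
  rw [← PolygonalDomain.pairB_smooth_sub_pairV hC.1 d1 ha.smooth_v ha.smooth_w,
    ← PolygonalDomain.pairB_smooth_sub_pairV hC.2 d2 ha.smooth_v' ha.smooth_w']
  have := hG _ ha.memW
  linarith

end CoupledPlates

/-! ### Localized displacements and necessity -/

/-- A radial bump is stationary in the directions orthogonal to the radius. -/
theorem fderiv_radialBump_of_inner_eq_zero (c : Plane) (r : ℝ) {x v : Plane}
    (h : inner ℝ (x - c) v = 0) : fderiv ℝ (radialBump c r) x v = 0 := by
  have h1 : HasFDerivAt (fun y : Plane => ‖y - c‖ ^ 2) (2 • (innerSL ℝ (x - c)).comp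
      (ContinuousLinearMap.id ℝ Plane)) x := ((hasFDerivAt_id x).sub_const c).norm_sq
  have h2 : DifferentiableAt ℝ Real.smoothTransition (2 - 2 * (‖x - c‖ ^ 2 / r ^ 2)) :=
    (Real.smoothTransition.contDiff (n := 1)).differentiable (by simp) _
  have h3 : HasFDerivAt (fun y : Plane => 2 - 2 * (‖y - c‖ ^ 2 / r ^ 2))
      (-((2 / r ^ 2) • (2 • (innerSL ℝ (x - c)).comp (ContinuousLinearMap.id ℝ Plane)))) x := by
    refine (((h1.const_mul (2 / r ^ 2)).const_sub 2)).congr_of_eventuallyEq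
      (Eventually.of_forall fun y => ?_)
    change 2 - 2 * (‖y - c‖ ^ 2 / r ^ 2) = 2 - 2 / r ^ 2 * ‖y - c‖ ^ 2
    ring
  have h4 := h2.hasDerivAt.comp_hasFDerivAt x h3
  have h5 : radialBump c r = Real.smoothTransition ∘
    fun y : Plane => 2 - 2 * (‖y - c‖ ^ 2 / r ^ 2) := rfl
  rw [inner_sub_left] at h
  rw [h5, h4.fderiv]
  simp [h]

namespace PolygonalDomain

variable {S : PolygonalDomain}

theorem norm_edgePt_sub (i : Fin S.numEdges) (s s₀ : ℝ) :
    ‖S.edgePt i s - S.edgePt i s₀‖ = |s - s₀| * S.len i := by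
  rw [edgePt_eq, edgePt_eq, add_sub_add_left_eq_sub, ← sub_smul, norm_smul, norm_tangent, mul_one,
    ← sub_mul, Real.norm_eq_abs, abs_mul, abs_of_pos (S.len_pos i)]

theorem dn_radialBump (i : Fin S.numEdges) (s s₀ r : ℝ) :
    S.dn i (radialBump (S.edgePt i s₀) r) (S.edgePt i s) = 0 := by
  rw [dn, ← fderiv_apply_eq_sum]
  refine fderiv_radialBump_of_inner_eq_zero _ _ ?_
  rw [edgePt_eq, edgePt_eq, add_sub_add_left_eq_sub, ← sub_smul, inner_smul_left,
    inner_tangent_normal, mul_zero]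

variable (S) in
/-- A smooth function supported near `c` which for `c` on the edge `i` has the values `b η` and the
normal derivative `d η` on that edge, with the radial bump `η` around `c`. -/
def bumpField (i : Fin S.numEdges) (c : Plane) (r b d : ℝ) (x : Plane) : ℝ :=
  (b - d * S.depth i x) * radialBump c r x

theorem contDiff_bumpField (i : Fin S.numEdges) (c : Plane) (r b d : ℝ) :
    ContDiff ℝ ∞ (S.bumpField i c r b d) :=
  (contDiff_const.sub (contDiff_const.mul (S.contDiff_depth i))).mul (contDiff_radialBump c r)

theorem tsupport_bumpField_subset (i : Fin S.numEdges) (c : Plane) {r : ℝ} (hr : 0 < r)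
    (b d : ℝ) : tsupport (S.bumpField i c r b d) ⊆ Metric.closedBall c r :=
  (closure_mono (Function.support_mul_subset_right _ _)).trans (tsupport_radialBump_subset c hr)

theorem depth_edgePt (i : Fin S.numEdges) (s : ℝ) : S.depth i (S.edgePt i s) = 0 := by
  rw [depth, inner_edgePt_normal, neg_zero]

theorem bumpField_edgePt (i : Fin S.numEdges) (c : Plane) (r b d s : ℝ) :
    S.bumpField i c r b d (S.edgePt i s) = b * radialBump c r (S.edgePt i s) := by
  rw [bumpField, depth_edgePt, mul_zero, sub_zero]

theorem dn_bumpField (i : Fin S.numEdges) (r b d s s₀ : ℝ) :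
    S.dn i (S.bumpField i (S.edgePt i s₀) r b d) (S.edgePt i s) =
      d * radialBump (S.edgePt i s₀) r (S.edgePt i s) := by
  have h1 : ∀ j, pd j (S.bumpField i (S.edgePt i s₀) r b d) (S.edgePt i s) =
      d * S.normal i j * radialBump (S.edgePt i s₀) r (S.edgePt i s) +
        b * pd j (radialBump (S.edgePt i s₀) r) (S.edgePt i s) := by
    intro j
    have hd := S.contDiff_depth i
    have h2 := pd_mul j (f := fun x => b - d * S.depth i x) (x := S.edgePt i s)
      (ContDiff.diffAt (contDiff_const.sub (contDiff_const.mul hd)) _)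
      (ContDiff.diffAt (contDiff_radialBump (S.edgePt i s₀) r) _)
    have h3 : pd j (fun x => b - d * S.depth i x) (S.edgePt i s) = d * S.normal i j := by
      have h4 := S.pd_depth i j (S.edgePt i s)
      unfold pd at h4 ⊢
      rw [fderiv_const_sub, fderiv_const_mul (ContDiff.diffAt hd _)]
      simp [h4]
    change pd j (fun x => (b - d * S.depth i x) * radialBump (S.edgePt i s₀) r x) _ = _
    rw [h2, h3, depth_edgePt, mul_zero, sub_zero]
  have h2 := S.dn_radialBump i s s₀ r
  have h3 := S.tangent_sq i
  simp only [dn, h1, Fin.sum_univ_two, normal_zero, normal_one] at h2 ⊢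
  linear_combination b * h2 + d * radialBump (S.edgePt i s₀) r (S.edgePt i s) * h3

/-- A displacement that is localized near `c` vanishes on the edges away from `c`. -/
theorem smoothClamped_bump {i j : Fin S.numEdges} {c : Plane} {r : ℝ} (hr : 0 < r)
    (h : ∀ z ∈ segment ℝ (S.vert j) (S.vert (S.next j)), r < dist z c) (a : Fin 2 → ℝ) (b d : ℝ) :
    S.SmoothClamped j (fun k x => a k * radialBump c r x) (S.bumpField i c r b d) := by
  have h1 : ∀ s ∈ Set.Icc (0 : ℝ) 1, S.edgePt j s ∉ Metric.closedBall c r := fun s hs hm =>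
    (h _ (S.edgePt_mem_segment j hs)).not_ge hm
  exact smoothClamped_of_tsupport
    (fun k s hs hm => h1 s hs (tsupport_radialBump_subset c hr
      (closure_mono (Function.support_mul_subset_right _ _) hm)))
    fun s hs hm => h1 s hs (tsupport_bumpField_subset i c hr b d hm)

theorem contDiff_mul_radialBump (a : ℝ) (c : Plane) (r : ℝ) :
    ContDiff ℝ ∞ fun x => a * radialBump c r x := contDiff_const.mul (contDiff_radialBump c r)

theorem bumpField_vert_eq_zero {i j : Fin S.numEdges} {c : Plane} {r : ℝ} (hr : 0 < r)
    (h : r < dist (S.vert j) c) (b d : ℝ) : S.bumpField i c r b d (S.vert j) = 0 := by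
  rw [bumpField, radialBump_eq_zero hr (by rw [← dist_eq_norm]; exact h.le), mul_zero]

/-- The edge work of a localized displacement on its own edge. -/
theorem edgeWork_bump (Φ : PlateStress) (i : Fin S.numEdges) (s₀ r : ℝ) (a : Fin 2 → ℝ)
    (b d : ℝ) :
    S.edgeWork Φ i (fun k s => a k * radialBump (S.edgePt i s₀) r (S.edgePt i s))
      (fun s => S.bumpField i (S.edgePt i s₀) r b d (S.edgePt i s))
      (fun s => S.dn i (S.bumpField i (S.edgePt i s₀) r b d) (S.edgePt i s)) =
    S.len i * ∫ s in (0 : ℝ)..1, radialBump (S.edgePt i s₀) r (S.edgePt i s) *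
      S.edgeDensity Φ i a b d (S.edgePt i s) := by
  rw [edgeWork_eq]
  congr 2
  funext s
  rw [bumpField_edgePt, dn_bumpField, edgeDensity, edgeDensity, Fin.sum_univ_two, Fin.sum_univ_two]
  ring

/-- A ball around an interior point of an edge that stays away from the other edges. -/
theorem exists_radius_edge (i : Fin S.numEdges) {s₀ : ℝ} (hs : s₀ ∈ Set.Ioo (0 : ℝ) 1) :
    ∃ δ > 0, ∀ j, j ≠ i → ∀ z ∈ segment ℝ (S.vert j) (S.vert (S.next j)),
      δ ≤ dist z (S.edgePt i s₀) := by
  obtain ⟨δ, hδ, h1, -⟩ := S.exists_isolating_radius (S.edgePt i s₀)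
  refine ⟨δ, hδ, fun j hj z hz => not_lt.1 fun h => ?_⟩
  exact Set.disjoint_left.1 (S.edges_disjoint i j hj.symm) (S.edgePt_mem_openSegment i hs)
    (h1 j z hz h)

/-- A ball around a vertex that stays away from the edges that do not meet there. -/
theorem exists_radius_vert (i : Fin S.numEdges) :
    ∃ δ > 0, (∀ j, j ≠ i → j ≠ S.prev i → ∀ z ∈ segment ℝ (S.vert j) (S.vert (S.next j)),
      δ ≤ dist z (S.vert i)) ∧ ∀ j, j ≠ i → δ ≤ dist (S.vert j) (S.vert i) := by
  obtain ⟨δ, hδ, h1, h2⟩ := S.exists_isolating_radius (S.vert i)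
  refine ⟨δ, hδ, fun j hj hj' z hz => not_lt.1 fun h => ?_, fun j hj => not_lt.1 fun h => ?_⟩
  · rcases S.eq_or_eq_prev_of_vert_mem (h1 j z hz h) with h3 | h3
    · exact hj h3
    · exact hj' h3
  · exact hj (S.vert_injective (h2 j h))

/-- The fundamental lemma of the calculus of variations on an edge, with radial bumps. -/
theorem eq_zero_of_integral_radialBump {b : ℝ → ℝ} (hb : ContinuousOn b (Set.Icc 0 1))
    (i : Fin S.numEdges) {s₀ : ℝ} (hs₀ : s₀ ∈ Set.Ioo (0 : ℝ) 1) {δ : ℝ} (hδ : 0 < δ)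
    (h : ∀ r, 0 < r → r < δ →
      ∫ s in (0 : ℝ)..1, radialBump (S.edgePt i s₀) r (S.edgePt i s) * b s = 0) : b s₀ = 0 := by
  have key : ∀ {b : ℝ → ℝ}, ContinuousOn b (Set.Icc 0 1) → (∀ r, 0 < r → r < δ →
      ∫ s in (0 : ℝ)..1, radialBump (S.edgePt i s₀) r (S.edgePt i s) * b s = 0) → ¬ 0 < b s₀ := by
    intro b hb h hpos
    -- if `b s₀` is positive, then the integrand is nonnegative for a bump of small support
    have h1 : ∀ᶠ s in 𝓝 s₀, 0 < b s :=
      continuousAt_const.eventually_lt (hb.continuousAt (Icc_mem_nhds hs₀.1 hs₀.2)) hpos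
    obtain ⟨ε, hε, h2⟩ := Metric.eventually_nhds_iff.1 h1
    have hl := S.len_pos i
    let r := min (δ / 2) (ε * S.len i)
    have hr : 0 < r := lt_min (by linarith) (mul_pos hε hl)
    have hrδ : r < δ := (min_le_left _ _).trans_lt (by linarith)
    have h3 := h r hr hrδ
    refine h3.not_gt (intervalIntegral.integral_pos zero_lt_one (ContinuousOn.mul ?_ hb) ?_
      ⟨s₀, Set.Ioo_subset_Icc_self hs₀, ?_⟩)
    · exact ((contDiff_radialBump _ _).continuous.comp (S.continuous_edgePt i)).continuousOn
    · intro s hs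
      by_cases hd : dist s s₀ < ε
      · exact mul_nonneg (radialBump_nonneg _ _ _) (h2 hd).le
      · rw [radialBump_eq_zero hr, zero_mul]
        rw [norm_edgePt_sub]
        refine (min_le_right _ _).trans ?_
        rw [Real.dist_eq] at hd
        gcongr
        exact not_lt.1 hd
    · rw [radialBump_center, one_mul]
      exact hpos
  refine le_antisymm (not_lt.1 (key hb h)) ?_
  have := key (b := fun s => -b s) hb.neg fun r h1 h2 => by
    simp only [mul_neg, intervalIntegral.integral_neg, h r h1 h2, neg_zero]
  linarith [not_lt.1 this]

theorem continuousOn_edgeDensity {Φ : PlateStress} (hC : S.StressCs Φ) (i : Fin S.numEdges)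
    (v : Fin 2 → ℝ) (w d : ℝ) : ContinuousOn (S.edgeDensity Φ i v w d) (closure S.carrier) := by
  refine ((continuousOn_const.mul (continuousOn_nn (fun a b => (hC.2.1 a b).continuousOn) i)).sub
    (continuousOn_const.mul (continuousOn_shear hC.2.1 i))).sub
    (continuousOn_finsetSum _ fun k _ => continuousOn_const.mul (continuousOn_conormal hC.1 i k))

/-- If the work on each displacement localized near an interior point of an edge vanishes, then so
do all boundary forces there. -/
theorem edge_conditions_of_work {Φ : PlateStress} (hC : S.StressCs Φ) {i : Fin S.numEdges}
    (h : ∀ (v : Fin 2 → Plane → ℝ) (φ : Plane → ℝ), (∀ k, ContDiff ℝ ∞ (v k)) →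
      ContDiff ℝ ∞ φ → (∀ j, j ≠ i → S.SmoothClamped j v φ) →
      ∑ i, S.edgeWork Φ i (fun k s => v k (S.edgePt i s)) (fun s => φ (S.edgePt i s))
        (fun s => S.dn i φ (S.edgePt i s)) + ∑ i, φ (S.vert i) * S.jumpNt Φ.M i = 0)
    {s₀ : ℝ} (hs₀ : s₀ ∈ Set.Ioo (0 : ℝ) 1) :
    S.conormal Φ.N i (S.edgePt i s₀) = 0 ∧ S.shear Φ.M i (S.edgePt i s₀) = 0 ∧
      S.nn Φ.M i (S.edgePt i s₀) = 0 := by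
  obtain ⟨δ, hδ, hδ1⟩ := S.exists_radius_edge i hs₀
  have key : ∀ (a : Fin 2 → ℝ) (b d : ℝ), S.edgeDensity Φ i a b d (S.edgePt i s₀) = 0 := by
    intro a b d
    refine eq_zero_of_integral_radialBump (b := fun s => S.edgeDensity Φ i a b d (S.edgePt i s))
      (continuousOn_comp_edgePt (continuousOn_edgeDensity hC i a b d) i) i hs₀ hδ
      fun r hr hrδ => ?_
    have hcl : ∀ j, j ≠ i → S.SmoothClamped j
        (fun k x => a k * radialBump (S.edgePt i s₀) r x)
        (S.bumpField i (S.edgePt i s₀) r b d) := fun j hj =>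
      smoothClamped_bump hr (fun z hz => hrδ.trans_le (hδ1 j hj z hz)) a b d
    have h1 := h _ _ (fun k => contDiff_mul_radialBump (a k) _ r) (contDiff_bumpField _ _ _ _ _) hcl
    rw [Finset.sum_eq_single i
      (fun j _ hj => edgeWork_eq_zero_of_smoothClamped (hcl j hj) Φ) (by simp),
      edgeWork_bump, Finset.sum_eq_zero, add_zero] at h1
    · exact (mul_eq_zero.1 h1).resolve_left (S.len_pos i).ne'
    · intro j _
      rw [bumpField_vert_eq_zero hr, zero_mul]
      refine hrδ.trans_le ?_
      -- one of the two edges at a vertex is different from the given edge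
      by_cases hj : j = i
      · refine hδ1 (S.prev j) ?_ _ ?_
        · rw [← hj]
          exact S.prev_ne j
        · rw [S.next_prev]
          exact right_mem_segment _ _ _
      · exact hδ1 j hj _ (left_mem_segment _ _ _)
  refine ⟨?_, ?_, ?_⟩
  · funext k
    have := key (Pi.single k 1) 0 0
    fin_cases k <;> simpa [edgeDensity] using this
  · simpa [edgeDensity] using key 0 1 0
  · simpa [edgeDensity] using key 0 0 1

end PolygonalDomain

namespace CoupledPlates

variable {P : CoupledPlates}

/-- Displacements localized near a free edge of the first plate are admissible. -/
theorem MemSigma.freeEdge {Φ : PlateStress × PlateStress} (hC : P.MemCs Φ) (h : P.MemSigma Φ)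
    {i : Fin P.S.numEdges} (hi : i ∈ P.free) {s : ℝ} (hs : s ∈ Set.Ioo (0 : ℝ) 1) :
    P.S.conormal Φ.1.N i (P.S.edgePt i s) = 0 ∧ P.S.shear Φ.1.M i (P.S.edgePt i s) = 0 ∧
      P.S.nn Φ.1.M i (P.S.edgePt i s) = 0 := by
  refine PolygonalDomain.edge_conditions_of_work hC.1 (fun v φ hv hφ hcl => ?_) hs
  have h1 := (MemSigma.boundary hC h).2 _ _ _ _ (admissible_left hv hφ fun j hj => hcl j (by
    rintro rfl
    exact hj.elim hi.1 hi.2))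
  rw [Finset.sum_eq_zero (s := Finset.univ) (f := fun i => P.S'.edgeWork _ _ _ _ _)
    fun j _ => PolygonalDomain.edgeWork_eq_zero_of_smoothClamped
      (PolygonalDomain.SmoothClamped.zero j) _] at h1
  simpa using h1

theorem MemSigma.freeEdge' {Φ : PlateStress × PlateStress} (hC : P.MemCs Φ) (h : P.MemSigma Φ)
    {i : Fin P.S'.numEdges} (hi : i ∈ P.free') {s : ℝ} (hs : s ∈ Set.Ioo (0 : ℝ) 1) :
    P.S'.conormal Φ.2.N i (P.S'.edgePt i s) = 0 ∧ P.S'.shear Φ.2.M i (P.S'.edgePt i s) = 0 ∧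
      P.S'.nn Φ.2.M i (P.S'.edgePt i s) = 0 := by
  refine PolygonalDomain.edge_conditions_of_work hC.2 (fun v φ hv hφ hcl => ?_) hs
  have h1 := (MemSigma.boundary hC h).2 _ _ _ _ (admissible_right hv hφ
    (hcl P.Γ' (Ne.symm hi)))
  rw [Finset.sum_eq_zero (s := Finset.univ) (f := fun i => P.S.edgeWork _ _ _ _ _)
    fun j _ => PolygonalDomain.edgeWork_eq_zero_of_smoothClamped
      (PolygonalDomain.SmoothClamped.zero j) _] at h1
  simpa using h1

theorem radialBump_junction (s s₀ r : ℝ) :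
    radialBump (P.S'.edgePt P.Γ' (1 - s₀)) r (P.S'.edgePt P.Γ' (1 - s)) =
      radialBump (P.S.edgePt P.Γ s₀) r (P.S.edgePt P.Γ s) := by
  rw [radialBump, radialBump, PolygonalDomain.norm_edgePt_sub, PolygonalDomain.norm_edgePt_sub,
    P.len_junction, sub_sub_sub_cancel_left, abs_sub_comm]

/-- Displacements of both plates that are localized near a point of the junction. -/
theorem admissible_bump {s₀ r : ℝ} (hr : 0 < r)
    (hcl : ∀ j ∈ P.clamped, ∀ z ∈ segment ℝ (P.S.vert j) (P.S.vert (P.S.next j)),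
      r < dist z (P.S.edgePt P.Γ s₀)) {a a' : Fin 2 → ℝ} {b d b' d' : ℝ}
    (hk : P.Kinematic a b d a' b' d') :
    P.Admissible (fun k x => a k * radialBump (P.S.edgePt P.Γ s₀) r x)
      (P.S.bumpField P.Γ (P.S.edgePt P.Γ s₀) r b d)
      (fun k x => a' k * radialBump (P.S'.edgePt P.Γ' (1 - s₀)) r x)
      (P.S'.bumpField P.Γ' (P.S'.edgePt P.Γ' (1 - s₀)) r b' d') := by
  refine ⟨fun k => PolygonalDomain.contDiff_mul_radialBump _ _ _,
    PolygonalDomain.contDiff_bumpField _ _ _ _ _,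
    fun k => PolygonalDomain.contDiff_mul_radialBump _ _ _,
    PolygonalDomain.contDiff_bumpField _ _ _ _ _,
    fun j hj => PolygonalDomain.smoothClamped_bump hr (hcl j hj) a b d, fun s _ => ?_⟩
  rw [PolygonalDomain.bumpField_edgePt, PolygonalDomain.bumpField_edgePt,
    PolygonalDomain.dn_bumpField, PolygonalDomain.dn_bumpField, radialBump_junction]
  obtain ⟨h1, h2, h3, h4⟩ := hk
  refine ⟨?_, ?_, ?_, ?_⟩
  · rw [h1]
    ring
  · simp only [h2]
    ring
  · simp only [h3]
    ring
  · rw [h4]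
    ring

theorem MemSigma.junction {Φ : PlateStress × PlateStress} (hC : P.MemCs Φ) (h : P.MemSigma Φ) :
    P.JunctionConditions Φ := by
  intro s₀ hs₀
  refine (P.junction_iff Φ _ _).2 fun a b d a' b' d' hk => ?_
  have hs₀' : 1 - s₀ ∈ Set.Ioo (0 : ℝ) 1 := ⟨by linarith [hs₀.2], by linarith [hs₀.1]⟩
  obtain ⟨δ, hδ, hδ1⟩ := P.S.exists_radius_edge P.Γ hs₀
  obtain ⟨δ', hδ', hδ1'⟩ := P.S'.exists_radius_edge P.Γ' hs₀'
  have hc : ContinuousOn (fun s => P.S.edgeDensity Φ.1 P.Γ a b d (P.S.edgePt P.Γ s))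
      (Set.Icc 0 1) := PolygonalDomain.continuousOn_comp_edgePt
    (PolygonalDomain.continuousOn_edgeDensity hC.1 P.Γ a b d) P.Γ
  have hc' : ContinuousOn (fun s => P.S'.edgeDensity Φ.2 P.Γ' a' b' d' (P.S'.edgePt P.Γ' (1 - s)))
      (Set.Icc 0 1) := (PolygonalDomain.continuousOn_comp_edgePt
    (PolygonalDomain.continuousOn_edgeDensity hC.2 P.Γ' a' b' d') P.Γ').comp
    (continuous_const.sub continuous_id).continuousOn
    fun s hs => ⟨by simpa using hs.2, by simpa using hs.1⟩
  refine PolygonalDomain.eq_zero_of_integral_radialBump (S := P.S)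
    (b := fun s => P.S.edgeDensity Φ.1 P.Γ a b d (P.S.edgePt P.Γ s) +
      P.S'.edgeDensity Φ.2 P.Γ' a' b' d' (P.S'.edgePt P.Γ' (1 - s)))
    (hc.add hc') P.Γ hs₀ (lt_min hδ hδ') fun r hr hrδ => ?_
  obtain ⟨hr1, hr2⟩ := lt_min_iff.1 hrδ
  have far : ∀ j, j ≠ P.Γ → ∀ z ∈ segment ℝ (P.S.vert j) (P.S.vert (P.S.next j)),
      r < dist z (P.S.edgePt P.Γ s₀) := fun j hj z hz => hr1.trans_le (hδ1 j hj z hz)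
  have far' : ∀ j, j ≠ P.Γ' → ∀ z ∈ segment ℝ (P.S'.vert j) (P.S'.vert (P.S'.next j)),
      r < dist z (P.S'.edgePt P.Γ' (1 - s₀)) := fun j hj z hz => hr2.trans_le (hδ1' j hj z hz)
  have h1 := (MemSigma.boundary hC h).2 _ _ _ _ (admissible_bump hr
    (fun j hj => far j (fun he => P.Γ_not_clamped (he ▸ hj))) hk)
  rw [Finset.sum_eq_single P.Γ (fun j _ hj => PolygonalDomain.edgeWork_eq_zero_of_smoothClamped
      (PolygonalDomain.smoothClamped_bump hr (far j hj) a b d) _) (by simp),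
    Finset.sum_eq_single P.Γ' (fun j _ hj => PolygonalDomain.edgeWork_eq_zero_of_smoothClamped
      (PolygonalDomain.smoothClamped_bump hr (far' j hj) a' b' d') _) (by simp),
    PolygonalDomain.edgeWork_bump, PolygonalDomain.edgeWork_bump, Finset.sum_eq_zero,
    Finset.sum_eq_zero, add_zero, add_zero, ← P.len_junction, ← mul_add] at h1
  · have h2 := (mul_eq_zero.1 h1).resolve_left (P.S.len_pos P.Γ).ne'
    have h3 := intervalIntegral.integral_comp_sub_left (a := 0) (b := 1) (fun s =>
      radialBump (P.S'.edgePt P.Γ' (1 - s₀)) r (P.S'.edgePt P.Γ' s) *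
        P.S'.edgeDensity Φ.2 P.Γ' a' b' d' (P.S'.edgePt P.Γ' s)) 1
    rw [sub_self, sub_zero] at h3
    simp only [radialBump_junction] at h3
    rw [← h3] at h2
    have hη : ContinuousOn (fun s => radialBump (P.S.edgePt P.Γ s₀) r (P.S.edgePt P.Γ s))
        (Set.Icc 0 1) := ((contDiff_radialBump _ _).continuous.comp
      (P.S.continuous_edgePt P.Γ)).continuousOn
    rw [← intervalIntegral.integral_add] at h2
    · simpa only [mul_add] using h2
    · exact (hη.mul hc).intervalIntegrable_of_Icc zero_le_one
    · exact (hη.mul hc').intervalIntegrable_of_Icc zero_le_one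
  · intro j _
    rw [PolygonalDomain.bumpField_vert_eq_zero hr, zero_mul]
    by_cases hj : j = P.Γ'
    · refine far' (P.S'.prev j) ?_ _ ?_
      · rw [← hj]
        exact P.S'.prev_ne j
      · rw [P.S'.next_prev]
        exact right_mem_segment _ _ _
    · exact far' j hj _ (left_mem_segment _ _ _)
  · intro j _
    rw [PolygonalDomain.bumpField_vert_eq_zero hr, zero_mul]
    by_cases hj : j = P.Γ
    · refine far (P.S.prev j) ?_ _ ?_
      · rw [← hj]
        exact P.S.prev_ne j
      · rw [P.S.next_prev]
        exact right_mem_segment _ _ _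
    · exact far j hj _ (left_mem_segment _ _ _)

/-- Once the edge and junction conditions are known, only the vertex forces are left. -/
theorem MemSigma.vertex {Φ : PlateStress × PlateStress} (hC : P.MemCs Φ) (h : P.MemSigma Φ)
    {v : Fin 2 → Plane → ℝ} {φ : Plane → ℝ} {v' : Fin 2 → Plane → ℝ} {φ' : Plane → ℝ}
    (ha : P.Admissible v φ v' φ') :
    ∑ i, φ (P.S.vert i) * P.S.jumpNt Φ.1.M i + ∑ i, φ' (P.S'.vert i) * P.S'.jumpNt Φ.2.M i = 0 := by
  have h1 := (MemSigma.boundary hC h).2 _ _ _ _ ha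
  rw [Finset.sum_eq_single P.Γ (fun j _ hj => ?_) (by simp),
    Finset.sum_eq_single P.Γ' (fun j _ hj => PolygonalDomain.edgeWork_eq_zero
      (fun s hs => MemSigma.freeEdge' hC h hj hs) _ _ _) (by simp)] at h1
  · have h2 := P.edgeWork_junction (MemSigma.junction hC h)
      (v := fun k s => v k (P.S.edgePt P.Γ s)) (w := fun s => φ (P.S.edgePt P.Γ s))
      (d := fun s => P.S.dn P.Γ φ (P.S.edgePt P.Γ s))
      (v' := fun k s => v' k (P.S'.edgePt P.Γ' s)) (w' := fun s => φ' (P.S'.edgePt P.Γ' s))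
      (d' := fun s => P.S'.dn P.Γ' φ' (P.S'.edgePt P.Γ' s)) (by
        filter_upwards [ae_restrict_mem measurableSet_Icc] with s hs
        exact ha.junction s hs)
    linarith
  · by_cases hjc : j ∈ P.clamped
    · exact PolygonalDomain.edgeWork_eq_zero_of_smoothClamped (ha.clamped j hjc) _
    · exact PolygonalDomain.edgeWork_eq_zero
        (fun s hs => MemSigma.freeEdge hC h ⟨hjc, hj⟩ hs) _ _ _

theorem sum_bumpField_vert {S : PolygonalDomain} {i j : Fin S.numEdges} {r : ℝ} (hr : 0 < r)
    (h : ∀ k, k ≠ j → r < dist (S.vert k) (S.vert j)) {s : ℝ} (hs : S.edgePt i s = S.vert j)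
    (b : ℝ) (J : Fin S.numEdges → ℝ) :
    ∑ k, S.bumpField i (S.vert j) r b 0 (S.vert k) * J k = b * J j := by
  rw [Finset.sum_eq_single j (fun k _ hk => by
    rw [PolygonalDomain.bumpField_vert_eq_zero hr (h k hk), zero_mul]) (by simp)]
  rw [← hs, PolygonalDomain.bumpField_edgePt, radialBump_center, mul_one]

theorem MemSigma.freeVertex {Φ : PlateStress × PlateStress} (hC : P.MemCs Φ) (h : P.MemSigma Φ)
    {i : Fin P.S.numEdges} (hi : i ∈ P.free) (hi' : P.S.prev i ∈ P.free) :
    P.S.jumpNt Φ.1.M i = 0 := by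
  obtain ⟨δ, hδ, h1, h2⟩ := P.S.exists_radius_vert i
  have hr : 0 < δ / 2 := by linarith
  have hrδ : δ / 2 < δ := by linarith
  have ha : P.Admissible (fun k x => (0 : ℝ) * radialBump (P.S.vert i) (δ / 2) x)
      (P.S.bumpField i (P.S.vert i) (δ / 2) 1 0) (fun _ _ => 0) (fun _ => 0) :=
    admissible_left (fun _ => PolygonalDomain.contDiff_mul_radialBump _ _ _)
      (PolygonalDomain.contDiff_bumpField _ _ _ _ _) fun j hj =>
      PolygonalDomain.smoothClamped_bump hr (fun z hz => hrδ.trans_le (h1 j (by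
        rintro rfl
        exact hj.elim hi.1 hi.2) (by
        rintro rfl
        exact hj.elim hi'.1 hi'.2) z hz)) (fun _ => 0) 1 0
  have h3 := MemSigma.vertex hC h ha
  rw [sum_bumpField_vert hr (fun k hk => hrδ.trans_le (h2 k hk)) (P.S.edgePt_zero i)] at h3
  simpa using h3

theorem MemSigma.freeVertex' {Φ : PlateStress × PlateStress} (hC : P.MemCs Φ) (h : P.MemSigma Φ)
    {i : Fin P.S'.numEdges} (hi : i ∈ P.free') (hi' : P.S'.prev i ∈ P.free') :
    P.S'.jumpNt Φ.2.M i = 0 := by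
  obtain ⟨δ, hδ, h1, h2⟩ := P.S'.exists_radius_vert i
  have hr : 0 < δ / 2 := by linarith
  have hrδ : δ / 2 < δ := by linarith
  have ha : P.Admissible (fun _ _ => 0) (fun _ => 0)
      (fun k x => (0 : ℝ) * radialBump (P.S'.vert i) (δ / 2) x)
      (P.S'.bumpField i (P.S'.vert i) (δ / 2) 1 0) :=
    admissible_right (fun _ => PolygonalDomain.contDiff_mul_radialBump _ _ _)
      (PolygonalDomain.contDiff_bumpField _ _ _ _ _)
      (PolygonalDomain.smoothClamped_bump hr (fun z hz => hrδ.trans_le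
        (h1 _ (Ne.symm hi) (Ne.symm hi') z hz)) (fun _ => 0) 1 0)
  have h3 := MemSigma.vertex hC h ha
  rw [sum_bumpField_vert hr (fun k hk => hrδ.trans_le (h2 k hk)) (P.S'.edgePt_zero i)] at h3
  simpa using h3

/-- At an end point of the junction the vertex forces of both plates balance for each compatible
deflection. -/
theorem MemSigma.corner {Φ : PlateStress × PlateStress} (hC : P.MemCs Φ) (h : P.MemSigma Φ)
    {j : Fin P.S.numEdges} {j' : Fin P.S'.numEdges} {s₀ : ℝ} (hj : P.S.edgePt P.Γ s₀ = P.S.vert j)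
    (hj' : P.S'.edgePt P.Γ' (1 - s₀) = P.S'.vert j') (hcl : j ∉ P.clamped)
    (hcl' : P.S.prev j ∉ P.clamped) {a a' : Fin 2 → ℝ} {b b' : ℝ}
    (hk : P.Kinematic a b 0 a' b' 0) :
    b * P.S.jumpNt Φ.1.M j + b' * P.S'.jumpNt Φ.2.M j' = 0 := by
  obtain ⟨δ, hδ, h1, h2⟩ := P.S.exists_radius_vert j
  obtain ⟨δ', hδ', -, h2'⟩ := P.S'.exists_radius_vert j'
  obtain ⟨r, hr, hrδ⟩ := exists_between (lt_min hδ hδ')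
  obtain ⟨hr1, hr2⟩ := lt_min_iff.1 hrδ
  have ha := admissible_bump hr (s₀ := s₀) (fun i hi z hz => by
    rw [hj]
    exact hr1.trans_le (h1 i (fun he => hcl (he ▸ hi)) (fun he => hcl' (he ▸ hi)) z hz)) hk
  have h3 := MemSigma.vertex hC h ha
  rw [hj, hj', sum_bumpField_vert hr (fun k hk => hr1.trans_le (h2 k hk)) hj,
    sum_bumpField_vert hr (fun k hk => hr2.trans_le (h2' k hk)) hj'] at h3
  exact h3

theorem MemSigma.corners {Φ : PlateStress × PlateStress} (hC : P.MemCs Φ) (h : P.MemSigma Φ) :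
    P.CornerConditions Φ := by
  have k1 : P.Kinematic ![Real.cos P.θ, 0] (-Real.sin P.θ) 0 ![1, 0] 0 0 := by simp [Kinematic]
  have k2 : P.Kinematic ![-Real.sin P.θ, 0] (-Real.cos P.θ) 0 ![0, 0] 1 0 := by simp [Kinematic]
  have hs : ∀ {a a' : Fin 2 → ℝ} {b b' : ℝ}, P.Kinematic a b 0 a' b' 0 →
      b * P.S.jumpNt Φ.1.M P.Γ + b' * P.S'.jumpNt Φ.2.M (P.S'.next P.Γ') = 0 := fun hk =>
    MemSigma.corner hC h (s₀ := 0) (P.S.edgePt_zero _) (by simp) P.Γ_not_clamped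
      P.prev_not_clamped hk
  have he : ∀ {a a' : Fin 2 → ℝ} {b b' : ℝ}, P.Kinematic a b 0 a' b' 0 →
      b * P.S.jumpNt Φ.1.M (P.S.next P.Γ) + b' * P.S'.jumpNt Φ.2.M P.Γ' = 0 := fun hk =>
    MemSigma.corner hC h (s₀ := 1) (P.S.edgePt_one _) (by simp) P.next_not_clamped
      (by rw [P.S.prev_next]; exact P.Γ_not_clamped) hk
  have s1 := hs k1
  have s2 := hs k2
  have e1 := he k1
  have e2 := he k2
  refine ⟨⟨by linarith, by linarith⟩, by linarith, by linarith⟩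

/-- The conditions are necessary. -/
theorem MemSigma.conditions {Φ : PlateStress × PlateStress} (hC : P.MemCs Φ) (h : P.MemSigma Φ) :
    P.MemHs Φ ∧ P.FreeBoundaryConditions Φ ∧ P.JunctionConditions Φ ∧ P.CornerConditions Φ :=
  ⟨(MemSigma.boundary hC h).1,
    ⟨⟨fun _ hi _ hs => MemSigma.freeEdge hC h hi hs,
      fun _ hi hi' _ => MemSigma.freeVertex hC h hi hi'⟩,
    ⟨fun _ hi _ hs => MemSigma.freeEdge' hC h hi hs,
      fun _ hi hi' _ => MemSigma.freeVertex' hC h hi hi'⟩⟩,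
    MemSigma.junction hC h, MemSigma.corners hC h⟩

end CoupledPlates

end Plates

end

theorem theorem3p4 (P : Plates.CoupledPlates) (Φ : Plates.PlateStress × Plates.PlateStress)
    (hL2 : P.MemVs Φ) (hC : P.MemCs Φ) :
    P.MemSigma Φ ↔
      P.MemHs Φ ∧ P.FreeBoundaryConditions Φ ∧ P.JunctionConditions Φ ∧ P.CornerConditions Φ :=
  ⟨fun h => h.conditions hC, fun h => P.memSigma_of_conditions hC h.1 h.2.1 h.2.2.1 h.2.2.2⟩
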